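/- **Notation.** For an open set $\Omega\subset\mathbb C^N$ let $A^2(\Omega)$ be the space of holomorphic functions in $L^2(\Omega)$ (Lebesgue measure $dV$), and let $K_\Omega(w,z)$ be the Bergman kernel, i.e. $K_\Omega(\cdot,z)\in A^2(\Omega)$ and $f(z)=\int_\Omega f(w)\overline{K_\Omega(w,z)}\,dV(w)$ for all $f\in A^2(\Omega)$, $z\in\Omega$. Put $k_z(w)=K_\Omega(w,z)/\sqrt{K_\Omega(z,z)}$. The Berezin transform and the absolute Bergman projection are $$B_\Omega\phi(z)=\int_\Omega\phi(w)\,|k_z(w)|^2\,dV(w),\qquad P^+_\Omega f(z)=\int_\Omega |K_\Omega(z,w)|\,f(w)\,dV(w),$$ and $\|\cdot\|_{L^p}$ denotes the operator norm on $L^p$. **Sharp $\mathcal B$-type.** Let $n\ge 1$ and let $\Omega=\{r<0\}\subset\mathbb C^n$ be a bounded domain, where $r\in C^\infty(\mathbb C^n,\mathbb R)$ and $dr\ne0$ on $b\Omega$. The Bergman kernel of $\Omega$ is of *sharp $\mathcal B$-type* if (a) $K_\Omega$ is locally bounded on $\overline\Omega\times\overline\Omega$ away from the boundary diagonal $\{(p,p):p\in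 b\Omega\}$; that is, every point of $\overline\Omega\times\overline\Omega$ off this diagonal has a neighbourhood on whose intersection with $\Omega\times\Omega$ the kernel is bounded; and (b) every $p\in b\Omega$ has an open neighbourhood $U$ with constants $\delta_0,C>0$ such that for all $z\in\Omega\cap U$ and $0<\delta\le\delta_0$ there are a holomorphic map $\zeta=\zeta_{z,\delta}:U\to\mathbb C^n$ with $\zeta(z)=0$ and numbers $b_1(z,\delta),\dots,b_n(z,\delta)>0$ with the following properties. * $C^{-1}|w-w'|\le|\zeta(w)-\zeta(w')|\le C|w-w'|$ on $U$, and in the coordinates $\zeta$ one has $\partial r/\partial(\operatorname{Re}\zeta_1)\ge C^{-1}$ on $U$. * $b_1(z,\delta)=1/\delta$ and $b_j(z,\delta)\le C/\delta$; $b_j(z,\delta')\le C\,b_j(z,\delta)$ for $\delta\le\delta'\le\delta_0$; and $b_j(z,\delta)\le C\,b_j(z,\delta')$ if in addition $\delta'\le2\delta$. * For $t>0$ put $P^t_\delta(z)=\{w\in U: b_j(z,\delta)\,|(\zeta_{z,\delta}(w))_j|<t \text{ for all } j\}$. Then $P^1_\delta(z)\subset P^{C}_{\delta'}(z)$ for $\delta\le\delta'\le\delta_0$.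 * Let $M(z,w)$ be the minimum of $\delta_0$ and $\inf\{\delta\in(0,\delta_0]:w\in P^1_\delta(z)\}$ (with $\inf\emptyset=\infty$), and let $\delta(z,w)=\min\{\delta_0,\,|r(z)|+|r(w)|+M(z,w)\}$. Then $$|K_\Omega(z,w)|\le C\prod_{j=1}^n b_j(z,\delta(z,w))^2\quad(z,w\in\Omega\cap U),$$ $$K_\Omega(z,z)\ge C^{-1}\prod_{j=1}^n b_j(z,|r(z)|)^2\quad(z\in\Omega\cap U,\ |r(z)|\le\delta_0).$$ **Theorem.** Let $\Omega=\Omega_1\times\dots\times\Omega_m$ be a finite product of bounded domains $\Omega_j\subset\mathbb C^{n_j}$ whose Bergman kernels are of sharp $\mathcal B$-type. Then the Berezin transform $B_\Omega:L^p(\Omega)\to L^p(\Omega)$ is (well defined by the integral above and) bounded for all $1<p\le\infty$. Moreover $K_\Omega(z,z)\neq0$ for all $z\in\Omega$, $\sup_{z,w\in\Omega}|K_\Omega(w,z)|/K_\Omega(z,z)<\infty$, and for $1<p<\infty$ every $P^+_{\Omega_j}$ is bounded on $L^p(\Omega_j)$ and $$\|B_\Omega\|_{L^p}\le\sup\left\{\frac{|K_\Omega(w,z)|}{K_\Omega(z,z)}:z,w\in\Omega\right\}\,\|P^+_{\Omega_1}\|_{L^p}\cdots\|P^+_{\Omega_m}\|_{L^p}.$$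 -/

import Mathlib

open MeasureTheory Set Filter Topology
open scoped ENNReal ContDiff

noncomputable section

/-! ### Bergman space, Bergman kernel, Berezin transform -/

section Bergman

variable {E : Type*} [NormedAddCommGroup E] [NormedSpace ℂ E] [MeasureSpace E]

/-- `f` belongs to the Bergman space `A²(Ω)`: it is holomorphic and square integrable on `Ω`. -/
def MemBergmanSpace (Ω : Set E) (f : E → ℂ) : Prop :=
  DifferentiableOn ℂ f Ω ∧ MemLp f 2 (volume.restrict Ω)

/-- `k` is in `A²(Ω)` and represents evaluation at `z`: `f(z) = ⟨f, k⟩` for all `f ∈ A²(Ω)`.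
By the Riesz theorem such a `k` exists for `z` in an open set `Ω ⊆ ℂⁿ`, and it is unique on `Ω`. -/
def IsReproducingAt (Ω : Set E) (z : E) (k : E → ℂ) : Prop :=
  MemBergmanSpace Ω k ∧
    ∀ f : E → ℂ, MemBergmanSpace Ω f → ∫ w in Ω, f w * (starRingEnd ℂ) (k w) = f z

open Classical in
/-- The Bergman kernel `K_Ω(w, z)`, holomorphic in `w` and antiholomorphic in `z`
(only its values for `z, w ∈ Ω` are meaningful). -/
def bergmanKernel (Ω : Set E) (w z : E) : ℂ :=
  if h : ∃ k : E → ℂ, IsReproducingAt Ω z k then h.choose w else 0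

/-- The normalized Bergman kernel `k_z(w) = K_Ω(w, z) / √K_Ω(z, z)`. -/
def normalizedKernel (Ω : Set E) (z w : E) : ℂ :=
  bergmanKernel Ω w z / (Real.sqrt (bergmanKernel Ω z z).re : ℂ)

/-- The integral operator `f ↦ (z ↦ ∫_Ω k(z, w) f(w) dV(w))` with a real kernel `k`. -/
def integralOp (Ω : Set E) (k : E → E → ℝ) (f : E → ℂ) (z : E) : ℂ :=
  ∫ w in Ω, (k z w : ℂ) * f w

/-- The kernel `|K_Ω(z, w)|` of the absolute Bergman projection `P⁺_Ω`. -/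
def absBergmanKernel (Ω : Set E) (z w : E) : ℝ := ‖bergmanKernel Ω z w‖

/-- The kernel `|k_z(w)|²` of the Berezin transform `B_Ω`, so that
`B_Ω φ(z) = ∫_Ω φ(w) |k_z(w)|² dV(w) = ⟨φ k_z, k_z⟩`. -/
def berezinKernel (Ω : Set E) (z w : E) : ℝ := ‖normalizedKernel Ω z w‖ ^ 2

/-- The integral operator with kernel `k` is bounded on `L^p(Ω)`: for every `f ∈ L^p(Ω)` the
defining integral converges absolutely at every point of `Ω`, the resulting function is in
`L^p(Ω)`, and its norm is at most a finite constant times the norm of `f`. -/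
def IsBoundedOnLp (Ω : Set E) (p : ℝ≥0∞) (k : E → E → ℝ) : Prop :=
  (∀ f : E → ℂ, MemLp f p (volume.restrict Ω) →
    (∀ z ∈ Ω, IntegrableOn (fun w => (k z w : ℂ) * f w) Ω) ∧
    MemLp (integralOp Ω k f) p (volume.restrict Ω)) ∧
  ∃ C : ℝ≥0∞, C ≠ ⊤ ∧ ∀ f : E → ℂ, MemLp f p (volume.restrict Ω) →
    eLpNorm (integralOp Ω k f) p (volume.restrict Ω) ≤ C * eLpNorm f p (volume.restrict Ω)

/-- The operator norm on `L^p(Ω)` of the integral operator with kernel `k`. -/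
def lpOpNorm (Ω : Set E) (p : ℝ≥0∞) (k : E → E → ℝ) : ℝ≥0∞ :=
  sInf {C : ℝ≥0∞ | ∀ f : E → ℂ, MemLp f p (volume.restrict Ω) →
    eLpNorm (integralOp Ω k f) p (volume.restrict Ω) ≤ C * eLpNorm f p (volume.restrict Ω)}

/-- `sup { |K_Ω(w, z)| / K_Ω(z, z) : z, w ∈ Ω }`, as an element of `[0, ∞]`. -/
def kernelRatioSup (Ω : Set E) : ℝ≥0∞ :=
  ⨆ z ∈ Ω, ⨆ w ∈ Ω, ‖bergmanKernel Ω w z‖ₑ / ‖bergmanKernel Ω z z‖ₑ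

end Bergman

/-! ### Bergman kernels of sharp `𝓑`-type

`ℂⁿ` is `Fin n → ℂ`; its norm enters only through boundedness and two-sided Lipschitz bounds with
unspecified constants, so that the choice of the norm is immaterial. -/

section BType

variable {n : ℕ} [NeZero n]

/-- `r` is a smooth defining function of `Ω`. -/
def IsSmoothDefining (Ω : Set (Fin n → ℂ)) (r : (Fin n → ℂ) → ℝ) : Prop :=
  ContDiff ℝ ∞ r ∧ Ω = {z | r z < 0} ∧ ∀ z ∈ frontier Ω, fderiv ℝ r z ≠ 0

/-- The nonisotropic polydisc `P_δ(z) = {w ∈ U : |ζ_j(w)| < 1 / b_j(z, δ) for all j}`, dilated by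
`t`, where `ζ = Φ z δ` are the coordinates attached to `z` and `δ`. -/
def bPolydisc (U : Set (Fin n → ℂ)) (Φ : (Fin n → ℂ) → ℝ → (Fin n → ℂ) → (Fin n → ℂ))
    (b : Fin n → (Fin n → ℂ) → ℝ → ℝ) (z : Fin n → ℂ) (δ t : ℝ) : Set (Fin n → ℂ) :=
  {w | w ∈ U ∧ ∀ j, b j z δ * ‖Φ z δ w j‖ < t}

/-- A `𝓑`-system for `Ω = {r < 0}` on the open set `U`, for the scales `0 < δ ≤ δ₀` and with the
uniform constant `C`: holomorphic coordinates `ζ = Φ z δ` on `U`, centred at `z`, and functions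
`b 0, …, b (n-1)` (reciprocals of the radii of polydiscs in these coordinates). The coordinate of
index `0` is the complex normal one. -/
structure IsBSystem (Ω : Set (Fin n → ℂ)) (r : (Fin n → ℂ) → ℝ) (U : Set (Fin n → ℂ)) (δ₀ C : ℝ)
    (Φ : (Fin n → ℂ) → ℝ → (Fin n → ℂ) → (Fin n → ℂ))
    (b : Fin n → (Fin n → ℂ) → ℝ → ℝ) : Prop where
  scale_pos : 0 < δ₀
  const_pos : 0 < C
  isOpen : IsOpen U
  holo : ∀ z ∈ Ω ∩ U, ∀ δ ∈ Ioc 0 δ₀, DifferentiableOn ℂ (Φ z δ) U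
  centre : ∀ z ∈ Ω ∩ U, ∀ δ ∈ Ioc 0 δ₀, Φ z δ z = 0
  lipschitz : ∀ z ∈ Ω ∩ U, ∀ δ ∈ Ioc 0 δ₀, ∀ w ∈ U, ∀ w' ∈ U,
    ‖Φ z δ w - Φ z δ w'‖ ≤ C * ‖w - w'‖
  antilipschitz : ∀ z ∈ Ω ∩ U, ∀ δ ∈ Ioc 0 δ₀, ∀ w ∈ U, ∀ w' ∈ U,
    ‖w - w'‖ ≤ C * ‖Φ z δ w - Φ z δ w'‖
  /-- `∂r / ∂(Re ζ_0) ≥ 1 / C` on `U` -/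
  transversal : ∀ z ∈ Ω ∩ U, ∀ δ ∈ Ioc 0 δ₀, ∀ w ∈ U, ∀ v : Fin n → ℂ,
    fderiv ℂ (Φ z δ) w v = Pi.single 0 1 → 1 / C ≤ fderiv ℝ r w v
  b_pos : ∀ z ∈ Ω ∩ U, ∀ δ ∈ Ioc 0 δ₀, ∀ j, 0 < b j z δ
  b_normal : ∀ z ∈ Ω ∩ U, ∀ δ ∈ Ioc 0 δ₀, b 0 z δ = 1 / δ
  b_le : ∀ z ∈ Ω ∩ U, ∀ δ ∈ Ioc 0 δ₀, ∀ j, b j z δ ≤ C / δ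
  b_almost_antitone : ∀ z ∈ Ω ∩ U, ∀ δ ∈ Ioc 0 δ₀, ∀ δ' ∈ Ioc 0 δ₀, δ ≤ δ' →
    ∀ j, b j z δ' ≤ C * b j z δ
  b_doubling : ∀ z ∈ Ω ∩ U, ∀ δ ∈ Ioc 0 δ₀, ∀ δ' ∈ Ioc 0 δ₀, δ ≤ δ' → δ' ≤ 2 * δ →
    ∀ j, b j z δ ≤ C * b j z δ'
  nested : ∀ z ∈ Ω ∩ U, ∀ δ ∈ Ioc 0 δ₀, ∀ δ' ∈ Ioc 0 δ₀, δ ≤ δ' →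
    bPolydisc U Φ b z δ 1 ⊆ bPolydisc U Φ b z δ' C

/-- The quasi-distance `M(z, w) = inf {δ : w ∈ P_δ(z)}`, truncated at `δ₀`. -/
def bDist (U : Set (Fin n → ℂ)) (δ₀ : ℝ) (Φ : (Fin n → ℂ) → ℝ → (Fin n → ℂ) → (Fin n → ℂ))
    (b : Fin n → (Fin n → ℂ) → ℝ → ℝ) (z w : Fin n → ℂ) : ℝ :=
  sInf (insert δ₀ {δ | δ ∈ Ioc 0 δ₀ ∧ w ∈ bPolydisc U Φ b z δ 1})

/-- The quantity `δ(z, w) = |r(z)| + |r(w)| + M(z, w)`, truncated at `δ₀`. -/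
def bScale (r : (Fin n → ℂ) → ℝ) (U : Set (Fin n → ℂ)) (δ₀ : ℝ)
    (Φ : (Fin n → ℂ) → ℝ → (Fin n → ℂ) → (Fin n → ℂ))
    (b : Fin n → (Fin n → ℂ) → ℝ → ℝ) (z w : Fin n → ℂ) : ℝ :=
  min δ₀ (|r z| + |r w| + bDist U δ₀ Φ b z w)

/-- The Bergman kernel of `Ω = {r < 0}` is of sharp `𝓑`-type at the boundary point `p`: for some
`𝓑`-system on a neighbourhood `U` of `p`,
`|K(z, w)| ≤ C ∏ b_j(z, δ(z, w))²` and `K(z, z) ≥ C⁻¹ ∏ b_j(z, |r(z)|)²` in `Ω ∩ U`. -/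
def IsSharpBTypeAt (Ω : Set (Fin n → ℂ)) (r : (Fin n → ℂ) → ℝ) (p : Fin n → ℂ) : Prop :=
  ∃ (U : Set (Fin n → ℂ)) (δ₀ C : ℝ) (Φ : (Fin n → ℂ) → ℝ → (Fin n → ℂ) → (Fin n → ℂ))
    (b : Fin n → (Fin n → ℂ) → ℝ → ℝ),
    p ∈ U ∧ IsBSystem Ω r U δ₀ C Φ b ∧
    (∀ z ∈ Ω ∩ U, ∀ w ∈ Ω ∩ U,
      ‖bergmanKernel Ω z w‖ ≤ C * ∏ j, b j z (bScale r U δ₀ Φ b z w) ^ 2) ∧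
    (∀ z ∈ Ω ∩ U, |r z| ≤ δ₀ → ∏ j, b j z |r z| ^ 2 ≤ C * (bergmanKernel Ω z z).re)

/-- The Bergman kernel is locally bounded on `Ω̄ × Ω̄` away from the boundary diagonal
`{(p, p) : p ∈ bΩ}`. -/
def KernelBoundedOffDiagonal (Ω : Set (Fin n → ℂ)) : Prop :=
  ∀ p ∈ closure Ω, ∀ q ∈ closure Ω, ¬ (p = q ∧ p ∈ frontier Ω) →
    ∃ M : ℝ, ∃ V ∈ 𝓝 p, ∃ W ∈ 𝓝 q, ∀ z ∈ Ω ∩ V, ∀ w ∈ Ω ∩ W, ‖bergmanKernel Ω z w‖ ≤ M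

/-- `Ω` is a smoothly bounded domain in `ℂⁿ` whose Bergman kernel is of sharp `𝓑`-type. -/
structure IsSharpBTypeDomain (Ω : Set (Fin n → ℂ)) : Prop where
  isOpen : IsOpen Ω
  isConnected : IsConnected Ω
  isBounded : Bornology.IsBounded Ω
  offDiagonal : KernelBoundedOffDiagonal Ω
  sharpBType : ∃ r : (Fin n → ℂ) → ℝ, IsSmoothDefining Ω r ∧
    ∀ p ∈ frontier Ω, IsSharpBTypeAt Ω r p

end BType

end

/-!
The Berezin kernel is `|K(w, z)|² / K(z, z) ≤ S |K(z, w)|` with `S = sup |K(w, z)| / K(z, z)`, and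
the Bergman kernel of a product is the product of the Bergman kernels (`bergmanKernel_pi`). So for
`1 < p < ∞` the Berezin transform is dominated by `S` times the composition of the absolute Bergman
projections of the factors, acting on separate variables; by Tonelli's theorem the norm of this
composition is at most the product of the norms (`IsLpBoundedKernel.pi`). For `p = ∞` it is enough
that `|k_z|² dV` has mass `1`. It remains to show, for a single factor `Ω = {r < 0}`, that `S` is
finite and that the absolute projection is bounded.

The finiteness of `S` (`exists_norm_kernel_le_mul_self`) follows near the boundary diagonal by
comparing the upper bound for `K(z, w)` with the lower bound for `K(z, z)`, as `δ(z, w) ≥ |r(z)|`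
and the `b_j` are almost decreasing in `δ`. Elsewhere `K` is bounded, and `K(z, z) ≥ 1 / vol Ω`.

The absolute projection satisfies Schur's test (`isLpBoundedKernel_of_schur`) with a power of `|r|`,
once `∫ |K(z, w)| |r(w)| ^ (-s) dV(w) ≤ C |r(z)| ^ (-s)` is known for `0 < s < 1`
(`exists_lintegral_kernel_le`). Near a boundary point the integral is split according to the dyadic
size `δ = 2 ^ k |r(z)|` of `δ(z, w)`. The corresponding points `w` lie in a polydisc of radii
comparable to `1 / b_j(z, δ)` and in the layer `-δ < r < 0`, and there `|K(z, w)|` is at most a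
constant times `∏ b_j(z, δ)²`. As `r` increases in the direction of `Re ζ_0`, the layer
`-t < r < 0` cuts out of the polydisc at most a proportion of order `t / δ` of its volume
(`IsTransversalChart.volume_layer_le`). Hence the contribution of the scale `δ` is at most a
constant times `δ ^ (-s)`, and these contributions form a geometric series.

The existence of the Bergman kernel is part of the proof, since `bergmanKernel` has a default value
where no reproducing function exists: the mean value property over balls shows that `A²(Ω)` is
closed in `L²(Ω)` and that point evaluations are represented by projections of indicator functions
of balls (`exists_isReproducingAt`).
-/

/-! ### Holomorphic functions of several variables -/

section Holomorphic

variable {E F : Type*} [NormedAddCommGroup E] [NormedSpace ℂ E] [NormedAddCommGroup F]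
  [NormedSpace ℂ F]

theorem norm_fderiv_le_of_norm_le_on_ball {f : E → F} {c : E} {R M : ℝ} (hR : 0 < R)
    (hf : DifferentiableOn ℂ f (Metric.ball c R)) (hM : ∀ z ∈ Metric.ball c R, ‖f z‖ ≤ M) :
    ‖fderiv ℂ f c‖ ≤ 2 * M / R := by
  refine Complex.norm_fderiv_le_div_of_mapsTo_ball hf (fun z hz => ?_) hR
  rw [Metric.mem_closedBall, dist_eq_norm]
  have h1 := hM z hz
  have h2 := hM c (Metric.mem_ball_self hR)
  linarith [norm_sub_le (f z) (f c)]

/-- A holomorphic map of several variables is `C¹`: the Cauchy estimate is applied to the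
difference of two translates. -/
theorem continuousAt_fderiv_of_differentiableOn [ProperSpace E] {f : E → F} {U : Set E}
    (hU : IsOpen U) (hf : DifferentiableOn ℂ f U) {x : E} (hx : x ∈ U) :
    ContinuousAt (fderiv ℂ f) x := by
  obtain ⟨R, hR, hRU⟩ := Metric.nhds_basis_closedBall.mem_iff.1 (hU.mem_nhds hx)
  have huc : UniformContinuousOn f (Metric.closedBall x R) :=
    (isCompact_closedBall x R).uniformContinuousOn_of_continuous (hf.continuousOn.mono hRU)
  rw [Metric.continuousAt_iff]
  intro ε hε
  obtain ⟨δ, hδ, h⟩ := Metric.uniformContinuousOn_iff.1 huc (ε * R / 8) (by positivity)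
  refine ⟨min δ (R / 2), by positivity, fun {y} hy => ?_⟩
  have hyδ : dist y x < δ := hy.trans_le (min_le_left _ _)
  have hyR : dist y x < R / 2 := hy.trans_le (min_le_right _ _)
  have hball : ∀ z ∈ Metric.ball x (R / 2), z + (y - x) ∈ Metric.closedBall x R := by
    intro z hz
    rw [Metric.mem_ball, dist_eq_norm] at hz
    rw [dist_eq_norm] at hyR
    rw [Metric.mem_closedBall, dist_eq_norm]
    calc ‖z + (y - x) - x‖ = ‖(z - x) + (y - x)‖ := by congr 1; abel
      _ ≤ ‖z - x‖ + ‖y - x‖ := norm_add_le _ _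
      _ ≤ R := by linarith
  have hball' : ∀ z ∈ Metric.ball x (R / 2), z ∈ Metric.closedBall x R := fun z hz =>
    Metric.ball_subset_closedBall (Metric.ball_subset_ball (by linarith) hz)
  have hyU : y ∈ U := hRU (by simpa using hball x (Metric.mem_ball_self (by positivity)))
  have hd : ∀ z ∈ U, DifferentiableAt ℂ f z := fun z hz => hf.differentiableAt (hU.mem_nhds hz)
  have hderiv : fderiv ℂ (fun z => f (z + (y - x)) - f z) x = fderiv ℂ f y - fderiv ℂ f x := by
    have e : x + (y - x) = y := by abel
    have h1 : DifferentiableAt ℂ (fun z => f (z + (y - x))) x :=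
      DifferentiableAt.comp (g := f) x (by rw [e]; exact hd y hyU) (by fun_prop)
    rw [fderiv_fun_sub h1 (hd x hx), fderiv_comp_add_right, e]
  have key := norm_fderiv_le_of_norm_le_on_ball (f := fun z => f (z + (y - x)) - f z) (c := x)
    (R := R / 2) (M := ε * R / 8) (by positivity)
    (fun z hz => ((DifferentiableAt.comp (g := f) z (hd _ (hRU (hball z hz)))
      (by fun_prop)).sub (hd _ (hRU (hball' z hz)))).differentiableWithinAt)
    (fun z hz => by
      rw [← dist_eq_norm]
      refine (h _ (hball z hz) _ (hball' z hz) ?_).le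
      rw [dist_eq_norm] at hyδ ⊢
      simpa using hyδ)
  rw [hderiv] at key
  rw [dist_eq_norm]
  have : 2 * (ε * R / 8) / (R / 2) = ε / 2 := by field_simp; norm_num
  rw [this] at key
  linarith

theorem hasStrictFDerivAt_of_differentiableOn [ProperSpace E] {f : E → F} {U : Set E}
    (hU : IsOpen U) (hf : DifferentiableOn ℂ f U) {x : E} (hx : x ∈ U) :
    HasStrictFDerivAt f (fderiv ℂ f x) x :=
  hasStrictFDerivAt_of_hasFDerivAt_of_continuousAt
    (by filter_upwards [hU.mem_nhds hx] with y hy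
        exact (hf.differentiableAt (hU.mem_nhds hy)).hasFDerivAt)
    (continuousAt_fderiv_of_differentiableOn hU hf hx)

/-- Weierstrass: locally uniform limits of holomorphic functions of several variables are
holomorphic. By the Cauchy estimate the derivatives form a uniform Cauchy sequence. -/
theorem differentiableOn_of_uniformCauchySeqOn [CompleteSpace F] {f : ℕ → E → F}
    {g : E → F} {U : Set E} (hf : ∀ k, DifferentiableOn ℂ (f k) U)
    (hfg : ∀ x ∈ U, Tendsto (fun k => f k x) atTop (𝓝 (g x)))
    (hc : ∀ x ∈ U, ∃ R > 0, Metric.ball x R ⊆ U ∧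
      UniformCauchySeqOn f atTop (Metric.ball x R)) : DifferentiableOn ℂ g U := by
  intro x hx
  obtain ⟨R, hR, hRU, hcau⟩ := hc x hx
  have hsub : ∀ y ∈ Metric.ball x (R / 2), Metric.ball y (R / 2) ⊆ Metric.ball x R := by
    intro y hy
    refine Metric.ball_subset_ball' ?_
    rw [Metric.mem_ball] at hy
    linarith
  have hd : ∀ k, ∀ y ∈ Metric.ball x R, DifferentiableAt ℂ (f k) y := fun k y hy =>
    ((hf k).mono hRU).differentiableAt (Metric.isOpen_ball.mem_nhds hy)
  have hdc : UniformCauchySeqOn (fun k => fderiv ℂ (f k)) atTop (Metric.ball x (R / 2)) := by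
    rw [Metric.uniformCauchySeqOn_iff] at hcau ⊢
    intro ε hε
    obtain ⟨N, hN⟩ := hcau (ε * R / 8) (by positivity)
    refine ⟨N, fun k hk l hl y hy => ?_⟩
    have hyR : y ∈ Metric.ball x R := Metric.ball_subset_ball (by linarith) hy
    have key := norm_fderiv_le_of_norm_le_on_ball (f := fun z => f k z - f l z) (c := y)
      (R := R / 2) (M := ε * R / 8) (by positivity)
      (fun z hz => ((hd k z (hsub y hy hz)).sub (hd l z (hsub y hy hz))).differentiableWithinAt)
      (fun z hz => by
        rw [← dist_eq_norm]
        exact (hN k hk l hl z (hsub y hy hz)).le)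
    rw [fderiv_fun_sub (hd k y hyR) (hd l y hyR)] at key
    have e : 2 * (ε * R / 8) / (R / 2) = ε / 2 := by field_simp; norm_num
    rw [e] at key
    rw [dist_eq_norm]
    linarith
  choose! g' hg' using fun y (hy : y ∈ Metric.ball x (R / 2)) =>
    cauchySeq_tendsto_of_complete (hdc.cauchySeq hy)
  refine (hasFDerivAt_of_tendstoUniformlyOn Metric.isOpen_ball
    (hdc.tendstoUniformlyOn_of_tendsto hg')
    (fun k y hy => (hd k y (Metric.ball_subset_ball (by linarith) hy)).hasFDerivAt)
    (fun y hy => hfg y (hRU (Metric.ball_subset_ball (by linarith) hy)))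
    (Metric.mem_ball_self (by positivity))).differentiableAt.differentiableWithinAt

end Holomorphic

/-! ### The mean value property and existence of the Bergman kernel -/

section MeanValue

variable {n : ℕ}

theorem measurePreserving_unit_smul {c : ℂ} (hc : ‖c‖ = 1) :
    MeasurePreserving (fun v : Fin n → ℂ => c • v) :=
  volume_preserving_pi (f := fun (_ : Fin n) (x : ℂ) => c * x)
    (fun _ => (rotation ⟨c, by simp [Submonoid.unitSphere, hc]⟩).measurePreserving)

/-- The mean value property over balls of `ℂⁿ`: average the one-variable mean value property on
the circles `θ ↦ c + exp(iθ) v` over all `v` in the ball, and use that `v ↦ exp(iθ) v` preserves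
the ball and the volume. -/
theorem setIntegral_ball_of_differentiableOn {f : (Fin n → ℂ) → ℂ} {U : Set (Fin n → ℂ)}
    (hf : DifferentiableOn ℂ f U) {c : Fin n → ℂ} {R : ℝ} (hR : Metric.closedBall c R ⊆ U)
    (hU : IsOpen U) :
    ∫ w in Metric.ball c R, f w = (volume.real (Metric.ball (0 : Fin n → ℂ) R) : ℂ) * f c := by
  set B := Metric.ball (0 : Fin n → ℂ) R with hB
  have htrans : ∫ w in Metric.ball c R, f w = ∫ v in B, f (c + v) := by
    rw [← (measurePreserving_add_left volume c).setIntegral_preimage_emb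
      (measurableEmbedding_addLeft c)]
    simp [hB]
  have hmaps : ∀ θ : ℝ, ∀ v ∈ Metric.closedBall (0 : Fin n → ℂ) R,
      c + circleMap 0 1 θ • v ∈ U := by
    intro θ v hv
    apply hR
    rw [mem_closedBall_zero_iff] at hv
    simpa [norm_smul] using hv
  have hrot : ∀ θ : ℝ, ∫ v in B, f (c + circleMap 0 1 θ • v) = ∫ v in B, f (c + v) := by
    intro θ
    have hmp := measurePreserving_unit_smul (n := n) (c := circleMap 0 1 θ) (by simp)
    have hemb : MeasurableEmbedding (fun v : Fin n → ℂ => circleMap 0 1 θ • v) :=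
      (Homeomorph.smulOfNeZero (circleMap 0 1 θ) (by simp)).measurableEmbedding
    have hpre : (fun v : Fin n → ℂ => circleMap 0 1 θ • v) ⁻¹' B = B := by
      ext v; simp [hB, norm_smul]
    have := hmp.setIntegral_preimage_emb hemb (fun v => f (c + v)) B
    rwa [hpre] at this
  have hmean : ∀ v ∈ B, ∫ θ in Ioc 0 (2 * Real.pi), f (c + circleMap 0 1 θ • v)
      = ((2 * Real.pi : ℝ) : ℂ) * f c := by
    intro v hv
    have hd : DifferentiableOn ℂ (fun ζ : ℂ => f (c + ζ • v)) (Metric.closedBall 0 1) := by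
      intro ζ hζ
      have hm : c + ζ • v ∈ U := by
        apply hR
        rw [mem_closedBall_zero_iff] at hζ
        rw [hB, mem_ball_zero_iff] at hv
        rw [mem_closedBall_iff_norm, add_sub_cancel_left, norm_smul]
        nlinarith [norm_nonneg v, norm_nonneg ζ]
      exact (DifferentiableAt.comp (g := f) ζ (hf.differentiableAt (hU.mem_nhds hm))
        (by fun_prop)).differentiableWithinAt
    have h := DiffContOnCl.circleAverage (f := fun ζ : ℂ => f (c + ζ • v)) (c := 0) (R := 1)
      (DifferentiableOn.diffContOnCl (by
        rw [abs_one, closure_ball _ one_ne_zero]; exact hd))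
    rw [Real.circleAverage_def, intervalIntegral.integral_of_le (by positivity)] at h
    simp only [zero_smul, add_zero] at h
    rw [← h, Complex.real_smul, ← mul_assoc, ← Complex.ofReal_mul, mul_inv_cancel₀ (by positivity),
      Complex.ofReal_one, one_mul]
  have hint : Integrable (Function.uncurry fun (θ : ℝ) (v : Fin n → ℂ) =>
      f (c + circleMap 0 1 θ • v))
      ((volume.restrict (Ioc 0 (2 * Real.pi))).prod (volume.restrict B)) := by
    rw [Measure.prod_restrict]
    refine IntegrableOn.mono_set (t := Icc 0 (2 * Real.pi) ×ˢ Metric.closedBall 0 R) ?_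
      (prod_mono Ioc_subset_Icc_self Metric.ball_subset_closedBall)
    refine ContinuousOn.integrableOn_compact (isCompact_Icc.prod (isCompact_closedBall _ _)) ?_
    refine hf.continuousOn.comp (by fun_prop) ?_
    rintro ⟨θ, v⟩ ⟨_, hv⟩
    exact hmaps θ v hv
  have hswap := integral_integral_swap hint
  simp only [hrot] at hswap
  rw [setIntegral_congr_fun (g := fun _ => ((2 * Real.pi : ℝ) : ℂ) * f c)
    Metric.isOpen_ball.measurableSet hmean] at hswap
  simp only [integral_const, Measure.real, Measure.restrict_apply MeasurableSet.univ, univ_inter,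
    Real.volume_Ioc, sub_zero, ENNReal.toReal_ofReal Real.two_pi_pos.le, Complex.real_smul]
    at hswap
  have hpi : ((2 * Real.pi : ℝ) : ℂ) ≠ 0 := by
    rw [Complex.ofReal_ne_zero]; positivity
  rw [htrans]
  apply mul_left_cancel₀ hpi
  rw [hswap, Measure.real]
  ring

/-- The classes in `L²(Ω)` that have a holomorphic representative. -/
noncomputable def bergmanSubmodule (Ω : Set (Fin n → ℂ)) : Submodule ℂ (Lp ℂ 2 (volume.restrict Ω)) where
  carrier := {g | ∃ f : (Fin n → ℂ) → ℂ, DifferentiableOn ℂ f Ω ∧ g =ᵐ[volume.restrict Ω] f}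
  add_mem' := by
    rintro a b ⟨f, hf, hfa⟩ ⟨g, hg, hgb⟩
    exact ⟨f + g, hf.add hg, (Lp.coeFn_add a b).trans (hfa.add hgb)⟩
  zero_mem' := ⟨0, differentiableOn_const 0, Lp.coeFn_zero _ _ _⟩
  smul_mem' := by
    rintro c a ⟨f, hf, hfa⟩
    exact ⟨c • f, hf.const_smul c, (Lp.coeFn_smul c a).trans (hfa.const_smul c)⟩

variable {Ω : Set (Fin n → ℂ)}

/-- The indicator function of a ball, as an element of `L²(Ω)`. -/
noncomputable def ballIndicatorLp (Ω : Set (Fin n → ℂ)) (c : Fin n → ℂ) (R : ℝ) :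
    Lp ℂ 2 (volume.restrict Ω) :=
  indicatorConstLp 2 (Metric.isOpen_ball (x := c) (ε := R)).measurableSet
    ((Measure.restrict_apply_le _ _).trans_lt measure_ball_lt_top).ne 1

/-- By the mean value property, evaluation at `c` is, up to a constant, the pairing with the
indicator function of a ball. -/
theorem inner_ballIndicatorLp (hΩ : IsOpen Ω) {c : Fin n → ℂ} {R : ℝ}
    (hR : Metric.closedBall c R ⊆ Ω) {g : Lp ℂ 2 (volume.restrict Ω)} {f : (Fin n → ℂ) → ℂ}
    (hf : DifferentiableOn ℂ f Ω) (hg : g =ᵐ[volume.restrict Ω] f) :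
    inner ℂ (ballIndicatorLp Ω c R) g
      = (volume.real (Metric.ball (0 : Fin n → ℂ) R) : ℂ) * f c := by
  rw [ballIndicatorLp, L2.inner_indicatorConstLp_one,
    integral_congr_ae (ae_restrict_of_ae hg), Measure.restrict_restrict
    Metric.isOpen_ball.measurableSet, inter_eq_left.2 (Metric.ball_subset_closedBall.trans hR)]
  exact setIntegral_ball_of_differentiableOn hf hR hΩ

theorem norm_le_of_mem_bergmanSubmodule (hΩ : IsOpen Ω) {c : Fin n → ℂ} {R : ℝ} (hR0 : 0 < R)
    (hR : Metric.closedBall c R ⊆ Ω) {g : Lp ℂ 2 (volume.restrict Ω)} {f : (Fin n → ℂ) → ℂ}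
    (hf : DifferentiableOn ℂ f Ω) (hg : g =ᵐ[volume.restrict Ω] f) :
    ‖f c‖ ≤ (volume.real (Metric.ball (0 : Fin n → ℂ) R))⁻¹
      * volume.real (Metric.ball (0 : Fin n → ℂ) R) ^ (1 / 2 : ℝ) * ‖g‖ := by
  have hpos : 0 < volume.real (Metric.ball (0 : Fin n → ℂ) R) :=
    ENNReal.toReal_pos (Metric.measure_ball_pos _ _ hR0).ne' measure_ball_lt_top.ne
  have h := norm_inner_le_norm (𝕜 := ℂ) (ballIndicatorLp Ω c R) g
  have hvol : (volume.restrict Ω).real (Metric.ball c R)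
      = volume.real (Metric.ball (0 : Fin n → ℂ) R) := by
    rw [Measure.real, Measure.restrict_apply Metric.isOpen_ball.measurableSet,
      inter_eq_left.2 (Metric.ball_subset_closedBall.trans hR), Measure.real,
      Measure.addHaar_ball_center]
  rw [inner_ballIndicatorLp hΩ hR hf hg, norm_mul, Complex.norm_real,
    Real.norm_of_nonneg hpos.le] at h
  have h2 : ‖ballIndicatorLp Ω c R‖ = volume.real (Metric.ball (0 : Fin n → ℂ) R) ^ (1 / 2 : ℝ) := by
    rw [ballIndicatorLp, norm_indicatorConstLp (by norm_num) (by norm_num), hvol]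
    simp
  rw [h2] at h
  rw [mul_assoc, ← div_eq_inv_mul, le_div_iff₀ hpos]
  linarith

theorem isClosed_bergmanSubmodule (hΩ : IsOpen Ω) :
    IsClosed (bergmanSubmodule Ω : Set (Lp ℂ 2 (volume.restrict Ω))) := by
  apply IsSeqClosed.isClosed
  intro g g₀ hg hlim
  choose f hf hfg using hg
  have hunif : ∀ x ∈ Ω, ∃ R > 0, Metric.ball x R ⊆ Ω ∧
      UniformCauchySeqOn f atTop (Metric.ball x R) := by
    intro x hx
    obtain ⟨R, hR, hRΩ⟩ := Metric.nhds_basis_closedBall.mem_iff.1 (hΩ.mem_nhds hx)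
    refine ⟨R / 2, by positivity, (Metric.ball_subset_closedBall.trans
      (Metric.closedBall_subset_closedBall (by linarith))).trans hRΩ, ?_⟩
    rw [Metric.uniformCauchySeqOn_iff]
    intro ε hε
    set C := (volume.real (Metric.ball (0 : Fin n → ℂ) (R / 2)))⁻¹
      * volume.real (Metric.ball (0 : Fin n → ℂ) (R / 2)) ^ (1 / 2 : ℝ) with hC
    have hC0 : 0 ≤ C := by positivity
    obtain ⟨N, hN⟩ := Metric.cauchySeq_iff.1 hlim.cauchySeq (ε / (C + 1)) (by positivity)
    refine ⟨N, fun k hk l hl y hy => ?_⟩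
    have hsub : Metric.closedBall y (R / 2) ⊆ Ω := by
      refine (Metric.closedBall_subset_closedBall' ?_).trans hRΩ
      rw [Metric.mem_ball] at hy
      linarith
    have h := norm_le_of_mem_bergmanSubmodule hΩ (half_pos hR) hsub ((hf k).sub (hf l))
      ((Lp.coeFn_sub (g k) (g l)).trans ((hfg k).sub (hfg l)))
    have h2 := hN k hk l hl
    rw [dist_eq_norm] at h2 ⊢
    calc ‖f k y - f l y‖ ≤ C * ‖g k - g l‖ := h
      _ ≤ C * (ε / (C + 1)) := by gcongr
      _ < ε := by
        rw [mul_div_assoc', div_lt_iff₀ (by positivity)]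
        nlinarith
  have hpt : ∀ x ∈ Ω, ∃ y, Tendsto (fun k => f k x) atTop (𝓝 y) := by
    intro x hx
    obtain ⟨R, hR, -, hc⟩ := hunif x hx
    exact cauchySeq_tendsto_of_complete (hc.cauchySeq (Metric.mem_ball_self hR))
  choose! f₀ hf₀ using hpt
  refine ⟨f₀, differentiableOn_of_uniformCauchySeqOn hf hf₀ hunif, ?_⟩
  obtain ⟨ns, hns, hae⟩ := (tendstoInMeasure_of_tendsto_Lp hlim).exists_seq_tendsto_ae
  filter_upwards [hae, ae_all_iff.2 hfg, ae_restrict_mem hΩ.measurableSet] with x h1 h2 h3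
  refine tendsto_nhds_unique h1 ?_
  simp only [h2]
  exact (hf₀ x h3).comp hns.tendsto_atTop

/-- Existence of the Bergman kernel: `K(·, z)` is the orthogonal projection onto `A²(Ω)` of the
normalized indicator function of a ball about `z`. -/
theorem exists_isReproducingAt (hΩ : IsOpen Ω) {z : Fin n → ℂ} (hz : z ∈ Ω) :
    ∃ k, IsReproducingAt Ω z k := by
  obtain ⟨R, hR, hRΩ⟩ := Metric.nhds_basis_closedBall.mem_iff.1 (hΩ.mem_nhds hz)
  have : CompleteSpace (bergmanSubmodule Ω) := (isClosed_bergmanSubmodule hΩ).completeSpace_coe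
  have hpos : 0 < volume.real (Metric.ball (0 : Fin n → ℂ) R) :=
    ENNReal.toReal_pos (Metric.measure_ball_pos _ _ hR).ne' measure_ball_lt_top.ne
  set c : ℂ := (((volume.real (Metric.ball (0 : Fin n → ℂ) R))⁻¹ : ℝ) : ℂ) with hc
  set κ : Lp ℂ 2 (volume.restrict Ω) :=
    (bergmanSubmodule Ω).starProjection (c • ballIndicatorLp Ω z R) with hκ
  obtain ⟨k, hk, hκk⟩ : κ ∈ bergmanSubmodule Ω := Submodule.starProjection_apply_mem _ _
  refine ⟨k, ⟨hk, (Lp.memLp κ).ae_eq hκk⟩, fun f hf => ?_⟩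
  set F := hf.2.toLp f with hF
  have hFf : F =ᵐ[volume.restrict Ω] f := hf.2.coeFn_toLp
  have hFV : F ∈ bergmanSubmodule Ω := ⟨f, hf.1, hFf⟩
  have h1 : inner ℂ κ F = f z := by
    rw [hκ, Submodule.inner_starProjection_left_eq_right,
      Submodule.starProjection_eq_self_iff.2 hFV, inner_smul_left,
      inner_ballIndicatorLp hΩ hRΩ hf.1 hFf, hc, Complex.conj_ofReal, ← mul_assoc,
      ← Complex.ofReal_mul, inv_mul_cancel₀ hpos.ne', Complex.ofReal_one, one_mul]
  rw [← h1, L2.inner_def]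
  refine integral_congr_ae ?_
  filter_upwards [hκk, hFf] with w h1 h2
  rw [h1, h2, RCLike.inner_apply]

end MeanValue

/-! ### The Bergman kernel: symmetry, values on the diagonal, measurability -/

section Kernel

variable {E : Type*} [NormedAddCommGroup E] [NormedSpace ℂ E] [MeasureSpace E] {Ω : Set E}

theorem isReproducingAt_bergmanKernel {z : E} (h : ∃ k, IsReproducingAt Ω z k) :
    IsReproducingAt Ω z (fun w => bergmanKernel Ω w z) := by
  simp only [bergmanKernel, dif_pos h]
  exact h.choose_spec

/-- Any function reproducing at `z` agrees on `Ω` with `w ↦ conj K(z, w)`; so the kernel is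
unique on `Ω`, and it is Hermitian symmetric. -/
theorem IsReproducingAt.eq_conj_bergmanKernel {z w : E} {k : E → ℂ} (hk : IsReproducingAt Ω z k)
    (hw : ∃ k, IsReproducingAt Ω w k) : k w = (starRingEnd ℂ) (bergmanKernel Ω z w) := by
  have hKw := isReproducingAt_bergmanKernel hw
  rw [← hk.2 _ hKw.1, ← hKw.2 _ hk.1, ← integral_conj]
  refine integral_congr_ae (Eventually.of_forall fun x => ?_)
  simp [mul_comm]

variable (hex : ∀ z ∈ Ω, ∃ k, IsReproducingAt Ω z k)

include hex

theorem IsReproducingAt.eq_bergmanKernel {z w : E} (hz : z ∈ Ω) (hw : w ∈ Ω) {k : E → ℂ}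
    (hk : IsReproducingAt Ω z k) : k w = bergmanKernel Ω w z := by
  rw [hk.eq_conj_bergmanKernel (hex w hw),
    ← (isReproducingAt_bergmanKernel (hex z hz)).eq_conj_bergmanKernel (hex w hw)]

theorem bergmanKernel_conj {z w : E} (hz : z ∈ Ω) (hw : w ∈ Ω) :
    bergmanKernel Ω w z = (starRingEnd ℂ) (bergmanKernel Ω z w) :=
  (isReproducingAt_bergmanKernel (hex z hz)).eq_conj_bergmanKernel (hex w hw)

theorem norm_bergmanKernel_comm {z w : E} (hz : z ∈ Ω) (hw : w ∈ Ω) :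
    ‖bergmanKernel Ω w z‖ = ‖bergmanKernel Ω z w‖ := by
  rw [bergmanKernel_conj hex hz hw, RCLike.norm_conj]

theorem bergmanKernel_self_eq_integral {z : E} (hz : z ∈ Ω) :
    bergmanKernel Ω z z = ((∫ w in Ω, ‖bergmanKernel Ω w z‖ ^ 2 : ℝ) : ℂ) := by
  have h := isReproducingAt_bergmanKernel (hex z hz)
  rw [← h.2 _ h.1, ← integral_complex_ofReal]
  refine integral_congr_ae (Eventually.of_forall fun x => ?_)
  simp [Complex.mul_conj, Complex.normSq_eq_norm_sq]

theorem bergmanKernel_self_re {z : E} (hz : z ∈ Ω) :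
    (bergmanKernel Ω z z).re = ∫ w in Ω, ‖bergmanKernel Ω w z‖ ^ 2 := by
  rw [bergmanKernel_self_eq_integral hex hz, Complex.ofReal_re]

theorem norm_bergmanKernel_self {z : E} (hz : z ∈ Ω) :
    ‖bergmanKernel Ω z z‖ = (bergmanKernel Ω z z).re := by
  rw [bergmanKernel_self_eq_integral hex hz, Complex.norm_real, Complex.ofReal_re,
    Real.norm_of_nonneg (integral_nonneg fun _ => by positivity)]

/-- Testing the reproducing property against the constant `1` gives `K(z, z) ≥ 1 / vol Ω`. -/
theorem one_le_volume_mul_bergmanKernel_self (hvol : volume Ω ≠ ⊤) {z : E} (hz : z ∈ Ω) :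
    0 < volume.real Ω ∧ 1 ≤ volume.real Ω * (bergmanKernel Ω z z).re := by
  have : IsFiniteMeasure (volume.restrict Ω) := ⟨by
    rw [Measure.restrict_apply_univ]; exact hvol.lt_top⟩
  have h := isReproducingAt_bergmanKernel (hex z hz)
  have h1 := h.2 (fun _ => 1) ⟨differentiableOn_const 1, memLp_const 1⟩
  have hint : Integrable (fun w => bergmanKernel Ω w z) (volume.restrict Ω) :=
    h.1.2.integrable (by norm_num)
  have hint2 := (memLp_two_iff_integrable_sq_norm h.1.2.1).1 h.1.2
  have hV : 0 < volume.real Ω := by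
    refine ENNReal.toReal_pos (fun h0 => ?_) hvol
    rw [Measure.restrict_eq_zero.2 h0] at h1
    simp at h1
  refine ⟨hV, ?_⟩
  have h2 : 1 ≤ ∫ w in Ω, ‖bergmanKernel Ω w z‖ := by
    have := norm_integral_le_integral_norm (μ := volume.restrict Ω)
      (fun w => (1 : ℂ) * (starRingEnd ℂ) (bergmanKernel Ω w z))
    rw [h1] at this
    simpa using this
  have h3 : ∫ w in Ω, 2 * ‖bergmanKernel Ω w z‖
      ≤ ∫ w in Ω, (volume.real Ω * ‖bergmanKernel Ω w z‖ ^ 2 + (volume.real Ω)⁻¹) := by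
    refine integral_mono (hint.norm.const_mul 2)
      ((hint2.const_mul _).add (integrable_const _)) fun w => ?_
    have hi : volume.real Ω * (volume.real Ω)⁻¹ = 1 := mul_inv_cancel₀ hV.ne'
    have hi0 : 0 < (volume.real Ω)⁻¹ := by positivity
    have : 0 ≤ (volume.real Ω)⁻¹ * (volume.real Ω * ‖bergmanKernel Ω w z‖ - 1) ^ 2 := by positivity
    calc 2 * ‖bergmanKernel Ω w z‖ = volume.real Ω * ‖bergmanKernel Ω w z‖ ^ 2
          + (volume.real Ω)⁻¹
          - (volume.real Ω)⁻¹ * (volume.real Ω * ‖bergmanKernel Ω w z‖ - 1) ^ 2 := by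
          field_simp; ring
      _ ≤ _ := by linarith
  rw [integral_const_mul, integral_add (hint2.const_mul _) (integrable_const _),
    integral_const_mul, integral_const, ← bergmanKernel_self_re hex hz, smul_eq_mul,
    measureReal_restrict_apply_univ, mul_inv_cancel₀ hV.ne'] at h3
  linarith

theorem bergmanKernel_self_re_pos (hvol : volume Ω ≠ ⊤) {z : E} (hz : z ∈ Ω) :
    0 < (bergmanKernel Ω z z).re := by
  obtain ⟨h1, h2⟩ := one_le_volume_mul_bergmanKernel_self hex hvol hz
  by_contra h
  nlinarith

/-- The kernel is holomorphic in one variable and antiholomorphic in the other, so it is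
separately continuous, hence jointly measurable. -/
theorem measurable_indicator_bergmanKernel [SecondCountableTopology E] [BorelSpace E]
    (hΩ : IsOpen Ω) :
    Measurable ((Ω ×ˢ Ω).indicator fun p : E × E => bergmanKernel Ω p.1 p.2) := by
  have h1 : ∀ z ∈ Ω, Continuous fun w : Ω => bergmanKernel Ω w z := fun z hz =>
    continuousOn_iff_continuous_domRestrict.1
      (isReproducingAt_bergmanKernel (hex z hz)).1.1.continuousOn
  have h2 : Measurable (Function.uncurry fun (w z : Ω) => bergmanKernel Ω w z) := by
    refine measurable_uncurry_of_continuous_of_measurable (fun z => h1 z z.2) fun w => ?_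
    refine Continuous.measurable ?_
    have : (fun z : Ω => bergmanKernel Ω w z)
        = fun z : Ω => (starRingEnd ℂ) (bergmanKernel Ω z w) :=
      funext fun z => bergmanKernel_conj hex z.2 w.2
    rw [this]
    exact Complex.continuous_conj.comp (h1 w w.2)
  have hm : MeasurableSet (Ω ×ˢ Ω) := hΩ.measurableSet.prod hΩ.measurableSet
  refine measurable_of_restrict_of_restrict_compl hm ?_ ?_
  · have h3 : Measurable fun p : (Ω ×ˢ Ω : Set (E × E)) =>
        ((⟨p.1.1, p.2.1⟩, ⟨p.1.2, p.2.2⟩) : Ω × Ω) := by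
      fun_prop
    convert! h2.comp h3 using 1
    ext p
    exact indicator_of_mem p.2 _
  · convert! measurable_const (a := (0 : ℂ)) using 1
    ext p
    exact indicator_of_notMem p.2 _

end Kernel

/-! ### The Bergman kernel of a product -/

section Product

/-- Integrating a square integrable function of two variables against a square integrable function
of the second variable. -/
theorem memLp_two_of_integral_mul_conj {X Y : Type*} [MeasurableSpace X] [MeasurableSpace Y]
    {μ : Measure X} {ν : Measure Y} [SFinite μ] [SFinite ν] {G : X × Y → ℂ} {K : Y → ℂ} {h : X → ℂ}
    (hG : MemLp G 2 (μ.prod ν)) (hK : MemLp K 2 ν)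
    (hh : ∀ᵐ x ∂μ, ∫ y, G (x, y) * (starRingEnd ℂ) (K y) ∂ν = h x) : MemLp h 2 μ := by
  have hmeas : AEStronglyMeasurable (fun p : X × Y => G p * (starRingEnd ℂ) (K p.2)) (μ.prod ν) :=
    hG.1.mul (Complex.continuous_conj.comp_aestronglyMeasurable hK.1.comp_snd)
  refine ⟨hmeas.integral_prod_right'.congr hh, ?_⟩
  rw [eLpNorm_lt_top_iff_lintegral_rpow_enorm_lt_top (by norm_num) (by norm_num)]
  have hKt := (eLpNorm_lt_top_iff_lintegral_rpow_enorm_lt_top (by norm_num) (by norm_num)).1 hK.2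
  have hGt := (eLpNorm_lt_top_iff_lintegral_rpow_enorm_lt_top (by norm_num) (by norm_num)).1 hG.2
  have hGm : AEMeasurable (fun p => ‖G p‖ₑ ^ (2 : ℝ≥0∞).toReal) (μ.prod ν) :=
    hG.1.enorm.pow_const _
  rw [lintegral_prod _ hGm] at hGt
  calc ∫⁻ x, ‖h x‖ₑ ^ (2 : ℝ≥0∞).toReal ∂μ
      ≤ ∫⁻ x, (∫⁻ y, ‖G (x, y)‖ₑ ^ (2 : ℝ≥0∞).toReal ∂ν)
          * (∫⁻ y, ‖K y‖ₑ ^ (2 : ℝ≥0∞).toReal ∂ν) ∂μ := by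
        refine lintegral_mono_ae ?_
        filter_upwards [hh, hG.1.prodMk_left] with x hx hGx
        rw [← hx]
        have hol := ENNReal.lintegral_mul_le_Lp_mul_Lq ν (p := 2) (q := 2)
          ⟨by norm_num, by norm_num, by norm_num⟩ (f := fun y => ‖G (x, y)‖ₑ)
          (g := fun y => ‖K y‖ₑ) hGx.enorm hK.1.enorm
        have hle : ‖∫ y, G (x, y) * (starRingEnd ℂ) (K y) ∂ν‖ₑ
            ≤ ∫⁻ y, ((fun y => ‖G (x, y)‖ₑ) * fun y => ‖K y‖ₑ) y ∂ν := by
          refine (enorm_integral_le_lintegral_enorm _).trans (lintegral_mono fun y => ?_)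
          simp [enorm_eq_nnnorm]
        calc ‖∫ y, G (x, y) * (starRingEnd ℂ) (K y) ∂ν‖ₑ ^ (2 : ℝ≥0∞).toReal
            ≤ ((∫⁻ y, ‖G (x, y)‖ₑ ^ (2 : ℝ) ∂ν) ^ (1 / 2 : ℝ)
              * (∫⁻ y, ‖K y‖ₑ ^ (2 : ℝ) ∂ν) ^ (1 / 2 : ℝ)) ^ (2 : ℝ≥0∞).toReal := by
              gcongr
              exact hle.trans hol
          _ = _ := by
              rw [ENNReal.mul_rpow_of_nonneg _ _ (by norm_num), ← ENNReal.rpow_mul,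
                ← ENNReal.rpow_mul]
              norm_num
    _ = (∫⁻ x, ∫⁻ y, ‖G (x, y)‖ₑ ^ (2 : ℝ≥0∞).toReal ∂ν ∂μ)
          * (∫⁻ y, ‖K y‖ₑ ^ (2 : ℝ≥0∞).toReal ∂ν) := by
        rw [lintegral_mul_const' _ _ hKt.ne]
    _ < ⊤ := ENNReal.mul_lt_top hGt hKt

theorem memLp_two_fintype_prod {ι : Type*} [Fintype ι] {X : ι → Type*}
    [∀ i, MeasurableSpace (X i)] {μ : ∀ i, Measure (X i)} [∀ i, SigmaFinite (μ i)]
    {f : ∀ i, X i → ℂ} (hf : ∀ i, MemLp (f i) 2 (μ i)) :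
    MemLp (fun x : ∀ i, X i => ∏ i, f i (x i)) 2 (Measure.pi μ) := by
  rw [memLp_two_iff_integrable_sq_norm]
  · simp only [norm_prod, ← Finset.prod_pow]
    exact Integrable.fintype_prod_dep (f := fun i x => ‖f i x‖ ^ 2)
      fun i => (memLp_two_iff_integrable_sq_norm (hf i).1).1 (hf i)
  · exact Finset.aestronglyMeasurable_fun_prod _ fun i _ =>
      (hf i).1.comp_quasiMeasurePreserving (Measure.quasiMeasurePreserving_eval (μ := μ) i)

/-- `Fin.cons` as a measurable equivalence: it splits off the first factor of a product. -/
def finConsMeasurableEquiv {m : ℕ} (X : Fin (m + 1) → Type*) [∀ j, MeasurableSpace (X j)] :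
    X 0 × (∀ j : Fin m, X j.succ) ≃ᵐ ∀ j, X j where
  toEquiv := Fin.consEquiv X
  measurable_toFun := by
    refine measurable_pi_iff.2 fun j => ?_
    refine Fin.cases ?_ (fun j => ?_) j
    · exact measurable_fst
    · exact (measurable_pi_apply j).comp measurable_snd
  measurable_invFun := (measurable_pi_apply 0).prodMk
    (measurable_pi_iff.2 fun j => measurable_pi_apply j.succ)

@[simp]
theorem finConsMeasurableEquiv_apply {m : ℕ} (X : Fin (m + 1) → Type*)
    [∀ j, MeasurableSpace (X j)] (p : X 0 × (∀ j : Fin m, X j.succ)) :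
    finConsMeasurableEquiv X p = Fin.cons p.1 p.2 := rfl

theorem measurePreserving_finConsMeasurableEquiv {m : ℕ} {X : Fin (m + 1) → Type*}
    [∀ j, MeasurableSpace (X j)] (μ : ∀ j, Measure (X j)) [∀ j, SigmaFinite (μ j)] :
    MeasurePreserving (finConsMeasurableEquiv X)
      ((μ 0).prod (Measure.pi fun j : Fin m => μ j.succ)) (Measure.pi μ) := by
  refine ⟨(finConsMeasurableEquiv X).measurable, (Measure.pi_eq fun s _ => ?_).symm⟩
  rw [MeasurableEquiv.map_apply, Fin.prod_univ_succ, ← Measure.pi_pi, ← Measure.prod_prod]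
  congr 1 with ⟨x, f⟩
  simp [Fin.forall_fin_succ]

theorem restrict_univ_pi {m : ℕ} {E : Fin m → Type*} [∀ j, MeasureSpace (E j)]
    [∀ j, SigmaFinite (volume : Measure (E j))] (Ωs : ∀ j, Set (E j)) :
    (volume : Measure (∀ j, E j)).restrict (univ.pi Ωs)
      = Measure.pi fun j => volume.restrict (Ωs j) :=
  Measure.restrict_pi_pi _ _

/-- A product of reproducing functions is reproducing on the product domain: apply the reproducing
property in one variable after the other. The slices of a function in `A²` that arise from the
partial integration are again in `A²`, by the Cauchy-Schwarz inequality. -/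
theorem isReproducingAt_pi {m : ℕ} {E : Fin m → Type*} [∀ j, NormedAddCommGroup (E j)]
    [∀ j, NormedSpace ℂ (E j)] [∀ j, MeasureSpace (E j)]
    [∀ j, SigmaFinite (volume : Measure (E j))] {Ωs : ∀ j, Set (E j)}
    (hΩ : ∀ j, MeasurableSet (Ωs j)) {z : ∀ j, E j} (hz : ∀ j, z j ∈ Ωs j) {k : ∀ j, E j → ℂ}
    (hk : ∀ j, IsReproducingAt (Ωs j) (z j) (k j)) :
    IsReproducingAt (univ.pi Ωs) z (fun w => ∏ j, k j (w j)) := by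
  refine ⟨⟨?_, ?_⟩, ?_⟩
  · have h : ∀ j, DifferentiableOn ℂ (fun w : ∀ j, E j => k j (w j)) (univ.pi Ωs) := fun j =>
      (hk j).1.1.comp (differentiable_apply j).differentiableOn fun w hw => hw j (mem_univ j)
    exact fun w hw => (HasFDerivWithinAt.finsetProd (u := Finset.univ)
      fun j _ => (h j w hw).hasFDerivWithinAt).differentiableWithinAt
  · rw [restrict_univ_pi]
    exact memLp_two_fintype_prod fun j => (hk j).1.2
  induction m with
  | zero =>
    intro f _
    rw [restrict_univ_pi, Measure.pi_of_empty _ z, integral_dirac]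
    simp
  | succ m ih =>
    intro f hf
    set μ : Measure (E 0) := volume.restrict (Ωs 0) with hμ
    set ν : Measure (∀ j : Fin m, E j.succ) :=
      Measure.pi fun j : Fin m => volume.restrict (Ωs j.succ) with hν
    have hνr : (volume : Measure (∀ j : Fin m, E j.succ)).restrict
        (univ.pi fun j : Fin m => Ωs j.succ) = ν :=
      restrict_univ_pi fun j : Fin m => Ωs j.succ
    have hmp : MeasurePreserving (finConsMeasurableEquiv E) (μ.prod ν)
        (volume.restrict (univ.pi Ωs)) := by
      rw [restrict_univ_pi]
      exact measurePreserving_finConsMeasurableEquiv fun j => volume.restrict (Ωs j)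
    have hmem : ∀ x ∈ Ωs 0, ∀ y ∈ univ.pi (fun j : Fin m => Ωs j.succ),
        (Fin.cons x y : ∀ j, E j) ∈ univ.pi Ωs := by
      intro x hx y hy j _
      refine Fin.cases ?_ (fun j => ?_) j
      · simpa using hx
      · simpa using hy j (mem_univ j)
    have hztail : (Fin.cons (z 0) (fun j : Fin m => z j.succ) : ∀ j, E j) = z :=
      Fin.cons_self_tail z
    set G : E 0 × (∀ j : Fin m, E j.succ) → ℂ := fun p => f (Fin.cons p.1 p.2) with hG
    have hGL : MemLp G 2 (μ.prod ν) := hf.2.comp_measurePreserving hmp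
    set K : (∀ j : Fin m, E j.succ) → ℂ := fun y => ∏ j : Fin m, k j.succ (y j) with hK
    have hKL : MemLp K 2 ν := memLp_two_fintype_prod fun j : Fin m => (hk j.succ).1.2
    have hslice : ∀ᵐ x ∂μ, ∫ y, G (x, y) * (starRingEnd ℂ) (K y) ∂ν
        = G (x, fun j => z j.succ) := by
      have hint := (memLp_two_iff_integrable_sq_norm hGL.1).1 hGL
      filter_upwards [ae_restrict_mem (hΩ 0), hGL.1.prodMk_left, hint.prod_right_ae]
        with x hx hx1 hx2
      have := ih (fun j : Fin m => hΩ j.succ) (fun j : Fin m => hz j.succ)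
        (fun j : Fin m => hk j.succ) (fun y => G (x, y)) ⟨?_, ?_⟩
      · rw [hνr] at this
        exact this
      · refine hf.1.comp (Differentiable.differentiableOn ?_) fun y hy => hmem x hx y hy
        refine differentiable_pi.2 fun j => ?_
        refine Fin.cases ?_ (fun j => ?_) j
        · simp
        · simp only [Fin.cons_succ]
          exact differentiable_apply j
      · rw [hνr]
        exact (memLp_two_iff_integrable_sq_norm hx1).2 hx2
    have hGz : MemBergmanSpace (Ωs 0) fun x => G (x, fun j => z j.succ) := by
      refine ⟨hf.1.comp (Differentiable.differentiableOn ?_)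
        fun x hx => hmem x hx _ fun j _ => hz j.succ, memLp_two_of_integral_mul_conj hGL hKL hslice⟩
      refine differentiable_pi.2 fun j => ?_
      refine Fin.cases ?_ (fun j => ?_) j
      · simp only [Fin.cons_zero]
        exact differentiable_id
      · simp
    have hprod : Integrable (fun p : E 0 × (∀ j : Fin m, E j.succ) =>
        G p * (starRingEnd ℂ) (k 0 p.1 * K p.2)) (μ.prod ν) := by
      have h2 : MemLp (fun p : E 0 × (∀ j : Fin m, E j.succ) => k 0 p.1 * K p.2) 2
          (μ.prod ν) := by
        rw [memLp_two_iff_integrable_sq_norm]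
        · simp only [norm_mul, mul_pow]
          exact ((memLp_two_iff_integrable_sq_norm (hk 0).1.2.1).1 (hk 0).1.2).mul_prod
            ((memLp_two_iff_integrable_sq_norm hKL.1).1 hKL)
        · exact (hk 0).1.2.1.comp_fst.mul hKL.1.comp_snd
      exact hGL.integrable_mul h2.star
    calc ∫ w in univ.pi Ωs, f w * (starRingEnd ℂ) (∏ j, k j (w j))
        = ∫ p, G p * (starRingEnd ℂ) (k 0 p.1 * K p.2) ∂(μ.prod ν) := by
          rw [← hmp.integral_comp']
          simp [Fin.prod_univ_succ, hG, hK]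
      _ = ∫ x, ∫ y, G (x, y) * (starRingEnd ℂ) (k 0 x * K y) ∂ν ∂μ := integral_prod _ hprod
      _ = ∫ x, G (x, fun j => z j.succ) * (starRingEnd ℂ) (k 0 x) ∂μ := by
          refine integral_congr_ae ?_
          filter_upwards [hslice] with x hx
          rw [← hx, ← integral_mul_const]
          refine integral_congr_ae (Eventually.of_forall fun y => ?_)
          simp only [map_mul]
          ring
      _ = f z := by
          rw [(hk 0).2 _ hGz]
          simp only [hG, hztail]

theorem exists_isReproducingAt_pi {m : ℕ} {E : Fin m → Type*} [∀ j, NormedAddCommGroup (E j)]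
    [∀ j, NormedSpace ℂ (E j)] [∀ j, MeasureSpace (E j)]
    [∀ j, SigmaFinite (volume : Measure (E j))] {Ωs : ∀ j, Set (E j)}
    (hΩ : ∀ j, MeasurableSet (Ωs j)) (hex : ∀ j, ∀ z ∈ Ωs j, ∃ k, IsReproducingAt (Ωs j) z k) :
    ∀ z ∈ univ.pi Ωs, ∃ k, IsReproducingAt (univ.pi Ωs) z k := fun z hz =>
  ⟨_, isReproducingAt_pi hΩ (fun j => hz j (mem_univ j))
    fun j => isReproducingAt_bergmanKernel (hex j (z j) (hz j (mem_univ j)))⟩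

theorem bergmanKernel_pi {m : ℕ} {E : Fin m → Type*} [∀ j, NormedAddCommGroup (E j)]
    [∀ j, NormedSpace ℂ (E j)] [∀ j, MeasureSpace (E j)]
    [∀ j, SigmaFinite (volume : Measure (E j))] {Ωs : ∀ j, Set (E j)}
    (hΩ : ∀ j, MeasurableSet (Ωs j)) (hex : ∀ j, ∀ z ∈ Ωs j, ∃ k, IsReproducingAt (Ωs j) z k)
    {z w : ∀ j, E j} (hz : z ∈ univ.pi Ωs) (hw : w ∈ univ.pi Ωs) :
    bergmanKernel (univ.pi Ωs) w z = ∏ j, bergmanKernel (Ωs j) (w j) (z j) :=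
  (IsReproducingAt.eq_bergmanKernel (exists_isReproducingAt_pi hΩ hex) hz hw
    (isReproducingAt_pi hΩ (fun j => hz j (mem_univ j))
      fun j => isReproducingAt_bergmanKernel (hex j (z j) (hz j (mem_univ j))))).symm

end Product

/-! ### Volume estimates in transversal coordinates -/

section Chart

theorem LipschitzOnWith.addHaar_image_le {E : Type*} [NormedAddCommGroup E] [NormedSpace ℝ E]
    [FiniteDimensional ℝ E] [MeasurableSpace E] [BorelSpace E] (μ : Measure E)
    [μ.IsAddHaarMeasure] {K : NNReal} {f : E → E} {s : Set E} (hf : LipschitzOnWith K f s) :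
    μ (f '' s) ≤ (K : ℝ≥0∞) ^ Module.finrank ℝ E * μ s := by
  have h := Measure.isAddLeftInvariant_eq_smul μ (Measure.hausdorffMeasure (Module.finrank ℝ E))
  have h2 := hf.hausdorffMeasure_image_le (d := Module.finrank ℝ E) (by positivity)
  rw [h, Measure.smul_apply, Measure.smul_apply, ENNReal.smul_def, ENNReal.smul_def, smul_eq_mul,
    smul_eq_mul, mul_left_comm]
  gcongr
  simpa using h2

variable {n : ℕ}

theorem volume_polydisc (R : Fin n → ℝ) :
    volume {y : Fin n → ℂ | ∀ j, ‖y j‖ < R j}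
      = ENNReal.ofReal Real.pi ^ n * ∏ j, ENNReal.ofReal (R j) ^ 2 := by
  have : {y : Fin n → ℂ | ∀ j, ‖y j‖ < R j} = univ.pi fun j => Metric.ball 0 (R j) := by
    ext y; simp
  rw [this, volume_pi_pi]
  simp only [Complex.volume_ball, Finset.prod_mul_distrib, Finset.prod_const, Finset.card_univ,
    Fintype.card_fin]
  rw [mul_comm, ← NNReal.coe_real_pi, ENNReal.ofReal_coe_nnreal]

variable [NeZero n]

/-- A subset of a polydisc that is thin in the direction of the real part of the coordinate of
index `0` has small volume: about `R 0 / τ` of its translates in that direction are pairwise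
disjoint and contained in a polydisc of comparable size. -/
theorem volume_le_of_thin {T : Set (Fin n → ℂ)} (hT : MeasurableSet T) {R : Fin n → ℝ}
    (hR : ∀ j, 0 < R j) {τ : ℝ} (hτ : 0 < τ) (hTR : ∀ y ∈ T, ∀ j, ‖y j‖ < R j)
    (hthin : ∀ y ∈ T, ∀ x : ℝ, y + Pi.single 0 (x : ℂ) ∈ T → |x| < τ) :
    volume T ≤ ENNReal.ofReal (4 * Real.pi ^ n * (τ / R 0) * ∏ j, R j ^ 2) := by
  set N := ⌈R 0 / τ⌉₊ with hN
  have hNpos : 0 < N := Nat.ceil_pos.2 (div_pos (hR 0) hτ)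
  have hN1 : R 0 ≤ N * τ := by
    rw [← div_le_iff₀ hτ]; exact Nat.le_ceil _
  have hN2 : ∀ k < N, (k : ℝ) * τ < R 0 := fun k hk => by
    rw [← lt_div_iff₀ hτ]; exact Nat.lt_ceil.1 hk
  set S : ℕ → Set (Fin n → ℂ) := fun k =>
    (fun y => y + Pi.single 0 ((-(k * τ) : ℝ) : ℂ)) ⁻¹' T with hS
  have hvolS : ∀ k, volume (S k) = volume T := fun k => measure_preimage_add_right _ _ _
  have hmeasS : ∀ k, MeasurableSet (S k) := fun k => (measurable_add_const _) hT
  have hdisj : (↑(Finset.range N) : Set ℕ).PairwiseDisjoint S := by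
    intro k _ l _ hkl
    refine Set.disjoint_left.2 fun y hk hl => ?_
    have h := hthin _ hk ((k : ℝ) * τ - l * τ) (by
      have hl' : y + Pi.single 0 ((-(l * τ) : ℝ) : ℂ) ∈ T := hl
      convert hl' using 1
      rw [add_assoc, ← Pi.single_add, ← Complex.ofReal_add]
      congr 3; ring)
    have h1 : (1 : ℝ) ≤ |(k : ℝ) - l| := by
      have : (k : ℤ) - l ≠ 0 := sub_ne_zero.2 (by exact_mod_cast hkl)
      have := Int.one_le_abs this
      exact_mod_cast this
    rw [← sub_mul, abs_mul, abs_of_pos hτ] at h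
    nlinarith
  have hsub : (⋃ k ∈ Finset.range N, S k)
      ⊆ {y | ∀ j, ‖y j‖ < (if j = 0 then 2 else 1) * R j} := by
    refine iUnion₂_subset fun k hk y hy j => ?_
    have h := hTR _ hy j
    rcases eq_or_ne j 0 with rfl | hj
    · simp only [if_pos, Pi.add_apply, Pi.single_eq_same] at h ⊢
      have h2 : ‖y 0‖ ≤ ‖y 0 + ((-(k * τ) : ℝ) : ℂ)‖ + ‖((-(k * τ) : ℝ) : ℂ)‖ := by
        have := norm_sub_le (y 0 + ((-(k * τ) : ℝ) : ℂ)) ((-(k * τ) : ℝ) : ℂ)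
        rwa [add_sub_cancel_right] at this
      rw [Complex.norm_real, norm_neg, Real.norm_of_nonneg (by positivity)] at h2
      have := hN2 k (Finset.mem_range.1 hk)
      linarith
    · simp only [Pi.add_apply, Pi.single_eq_of_ne hj, add_zero, if_neg hj, one_mul] at h ⊢
      exact h
  have hprod : ∏ j, ENNReal.ofReal ((if j = 0 then 2 else 1) * R j) ^ 2
      = 4 * ENNReal.ofReal (∏ j, R j ^ 2) := by
    rw [ENNReal.ofReal_prod_of_nonneg fun j _ => by positivity]
    have : ∀ j, ENNReal.ofReal ((if j = 0 then 2 else 1) * R j) ^ 2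
        = (if j = 0 then 4 else 1) * ENNReal.ofReal (R j ^ 2) := by
      intro j
      rw [← ENNReal.ofReal_pow (by have := hR j; split_ifs <;> positivity)]
      split_ifs
      · rw [mul_pow, ENNReal.ofReal_mul (by positivity)]
        norm_num
      · simp
    simp only [this, Finset.prod_mul_distrib]
    congr 1
    simp
  have hmain : (N : ℝ≥0∞) * volume T
      ≤ ENNReal.ofReal (4 * Real.pi ^ n * ∏ j, R j ^ 2) := by
    calc (N : ℝ≥0∞) * volume T = volume (⋃ k ∈ Finset.range N, S k) := by
          rw [measure_biUnion_finset hdisj fun k _ => hmeasS k]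
          simp [hvolS]
      _ ≤ _ := measure_mono hsub
      _ = ENNReal.ofReal Real.pi ^ n * (4 * ENNReal.ofReal (∏ j, R j ^ 2)) := by
          rw [volume_polydisc, hprod]
      _ = _ := by
          rw [mul_assoc, ENNReal.ofReal_mul (by norm_num), ENNReal.ofReal_mul (by positivity),
            ENNReal.ofReal_pow Real.pi_pos.le, mul_left_comm]
          norm_num
  have hN0 : (N : ℝ≥0∞) ≠ 0 := by exact_mod_cast hNpos.ne'
  rw [mul_comm, ← ENNReal.le_div_iff_mul_le (Or.inl hN0) (Or.inl (ENNReal.natCast_ne_top N))]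
    at hmain
  refine hmain.trans ?_
  rw [← ENNReal.ofReal_natCast, ← ENNReal.ofReal_div_of_pos (by positivity)]
  refine ENNReal.ofReal_le_ofReal ?_
  have hP : 0 < ∏ j, R j ^ 2 := Finset.prod_pos fun j _ => by have := hR j; positivity
  have hR0 := hR 0
  rw [div_le_iff₀ (by positivity)]
  have : 1 ≤ τ / R 0 * N := by
    rw [div_mul_eq_mul_div, le_div_iff₀ hR0]; linarith
  calc 4 * Real.pi ^ n * ∏ j, R j ^ 2 = 4 * Real.pi ^ n * (∏ j, R j ^ 2) * 1 := by ring
    _ ≤ 4 * Real.pi ^ n * (∏ j, R j ^ 2) * (τ / R 0 * N) := by gcongr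
    _ = _ := by ring

/-- Holomorphic bi-Lipschitz coordinates `ζ` on `U`, in which `∂r / ∂(Re ζ_0) ≥ 1 / C`. -/
structure IsTransversalChart (U : Set (Fin n → ℂ)) (r : (Fin n → ℂ) → ℝ) (C : ℝ)
    (ζ : (Fin n → ℂ) → (Fin n → ℂ)) : Prop where
  const_pos : 0 < C
  isOpen : IsOpen U
  holo : DifferentiableOn ℂ ζ U
  lipschitz : ∀ w ∈ U, ∀ w' ∈ U, ‖ζ w - ζ w'‖ ≤ C * ‖w - w'‖
  antilipschitz : ∀ w ∈ U, ∀ w' ∈ U, ‖w - w'‖ ≤ C * ‖ζ w - ζ w'‖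
  transversal : ∀ w ∈ U, ∀ v : Fin n → ℂ,
    fderiv ℂ ζ w v = Pi.single 0 1 → 1 / C ≤ fderiv ℝ r w v

namespace IsTransversalChart

variable {U : Set (Fin n → ℂ)} {r : (Fin n → ℂ) → ℝ} {C : ℝ} {ζ : (Fin n → ℂ) → (Fin n → ℂ)}

theorem injOn (h : IsTransversalChart U r C ζ) : InjOn ζ U := fun w hw w' hw' e => by
  have := h.antilipschitz w hw w' hw'
  rw [e, sub_self, norm_zero, mul_zero, norm_le_zero_iff, sub_eq_zero] at this
  exact this

theorem norm_le_fderiv (h : IsTransversalChart U r C ζ) {w : Fin n → ℂ} (hw : w ∈ U)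
    (v : Fin n → ℂ) : ‖v‖ ≤ C * ‖fderiv ℂ ζ w v‖ := by
  have hd := (h.holo.differentiableAt (h.isOpen.mem_nhds hw)).hasFDerivAt
  have hc : Tendsto (fun k : ℕ => ‖((k : ℂ) + 1)‖) atTop atTop := by
    refine tendsto_atTop_mono (fun k => ?_)
      (tendsto_natCast_atTop_atTop (R := ℝ))
    have : ((k : ℂ) + 1) = ((k + 1 : ℝ) : ℂ) := by push_cast; rfl
    rw [this, Complex.norm_real, Real.norm_of_nonneg (by positivity)]
    linarith
  have hlim := ((hd.lim v hc).norm).const_mul C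
  refine ge_of_tendsto hlim ?_
  have hev : Tendsto (fun k : ℕ => w + ((k : ℂ) + 1)⁻¹ • v) atTop (𝓝 w) := by
    have h0 : Tendsto (fun k : ℕ => ((k : ℂ) + 1)⁻¹) atTop (𝓝 0) := by
      rw [tendsto_zero_iff_norm_tendsto_zero]
      simp only [norm_inv]
      exact hc.inv_tendsto_atTop
    simpa using (h0.smul_const v).const_add w
  filter_upwards [hev (h.isOpen.mem_nhds hw)] with k hk
  have hk0 : ((k : ℂ) + 1) ≠ 0 := Nat.cast_add_one_ne_zero k
  have := h.antilipschitz _ hk w hw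
  rw [add_sub_cancel_left, norm_smul, norm_inv] at this
  rw [norm_smul]
  have hpos : 0 < ‖((k : ℂ) + 1)‖ := norm_pos_iff.2 hk0
  rw [inv_mul_le_iff₀ hpos] at this
  linarith

theorem ker_fderiv (h : IsTransversalChart U r C ζ) {w : Fin n → ℂ} (hw : w ∈ U) :
    (fderiv ℂ ζ w : (Fin n → ℂ) →ₗ[ℂ] (Fin n → ℂ)).ker = ⊥ := by
  rw [LinearMap.ker_eq_bot']
  intro v hv
  have := h.norm_le_fderiv hw v
  rw [ContinuousLinearMap.coe_coe] at hv
  rw [hv, norm_zero, mul_zero] at this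
  exact norm_le_zero_iff.1 this

theorem range_fderiv (h : IsTransversalChart U r C ζ) {w : Fin n → ℂ} (hw : w ∈ U) :
    (fderiv ℂ ζ w : (Fin n → ℂ) →ₗ[ℂ] (Fin n → ℂ)).range = ⊤ :=
  LinearMap.ker_eq_bot_iff_range_eq_top.1 (h.ker_fderiv hw)

theorem isOpen_image (h : IsTransversalChart U r C ζ) {V : Set (Fin n → ℂ)} (hV : IsOpen V)
    (hVU : V ⊆ U) : IsOpen (ζ '' V) := by
  rw [isOpen_iff_mem_nhds]
  rintro _ ⟨w, hw, rfl⟩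
  rw [← (hasStrictFDerivAt_of_differentiableOn h.isOpen h.holo
    (hVU hw)).map_nhds_eq_of_surj (h.range_fderiv (hVU hw))]
  exact image_mem_map (hV.mem_nhds hw)

/-- The image of a ball contains a ball: inside the smaller ball the image is open, and it is
closed by compactness. -/
theorem ball_subset_image (h : IsTransversalChart U r C ζ) {w : Fin n → ℂ} {ρ : ℝ} (hρ : 0 < ρ)
    (hU : Metric.closedBall w ρ ⊆ U) :
    Metric.ball (ζ w) (ρ / C) ⊆ ζ '' Metric.ball w ρ := by
  have hC := h.const_pos
  refine (convex_ball _ _).isPreconnected.subset_of_closure_inter_subset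
    (h.isOpen_image Metric.isOpen_ball (Metric.ball_subset_closedBall.trans hU))
    ⟨ζ w, Metric.mem_ball_self (by positivity), w, Metric.mem_ball_self hρ, rfl⟩ ?_
  rintro y ⟨hy, hyb⟩
  have hcomp : IsCompact (ζ '' Metric.closedBall w ρ) :=
    (isCompact_closedBall w ρ).image_of_continuousOn (h.holo.continuousOn.mono hU)
  obtain ⟨x, hx, rfl⟩ : y ∈ ζ '' Metric.closedBall w ρ :=
    closure_minimal (image_mono Metric.ball_subset_closedBall) hcomp.isClosed hy
  refine ⟨x, ?_, rfl⟩
  have := h.antilipschitz x (hU hx) w (hU (Metric.mem_closedBall_self hρ.le))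
  rw [Metric.mem_ball, dist_eq_norm, lt_div_iff₀ hC] at hyb
  rw [Metric.mem_ball, dist_eq_norm]
  linarith

theorem lipschitzOnWith_invFunOn (h : IsTransversalChart U r C ζ) {V : Set (Fin n → ℂ)}
    (hVU : V ⊆ U) : LipschitzOnWith C.toNNReal (Function.invFunOn ζ V) (ζ '' V) := by
  refine LipschitzOnWith.of_dist_le_mul fun y hy y' hy' => ?_
  rw [dist_eq_norm, dist_eq_norm, Real.coe_toNNReal _ h.const_pos.le]
  have := h.antilipschitz _ (hVU (Function.invFunOn_mem hy)) _ (hVU (Function.invFunOn_mem hy'))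
  rwa [Function.invFunOn_eq hy, Function.invFunOn_eq hy'] at this

theorem exists_hasDerivAt_invFunOn (h : IsTransversalChart U r C ζ) (hr : Differentiable ℝ r)
    {y : Fin n → ℂ} {t : ℝ} (hy : y + Pi.single 0 (t : ℂ) ∈ ζ '' U) :
    ∃ d, 1 / C ≤ d ∧
      HasDerivAt (fun t : ℝ => r (Function.invFunOn ζ U (y + Pi.single 0 (t : ℂ)))) d t := by
  set inv := Function.invFunOn ζ U with hinv
  have hopen : IsOpen (ζ '' U) := h.isOpen_image h.isOpen subset_rfl
  have hcurve : HasDerivAt (fun t : ℝ => y + (Pi.single 0 (t : ℂ) : Fin n → ℂ))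
      (Pi.single 0 1) t := by
    refine HasDerivAt.const_add _ (hasDerivAt_pi.2 fun j => ?_)
    rcases eq_or_ne j 0 with rfl | hj
    · simpa using (hasDerivAt_id t).ofReal_comp
    · simpa [Pi.single_eq_of_ne hj] using hasDerivAt_const t (0 : ℂ)
  have hu : inv (y + Pi.single 0 (t : ℂ)) ∈ U := Function.invFunOn_mem hy
  have hcont : ContinuousAt inv (y + Pi.single 0 (t : ℂ)) :=
    (h.lipschitzOnWith_invFunOn subset_rfl).continuousOn.continuousAt (hopen.mem_nhds hy)
  obtain ⟨L, hL⟩ : ∃ L : (Fin n → ℂ) ≃L[ℂ] (Fin n → ℂ), (L : (Fin n → ℂ) →L[ℂ] (Fin n → ℂ))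
      = fderiv ℂ ζ (inv (y + Pi.single 0 (t : ℂ))) :=
    ⟨ContinuousLinearEquiv.ofBijective _ (h.ker_fderiv hu) (h.range_fderiv hu),
      ContinuousLinearEquiv.coe_ofBijective _ _ _⟩
  have hLd : HasFDerivAt ζ (L : (Fin n → ℂ) →L[ℂ] (Fin n → ℂ))
      (inv (y + Pi.single 0 (t : ℂ))) := by
    rw [hL]
    exact (h.holo.differentiableAt (h.isOpen.mem_nhds hu)).hasFDerivAt
  have hinvd : HasFDerivAt inv (L.symm : (Fin n → ℂ) →L[ℂ] (Fin n → ℂ))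
      (y + Pi.single 0 (t : ℂ)) :=
    HasFDerivAt.of_local_left_inverse hcont hLd (by
      filter_upwards [hopen.mem_nhds hy] with y' hy'
      exact Function.invFunOn_eq hy')
  have hinvR : HasFDerivAt inv
      ((L.symm : (Fin n → ℂ) →L[ℂ] (Fin n → ℂ)).restrictScalars ℝ)
      (y + Pi.single 0 (t : ℂ)) := hinvd.restrictScalars ℝ
  have h1 := HasFDerivAt.comp_hasDerivAt t hinvR hcurve
  have h2 := HasFDerivAt.comp_hasDerivAt t (hr (inv (y + Pi.single 0 (t : ℂ)))).hasFDerivAt h1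
  refine ⟨_, h.transversal _ hu _ ?_, h2⟩
  rw [← hL]
  exact L.apply_symm_apply _

/-- Along a segment in the direction of `Re ζ_0` that is contained in `ζ(U)`, the function `r`
increases with speed at least `1 / C`. -/
theorem sub_ge_of_segment (h : IsTransversalChart U r C ζ) (hr : Differentiable ℝ r)
    {w w' : Fin n → ℂ} (hw : w ∈ U) (hw' : w' ∈ U) {x : ℝ} (hx : 0 ≤ x)
    (hζ : ζ w' = ζ w + Pi.single 0 (x : ℂ))
    (hseg : ∀ t ∈ Icc 0 x, ζ w + Pi.single 0 (t : ℂ) ∈ ζ '' U) : x / C ≤ r w' - r w := by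
  have hleft : ∀ u ∈ U, Function.invFunOn ζ U (ζ u) = u := fun u hu =>
    h.injOn.leftInvOn_invFunOn hu
  have hd : ∀ t ∈ Icc 0 x, ∃ d, 1 / C ≤ d ∧
      HasDerivAt (fun t : ℝ => r (Function.invFunOn ζ U (ζ w + Pi.single 0 (t : ℂ)))) d t :=
    fun t ht => h.exists_hasDerivAt_invFunOn hr (hseg t ht)
  have hend : (fun t : ℝ => r (Function.invFunOn ζ U (ζ w + Pi.single 0 (t : ℂ)))) x = r w' := by
    simp only
    rw [← hζ, hleft w' hw']
  have hstart : (fun t : ℝ => r (Function.invFunOn ζ U (ζ w + Pi.single 0 (t : ℂ)))) 0 = r w := by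
    simp only [Complex.ofReal_zero, Pi.single_zero, add_zero]
    rw [hleft w hw]
  generalize (fun t : ℝ => r (Function.invFunOn ζ U (ζ w + Pi.single 0 (t : ℂ)))) = g
    at hd hend hstart
  have key := (convex_Icc 0 x).mul_sub_le_image_sub_of_le_deriv (C := 1 / C) (f := g)
    (fun t ht => (hd t ht).choose_spec.2.continuousAt.continuousWithinAt)
    (fun t ht =>
      (hd t (interior_subset ht)).choose_spec.2.differentiableAt.differentiableWithinAt)
    (fun t ht => by
      rw [(hd t (interior_subset ht)).choose_spec.2.deriv]
      exact (hd t (interior_subset ht)).choose_spec.1)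
    0 (left_mem_Icc.2 hx) x (right_mem_Icc.2 hx) hx
  rw [hend, hstart, sub_zero] at key
  linarith [mul_comm (1 / C) x, mul_one_div x C]

theorem isOpen_layer (h : IsTransversalChart U r C ζ) (hr : Differentiable ℝ r)
    {p : Fin n → ℂ} {ε : ℝ} (hU : Metric.ball p ε ⊆ U) (R : Fin n → ℝ) (t : ℝ) :
    IsOpen {w | w ∈ Metric.ball p ε ∧ (∀ j, ‖ζ w j‖ < R j) ∧ r w < 0 ∧ -t < r w} := by
  have h1 : IsOpen (Metric.ball p ε ∩ ζ ⁻¹' {y | ∀ j, ‖y j‖ < R j}) := by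
    refine (h.holo.continuousOn.mono hU).isOpen_inter_preimage Metric.isOpen_ball ?_
    simp only [ofPred_forall]
    exact isOpen_iInter_of_finite fun j => isOpen_lt (by fun_prop) continuous_const
  have h2 : IsOpen (r ⁻¹' Ioo (-t) 0) := isOpen_Ioo.preimage hr.continuous
  convert h1.inter h2 using 1
  ext w
  simp only [mem_ofPred_eq, mem_inter_iff, mem_preimage, mem_Ioo]
  tauto

/-- The volume of the part of a polydisc (in transversal coordinates) that lies in the layer
`-t < r < 0` is at most proportional to `t / R 0` times the volume of the polydisc. -/
theorem volume_layer_le (h : IsTransversalChart U r C ζ) (hr : Differentiable ℝ r)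
    {p : Fin n → ℂ} {ε : ℝ} (hε : 0 < ε) (hU : Metric.ball p ((2 * C ^ 2 + 1) * ε) ⊆ U)
    {R : Fin n → ℝ} (hR : ∀ j, 0 < R j) {t : ℝ} (ht : 0 < t) :
    volume {w | w ∈ Metric.ball p ε ∧ (∀ j, ‖ζ w j‖ < R j) ∧ r w < 0 ∧ -t < r w}
      ≤ ENNReal.ofReal (C ^ Module.finrank ℝ (Fin n → ℂ) * (4 * Real.pi ^ n) * C
          * (t / R 0 * ∏ j, R j ^ 2)) := by
  have hC := h.const_pos
  set W := {w | w ∈ Metric.ball p ε ∧ (∀ j, ‖ζ w j‖ < R j) ∧ r w < 0 ∧ -t < r w} with hW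
  have hballU : Metric.ball p ε ⊆ U := (Metric.ball_subset_ball (by nlinarith [sq_nonneg C])).trans hU
  have hWU : W ⊆ U := fun w hw => hballU hw.1
  have hWopen : IsOpen W := h.isOpen_layer hr hballU R t
  have hpos : ∀ w ∈ W, ∀ w' ∈ W, ∀ x : ℝ, 0 ≤ x → ζ w' = ζ w + Pi.single 0 (x : ℂ) →
      x < C * t := by
    intro w hw w' hw' x hx e
    have hxlt : x < 2 * C * ε := by
      have h1 := h.lipschitz w' (hWU hw') w (hWU hw)
      rw [e, add_sub_cancel_left, Pi.norm_single, Complex.norm_real, Real.norm_of_nonneg hx] at h1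
      have h2 : ‖w' - w‖ < 2 * ε := by
        rw [← dist_eq_norm]
        linarith [dist_triangle_right w' w p, Metric.mem_ball.1 hw.1, Metric.mem_ball.1 hw'.1]
      nlinarith
    have hcb : Metric.closedBall w (2 * C ^ 2 * ε) ⊆ U := by
      refine (Metric.closedBall_subset_ball' ?_).trans hU
      linarith [Metric.mem_ball.1 hw.1]
    have hb := h.ball_subset_image (ρ := 2 * C ^ 2 * ε) (by positivity) hcb
    have e2 : 2 * C ^ 2 * ε / C = 2 * C * ε := by field_simp
    have hs := h.sub_ge_of_segment hr (hWU hw) (hWU hw') hx e (fun s hs => by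
      refine image_mono (Metric.ball_subset_closedBall.trans hcb) (hb ?_)
      rw [e2, mem_ball_iff_norm, add_sub_cancel_left, Pi.norm_single, Complex.norm_real,
        Real.norm_of_nonneg hs.1]
      exact hs.2.trans_lt hxlt)
    have hw1 := hw.2.2.2
    have hw2 := hw'.2.2.1
    have : x / C < t := by linarith
    rw [div_lt_iff₀ hC] at this
    linarith
  have hthin : ∀ y ∈ ζ '' W, ∀ x : ℝ, y + Pi.single 0 (x : ℂ) ∈ ζ '' W → |x| < C * t := by
    rintro _ ⟨w, hw, rfl⟩ x ⟨w', hw', e⟩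
    rcases le_total 0 x with hx | hx
    · rw [abs_of_nonneg hx]
      exact hpos w hw w' hw' x hx e
    · rw [abs_of_nonpos hx]
      refine hpos w' hw' w hw (-x) (neg_nonneg.2 hx) ?_
      rw [e, add_assoc, ← Pi.single_add, ← Complex.ofReal_add]
      simp
  have h1 := volume_le_of_thin (h.isOpen_image hWopen hWU).measurableSet hR
    (mul_pos hC ht) (by rintro _ ⟨w, hw, rfl⟩; exact hw.2.1) hthin
  have h2 := (h.lipschitzOnWith_invFunOn hWU).addHaar_image_le volume
  rw [(h.injOn.mono hWU).leftInvOn_invFunOn.image_image] at h2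
  refine h2.trans ((mul_le_mul_right h1 _).trans (le_of_eq ?_))
  rw [← ENNReal.ofReal_coe_nnreal, Real.coe_toNNReal _ hC.le, ← ENNReal.ofReal_pow hC.le,
    ← ENNReal.ofReal_mul (by positivity)]
  congr 1
  ring

end IsTransversalChart

end Chart

/-! ### Integral estimates for the kernel against powers of the defining function -/

section Layers

/-- If the sublevel sets `{φ < t}` in `S` have measure at most `D t`, then `φ ^ (-s)` with `s < 1`
is integrable on `S`, by summation over dyadic layers. -/
theorem lintegral_rpow_neg_le {X : Type*} [MeasurableSpace X] {μ : Measure X} {S : Set X}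
    (hS : MeasurableSet S) {φ : X → ℝ} (hφ : Measurable φ) {s δ D : ℝ} (hs0 : 0 < s) (hs1 : s < 1)
    (hδ : 0 < δ) (hD : 0 ≤ D) (hpos : ∀ x ∈ S, 0 < φ x) (hle : ∀ x ∈ S, φ x ≤ δ)
    (hμ : ∀ t > 0, μ (S ∩ {x | φ x < t}) ≤ ENNReal.ofReal (D * t)) :
    ∫⁻ x in S, ENNReal.ofReal (φ x ^ (-s)) ∂μ
      ≤ ENNReal.ofReal (2 ^ (s + 1) / (1 - (1 / 2) ^ (1 - s)) * D * δ ^ (1 - s)) := by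
  set q : ℝ := (1 / 2) ^ (1 - s) with hq
  have hq0 : 0 < q := by positivity
  have hq1 : q < 1 := Real.rpow_lt_one (by norm_num) (by norm_num) (by linarith)
  set L : ℕ → Set X := fun i =>
    S ∩ {x | δ * (1 / 2) ^ (i + 1) < φ x ∧ φ x ≤ δ * (1 / 2) ^ i} with hL
  have hLm : ∀ i, MeasurableSet (L i) := fun i =>
    hS.inter ((measurableSet_lt measurable_const hφ).inter (measurableSet_le hφ measurable_const))
  have hcover : S ⊆ ⋃ i, L i := by
    intro x hx
    obtain ⟨i, hi1, hi2⟩ := exists_nat_pow_near_of_lt_one (x := φ x / δ) (y := (1 / 2 : ℝ))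
      (div_pos (hpos x hx) hδ) (by rw [div_le_one hδ]; exact hle x hx) (by norm_num) (by norm_num)
    refine mem_iUnion.2 ⟨i, hx, ?_, ?_⟩
    · rw [lt_div_iff₀ hδ] at hi1; linarith
    · rw [div_le_iff₀ hδ] at hi2; linarith
  have hterm : ∀ i, ∫⁻ x in L i, ENNReal.ofReal (φ x ^ (-s)) ∂μ
      ≤ ENNReal.ofReal (2 ^ (s + 1) * D * δ ^ (1 - s) * q ^ i) := by
    intro i
    have ha : 0 < δ * (1 / 2) ^ (i + 1) := by positivity
    calc ∫⁻ x in L i, ENNReal.ofReal (φ x ^ (-s)) ∂μ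
        ≤ ∫⁻ _ in L i, ENNReal.ofReal ((δ * (1 / 2) ^ (i + 1)) ^ (-s)) ∂μ := by
          refine setLIntegral_mono' (hLm i) fun x hx => ENNReal.ofReal_le_ofReal ?_
          exact Real.rpow_le_rpow_of_nonpos ha hx.2.1.le (by linarith)
      _ = ENNReal.ofReal ((δ * (1 / 2) ^ (i + 1)) ^ (-s)) * μ (L i) := by
          rw [setLIntegral_const]
      _ ≤ ENNReal.ofReal ((δ * (1 / 2) ^ (i + 1)) ^ (-s))
            * ENNReal.ofReal (D * (2 * (δ * (1 / 2) ^ i))) := by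
          gcongr
          have hsub : L i ⊆ S ∩ {x | φ x < 2 * (δ * (1 / 2) ^ i)} := by
            intro x hx
            have h1 : 0 < δ * (1 / 2) ^ i := by positivity
            have h2 : φ x ≤ δ * (1 / 2) ^ i := hx.2.2
            exact ⟨hx.1, show φ x < _ by linarith⟩
          exact (measure_mono hsub).trans (hμ _ (by positivity))
      _ = _ := by
          rw [← ENNReal.ofReal_mul (by positivity)]
          congr 1
          have e1 : (δ * (1 / 2) ^ (i + 1)) ^ (-s)
              = (2 : ℝ) ^ s * (δ * (1 / 2) ^ i) ^ (-s) := by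
            have : δ * (1 / 2 : ℝ) ^ (i + 1) = (2 : ℝ)⁻¹ * (δ * (1 / 2) ^ i) := by ring
            rw [this, Real.mul_rpow (by norm_num) (by positivity), Real.inv_rpow (by norm_num),
              Real.rpow_neg (by norm_num), inv_inv]
          have e2 : q ^ i = ((1 / 2 : ℝ) ^ i) ^ (1 - s) := by
            rw [hq, ← Real.rpow_natCast, ← Real.rpow_natCast, ← Real.rpow_mul (by norm_num),
              ← Real.rpow_mul (by norm_num), mul_comm]
          have e3 : (δ * (1 / 2) ^ i) ^ (-s) * (δ * (1 / 2) ^ i)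
              = δ ^ (1 - s) * ((1 / 2 : ℝ) ^ i) ^ (1 - s) := by
            rw [← Real.mul_rpow hδ.le (by positivity), sub_eq_add_neg, add_comm 1 (-s),
              Real.rpow_add_one (by positivity)]
          rw [e1, e2, Real.rpow_add_one (by norm_num)]
          linear_combination 2 * D * (2 : ℝ) ^ s * e3
  calc ∫⁻ x in S, ENNReal.ofReal (φ x ^ (-s)) ∂μ
      ≤ ∫⁻ x in ⋃ i, L i, ENNReal.ofReal (φ x ^ (-s)) ∂μ := lintegral_mono_set hcover
    _ ≤ ∑' i, ∫⁻ x in L i, ENNReal.ofReal (φ x ^ (-s)) ∂μ := lintegral_iUnion_le _ _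
    _ ≤ ∑' i, ENNReal.ofReal (2 ^ (s + 1) * D * δ ^ (1 - s) * q ^ i) := ENNReal.tsum_le_tsum hterm
    _ = _ := by
      rw [← ENNReal.ofReal_tsum_of_nonneg (fun i => by positivity)
        ((summable_geometric_of_lt_one hq0.le hq1).mul_left _), tsum_mul_left,
        tsum_geometric_of_lt_one hq0.le hq1]
      congr 1
      ring

end Layers

section KernelEstimate

variable {n : ℕ} {Ω : Set (Fin n → ℂ)} {r : (Fin n → ℂ) → ℝ}
  {U : Set (Fin n → ℂ)} {δ₀ C : ℝ} {Φ : (Fin n → ℂ) → ℝ → (Fin n → ℂ) → (Fin n → ℂ)}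
  {b : Fin n → (Fin n → ℂ) → ℝ → ℝ}

theorem bDist_nonneg (hδ₀ : 0 < δ₀) (z w : Fin n → ℂ) : 0 ≤ bDist U δ₀ Φ b z w := by
  refine Real.sInf_nonneg fun δ hδ => ?_
  rcases hδ with rfl | hδ
  · exact hδ₀.le
  · exact hδ.1.1.le

theorem exists_mem_bPolydisc_of_bDist_lt {z w : Fin n → ℂ} {t : ℝ} (ht : t ≤ δ₀)
    (h : bDist U δ₀ Φ b z w < t) : ∃ δ ∈ Ioc 0 δ₀, δ < t ∧ w ∈ bPolydisc U Φ b z δ 1 := by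
  obtain ⟨δ, hδ, hlt⟩ := exists_lt_of_csInf_lt (insert_nonempty _ _) h
  rcases hδ with rfl | hδ
  · exact absurd hlt (not_lt.2 ht)
  · exact ⟨δ, hδ.1, hlt, hδ.2⟩

variable [NeZero n]

theorem IsBSystem.isTransversalChart (h : IsBSystem Ω r U δ₀ C Φ b) {z : Fin n → ℂ}
    (hz : z ∈ Ω ∩ U) {δ : ℝ} (hδ : δ ∈ Ioc 0 δ₀) : IsTransversalChart U r C (Φ z δ) where
  const_pos := h.const_pos
  isOpen := h.isOpen
  holo := h.holo z hz δ hδ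
  lipschitz := h.lipschitz z hz δ hδ
  antilipschitz := h.antilipschitz z hz δ hδ
  transversal := h.transversal z hz δ hδ

/-- A dyadic form of the kernel estimate: the kernel `K(z, w)` is bounded by a constant unless, for
some dyadic multiple `δ ≤ δ₀` of `|r(z)|`, the point `w` lies in the dilated polydisc of size `δ`
about `z` and in the layer `|r| < δ`; and then it is bounded by the inverse square of the product
of the radii. -/
theorem norm_kernel_le_dyadic (h : IsBSystem Ω r U δ₀ C Φ b)
    (hneg : ∀ z ∈ Ω, r z < 0) {κ : ℝ} {z w : Fin n → ℂ} (hz : z ∈ Ω ∩ U)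
    (hK : κ ≤ C * ∏ j, b j z (bScale r U δ₀ Φ b z w) ^ 2) :
    κ ≤ C * ((2 * C / δ₀) ^ 2) ^ n ∨ ∃ k : ℕ, 2 ^ (k + 1) * |r z| ≤ δ₀ ∧
      |r w| < 2 ^ (k + 1) * |r z| ∧ w ∈ bPolydisc U Φ b z (2 ^ (k + 1) * |r z|) C ∧
      κ ≤ C * ((C ^ 2) ^ 2) ^ n * ∏ j, b j z (2 ^ (k + 1) * |r z|) ^ 2 := by
  have hC := h.const_pos
  have hδ₀ := h.scale_pos
  have hrz : 0 < |r z| := abs_pos.2 (hneg z hz.1).ne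
  have hM := bDist_nonneg (U := U) (Φ := Φ) (b := b) hδ₀ z w
  set d := bScale r U δ₀ Φ b z w with hd
  have hd0 : 0 < d := lt_min hδ₀ (by have := abs_nonneg (r w); linarith)
  have hdmem : d ∈ Ioc 0 δ₀ := ⟨hd0, min_le_left _ _⟩
  rcases le_or_gt (δ₀ / 2) d with hbig | hsmall
  · left
    refine hK.trans (mul_le_mul_of_nonneg_left ?_ hC.le)
    rw [← Fin.prod_const n ((2 * C / δ₀) ^ 2)]
    refine Finset.prod_le_prod (fun j _ => by positivity) fun j _ => ?_
    refine pow_le_pow_left₀ (h.b_pos z hz d hdmem j).le ((h.b_le z hz d hdmem j).trans ?_) 2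
    rw [div_le_div_iff₀ hd0 hδ₀]
    nlinarith
  · right
    have hdeq : d = |r z| + |r w| + bDist U δ₀ Φ b z w := by
      rcases min_choice δ₀ (|r z| + |r w| + bDist U δ₀ Φ b z w) with e | e
      · rw [hd, bScale, e] at hsmall; linarith
      · rw [hd, bScale, e]
    obtain ⟨k, hk1, hk2⟩ := exists_nat_pow_near (x := d / |r z|) (y := 2)
      (by rw [le_div_iff₀ hrz]; have := abs_nonneg (r w); linarith) (by norm_num)
    rw [le_div_iff₀ hrz] at hk1
    rw [div_lt_iff₀ hrz] at hk2
    have hpow : (2 : ℝ) ^ (k + 1) * |r z| = 2 * (2 ^ k * |r z|) := by ring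
    set δ := (2 : ℝ) ^ k * |r z| with hδdef
    have hδ : 0 < δ := by positivity
    have hδmem : δ ∈ Ioc 0 δ₀ := ⟨hδ, by linarith⟩
    have h2δmem : 2 * δ ∈ Ioc 0 δ₀ := ⟨by positivity, by linarith⟩
    rw [hpow] at hk2
    refine ⟨k, ?_⟩
    rw [hpow]
    refine ⟨h2δmem.2, by linarith, ?_, ?_⟩
    · obtain ⟨δ', hδ', hlt, hmem⟩ :=
        exists_mem_bPolydisc_of_bDist_lt (U := U) (Φ := Φ) (b := b) (z := z) (w := w) h2δmem.2
          (by linarith [abs_nonneg (r w)])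
      exact h.nested z hz δ' hδ' (2 * δ) h2δmem hlt.le hmem
    · refine hK.trans ?_
      rw [mul_assoc]
      refine mul_le_mul_of_nonneg_left ?_ hC.le
      rw [← Fin.prod_const n ((C ^ 2) ^ 2), ← Finset.prod_mul_distrib]
      refine Finset.prod_le_prod (fun j _ => by positivity) fun j _ => ?_
      rw [← mul_pow]
      refine pow_le_pow_left₀ (h.b_pos z hz d hdmem j).le ?_ 2
      calc b j z d ≤ C * b j z δ := h.b_almost_antitone z hz δ hδmem d hdmem hk1 j
        _ ≤ C * (C * b j z (2 * δ)) := by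
          gcongr
          exact h.b_doubling z hz δ hδmem (2 * δ) h2δmem (by linarith) le_rfl j
        _ = C ^ 2 * b j z (2 * δ) := by ring

/-- The integral of `|r| ^ (-s)` over the intersection of a polydisc of size `δ` with the layer
`-δ < r < 0` is at most `δ ^ (-s)` times the volume of the polydisc, up to a constant. -/
theorem IsBSystem.exists_lintegral_polydisc_le (h : IsBSystem Ω r U δ₀ C Φ b)
    (hr : Differentiable ℝ r) {p : Fin n → ℂ} {ε : ℝ} (hε : 0 < ε)
    (hU : Metric.ball p ((2 * C ^ 2 + 1) * ε) ⊆ U) {s : ℝ} (hs0 : 0 < s) (hs1 : s < 1) :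
    ∃ A : ℝ, 0 ≤ A ∧ ∀ z ∈ Ω ∩ U, ∀ δ ∈ Ioc 0 δ₀,
      ENNReal.ofReal (∏ j, b j z δ ^ 2) *
        ∫⁻ w in {w | w ∈ Metric.ball p ε ∧ (∀ j, ‖Φ z δ w j‖ < C / b j z δ) ∧ r w < 0 ∧
          -δ < r w}, ENNReal.ofReal (|r w| ^ (-s)) ≤ ENNReal.ofReal (A * δ ^ (-s)) := by
  have hC := h.const_pos
  set A₁ := C ^ Module.finrank ℝ (Fin n → ℂ) * (4 * Real.pi ^ n) * C with hA₁
  set A₂ := (2 : ℝ) ^ (s + 1) / (1 - (1 / 2) ^ (1 - s)) with hA₂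
  have hA₂0 : 0 ≤ A₂ := by
    have : (1 / 2 : ℝ) ^ (1 - s) < 1 :=
      Real.rpow_lt_one (by norm_num) (by norm_num) (by linarith)
    have : 0 < 1 - (1 / 2 : ℝ) ^ (1 - s) := by linarith
    positivity
  refine ⟨A₂ * (A₁ / C * (C ^ 2) ^ n), by positivity, fun z hz δ hδ => ?_⟩
  have hT := h.isTransversalChart hz hδ
  have hb := h.b_pos z hz δ hδ
  have hR : ∀ j, 0 < C / b j z δ := fun j => div_pos hC (hb j)
  have hUε : Metric.ball p ε ⊆ U :=
    (Metric.ball_subset_ball (by nlinarith [sq_nonneg C])).trans hU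
  have hδ0 := hδ.1
  set P := ∏ j, b j z δ ^ 2 with hP
  have hP0 : 0 < P := Finset.prod_pos fun j _ => by have := hb j; positivity
  have hprod : ∏ j, (C / b j z δ) ^ 2 = (C ^ 2) ^ n / P := by
    simp only [div_pow, Finset.prod_div_distrib, Finset.prod_const, Finset.card_univ,
      Fintype.card_fin, hP]
  have hb0 : C / b 0 z δ = C * δ := by rw [h.b_normal z hz δ hδ]; field_simp
  set D := A₁ * (1 / (C * δ) * ((C ^ 2) ^ n / P)) with hD
  have hD0 : 0 ≤ D := by positivity
  have key := lintegral_rpow_neg_le (μ := volume) (D := D) (φ := fun w => |r w|) (δ := δ)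
    (hT.isOpen_layer hr hUε (fun j => C / b j z δ) δ).measurableSet
    (by have := hr.continuous; fun_prop) hs0 hs1 hδ.1 hD0
    (fun w hw => abs_pos.2 hw.2.2.1.ne)
    (fun w hw => by rw [abs_of_neg hw.2.2.1]; linarith [hw.2.2.2])
    (fun t ht => by
      refine (measure_mono (t := {w | w ∈ Metric.ball p ε ∧ (∀ j, ‖Φ z δ w j‖ < C / b j z δ) ∧
        r w < 0 ∧ -t < r w}) ?_).trans ((hT.volume_layer_le hr hε hU hR ht).trans (le_of_eq ?_))
      · rintro w ⟨hw, hwt⟩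
        refine ⟨hw.1, hw.2.1, hw.2.2.1, ?_⟩
        rw [mem_ofPred_eq, abs_of_neg hw.2.2.1] at hwt
        linarith
      · rw [hprod, hb0, hD]
        congr 1
        ring)
  refine (mul_le_mul_right key _).trans (le_of_eq ?_)
  rw [← ENNReal.ofReal_mul hP0.le, ← hA₂]
  congr 1
  have e : δ ^ (1 - s) = δ * δ ^ (-s) := by
    rw [sub_eq_add_neg, Real.rpow_add hδ0, Real.rpow_one]
  rw [e, hD]
  field_simp

end KernelEstimate

section Global

variable {n : ℕ} {Ω : Set (Fin n → ℂ)} {r : (Fin n → ℂ) → ℝ}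

theorem IsSmoothDefining.differentiable (h : IsSmoothDefining Ω r) : Differentiable ℝ r :=
  h.1.differentiable (by simp)

theorem IsSmoothDefining.neg (h : IsSmoothDefining Ω r) {z : Fin n → ℂ} (hz : z ∈ Ω) :
    r z < 0 := by
  rw [h.2.1] at hz
  exact hz

theorem IsSmoothDefining.exists_abs_le (h : IsSmoothDefining Ω r) (hb : Bornology.IsBounded Ω) :
    ∃ B > 0, ∀ z ∈ Ω, |r z| ≤ B := by
  obtain ⟨B, hB⟩ := hb.isCompact_closure.exists_bound_of_continuousOn
    h.differentiable.continuous.continuousOn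
  exact ⟨max B 1, by positivity, fun z hz => (hB z (subset_closure hz)).trans (le_max_left _ _)⟩

theorem IsSmoothDefining.exists_le_rpow_neg (h : IsSmoothDefining Ω r)
    (hb : Bornology.IsBounded Ω) {s : ℝ} (hs : 0 < s) :
    ∃ c : ℝ≥0∞, c ≠ 0 ∧ c ≠ ⊤ ∧ ∀ z ∈ Ω, c ≤ ENNReal.ofReal (|r z| ^ (-s)) := by
  obtain ⟨B, hB, hle⟩ := h.exists_abs_le hb
  refine ⟨ENNReal.ofReal (B ^ (-s)), (ENNReal.ofReal_pos.2 (by positivity)).ne',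
    ENNReal.ofReal_ne_top, fun z hz => ENNReal.ofReal_le_ofReal ?_⟩
  exact Real.rpow_le_rpow_of_nonpos (abs_pos.2 (h.neg hz).ne) (hle z hz) (by linarith)

/-- A neighbourhood of a point of `U` that is small enough for the estimates in transversal charts
on `U`. -/
theorem exists_ball_subset {U : Set (Fin n → ℂ)} (hU : IsOpen U) {p : Fin n → ℂ} (hp : p ∈ U)
    (C : ℝ) : ∃ ε > 0, Metric.ball p ((2 * C ^ 2 + 1) * ε) ⊆ U ∧ Metric.ball p ε ⊆ U := by
  obtain ⟨ε, hε, hεU⟩ := Metric.isOpen_iff.1 hU p hp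
  have hpos : 0 < 2 * C ^ 2 + 1 := by positivity
  have e : (2 * C ^ 2 + 1) * (ε / (2 * C ^ 2 + 1)) = ε := by field_simp
  refine ⟨ε / (2 * C ^ 2 + 1), by positivity, by rwa [e], ?_⟩
  refine (Metric.ball_subset_ball ?_).trans hεU
  rw [div_le_iff₀ hpos]
  nlinarith [sq_nonneg C]

theorem KernelBoundedOffDiagonal.exists_bound (h : KernelBoundedOffDiagonal Ω) {p : Fin n → ℂ}
    (hp : p ∈ closure Ω) {Q : Set (Fin n → ℂ)} (hQ : IsCompact Q) (hQΩ : Q ⊆ closure Ω)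
    (hpQ : p ∈ Q → p ∉ frontier Ω) :
    ∃ M : ℝ, ∃ V ∈ 𝓝 p, ∀ z ∈ Ω ∩ V, ∀ w ∈ Ω ∩ Q, ‖bergmanKernel Ω z w‖ ≤ M := by
  refine hQ.induction_on (p := fun S => ∃ M : ℝ, ∃ V ∈ 𝓝 p, ∀ z ∈ Ω ∩ V, ∀ w ∈ Ω ∩ S,
    ‖bergmanKernel Ω z w‖ ≤ M) ⟨0, univ, univ_mem, by simp⟩ ?_ ?_ ?_
  · rintro S T hST ⟨M, V, hV, hM⟩
    exact ⟨M, V, hV, fun z hz w hw => hM z hz w ⟨hw.1, hST hw.2⟩⟩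
  · rintro S T ⟨M, V, hV, hM⟩ ⟨M', V', hV', hM'⟩
    refine ⟨max M M', V ∩ V', inter_mem hV hV', fun z hz w hw => ?_⟩
    rcases hw.2 with hw' | hw'
    · exact (hM z ⟨hz.1, hz.2.1⟩ w ⟨hw.1, hw'⟩).trans (le_max_left _ _)
    · exact (hM' z ⟨hz.1, hz.2.2⟩ w ⟨hw.1, hw'⟩).trans (le_max_right _ _)
  · intro x hx
    obtain ⟨M, V, hV, W, hW, hM⟩ := h p hp x (hQΩ hx) (by
      rintro ⟨rfl, hf⟩
      exact hpQ hx hf)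
    exact ⟨W, mem_nhdsWithin_of_mem_nhds hW, M, V, hV, hM⟩

theorem KernelBoundedOffDiagonal.exists_bound_of_mem (h : KernelBoundedOffDiagonal Ω)
    (hΩo : IsOpen Ω) (hΩb : Bornology.IsBounded Ω) {p : Fin n → ℂ} (hp : p ∈ Ω) :
    ∃ M : ℝ, ∃ V ∈ 𝓝 p, ∀ z ∈ Ω ∩ V, ∀ w ∈ Ω, ‖bergmanKernel Ω z w‖ ≤ M := by
  obtain ⟨M, V, hV, hM⟩ := h.exists_bound (subset_closure hp) hΩb.isCompact_closure subset_rfl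
    (fun _ hf => by rw [hΩo.frontier_eq] at hf; exact hf.2 hp)
  exact ⟨M, V, hV, fun z hz w hw => hM z hz w ⟨hw, subset_closure hw⟩⟩

variable [NeZero n]

theorem lintegral_rpow_neg_defining_lt_top (hΩo : IsOpen Ω) (hΩb : Bornology.IsBounded Ω)
    (hr : IsSmoothDefining Ω r) (hB : ∀ p ∈ frontier Ω, IsSharpBTypeAt Ω r p) {s : ℝ}
    (hs0 : 0 < s) (hs1 : s < 1) : ∫⁻ w in Ω, ENNReal.ofReal (|r w| ^ (-s)) < ⊤ := by
  have hrc : Continuous r := hr.differentiable.continuous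
  suffices h : ∫⁻ w in Ω ∩ closure Ω, ENNReal.ofReal (|r w| ^ (-s)) < ⊤ by
    rwa [inter_eq_left.2 subset_closure] at h
  refine hΩb.isCompact_closure.induction_on
    (p := fun S => ∫⁻ w in Ω ∩ S, ENNReal.ofReal (|r w| ^ (-s)) < ⊤) (by simp) ?_ ?_ ?_
  · intro S T hST hT
    exact (lintegral_mono_set (inter_subset_inter_right _ hST)).trans_lt hT
  · intro S T hS hT
    rw [inter_union_distrib_left]
    exact (lintegral_union_le _ _ _).trans_lt (ENNReal.add_lt_top.2 ⟨hS, hT⟩)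
  intro p hp
  by_cases hpΩ : p ∈ Ω
  · -- near an interior point the integrand is bounded
    have hev : ∀ᶠ w in 𝓝 p, |r p| / 2 < |r w| :=
      (hrc.abs.tendsto p).eventually_const_lt (half_lt_self (abs_pos.2 (hr.neg hpΩ).ne))
    have hrp : 0 < |r p| / 2 := half_pos (abs_pos.2 (hr.neg hpΩ).ne)
    refine ⟨{w | |r p| / 2 < |r w|}, mem_nhdsWithin_of_mem_nhds hev, ?_⟩
    calc ∫⁻ w in Ω ∩ {w | |r p| / 2 < |r w|}, ENNReal.ofReal (|r w| ^ (-s))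
        ≤ ∫⁻ _ in Ω ∩ {w | |r p| / 2 < |r w|}, ENNReal.ofReal ((|r p| / 2) ^ (-s)) := by
          refine setLIntegral_mono' (hΩo.measurableSet.inter
            (measurableSet_lt measurable_const hrc.abs.measurable)) fun w hw =>
            ENNReal.ofReal_le_ofReal ?_
          exact Real.rpow_le_rpow_of_nonpos hrp (le_of_lt hw.2) (by linarith)
      _ < ⊤ := by
          rw [setLIntegral_const]
          exact ENNReal.mul_lt_top ENNReal.ofReal_lt_top
            ((measure_mono inter_subset_left).trans_lt hΩb.measure_lt_top)
  · have hpf : p ∈ frontier Ω := by rw [hΩo.frontier_eq]; exact ⟨hp, hpΩ⟩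
    obtain ⟨U, δ₀, C, Φ, b, hpU, hS, -, -⟩ := hB p hpf
    have hC := hS.const_pos
    obtain ⟨ε, hε, hεU, hεU'⟩ := exists_ball_subset hS.isOpen hpU C
    obtain ⟨z, hz, hzΩ⟩ := mem_closure_iff_nhds.1 hp _ (Metric.ball_mem_nhds p hε)
    have hδ₀ : δ₀ ∈ Ioc 0 δ₀ := ⟨hS.scale_pos, le_rfl⟩
    have hzU : z ∈ Ω ∩ U := ⟨hzΩ, hεU' hz⟩
    have hT := hS.isTransversalChart hzU hδ₀
    obtain ⟨B, hB0, hBle⟩ := hr.exists_abs_le hΩb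
    refine ⟨Metric.ball p ε, mem_nhdsWithin_of_mem_nhds (Metric.ball_mem_nhds p hε), ?_⟩
    have hR : 0 < C * (2 * ε) := by positivity
    have hsub : Ω ∩ Metric.ball p ε ⊆ {w | w ∈ Metric.ball p ε ∧
        (∀ j, ‖Φ z δ₀ w j‖ < C * (2 * ε)) ∧ r w < 0 ∧ -(B + 1) < r w} := by
      rintro w ⟨hwΩ, hw⟩
      refine ⟨hw, fun j => ?_, hr.neg hwΩ, by
        linarith [(abs_le.1 (hBle w hwΩ)).1]⟩
      have h1 := hT.lipschitz w (hεU' hw) z (hεU' hz)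
      rw [hS.centre z hzU δ₀ hδ₀, sub_zero] at h1
      have h2 : ‖w - z‖ < 2 * ε := by
        rw [← dist_eq_norm]
        linarith [dist_triangle_right w z p, Metric.mem_ball.1 hw, Metric.mem_ball.1 hz]
      calc ‖Φ z δ₀ w j‖ ≤ ‖Φ z δ₀ w‖ := norm_le_pi_norm _ j
        _ ≤ C * ‖w - z‖ := h1
        _ < C * (2 * ε) := by gcongr
    refine (lintegral_mono_set hsub).trans_lt ?_
    refine (lintegral_rpow_neg_le (φ := fun w => |r w|) (δ := B + 1)
      (D := C ^ Module.finrank ℝ (Fin n → ℂ) * (4 * Real.pi ^ n) * C *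
        (1 / (C * (2 * ε)) * ∏ _j : Fin n, (C * (2 * ε)) ^ 2))
      (hT.isOpen_layer hr.differentiable hεU' (fun _ => C * (2 * ε)) (B + 1)).measurableSet
      hrc.abs.measurable hs0 hs1 (by positivity) (by positivity)
      (fun w hw => abs_pos.2 hw.2.2.1.ne)
      (fun w hw => by rw [abs_of_neg hw.2.2.1]; linarith [hw.2.2.2])
      (fun t ht => ?_)).trans_lt ENNReal.ofReal_lt_top
    refine (measure_mono (t := {w | w ∈ Metric.ball p ε ∧ (∀ j, ‖Φ z δ₀ w j‖ < C * (2 * ε)) ∧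
        r w < 0 ∧ -t < r w}) ?_).trans
      ((hT.volume_layer_le hr.differentiable hε hεU (R := fun _ => C * (2 * ε)) (fun _ => hR)
        ht).trans (le_of_eq ?_))
    · rintro w ⟨hw, hwt⟩
      refine ⟨hw.1, hw.2.1, hw.2.2.1, ?_⟩
      rw [mem_ofPred_eq, abs_of_neg hw.2.2.1] at hwt
      linarith
    · congr 1
      ring

/-- The integral estimate localized to a neighbourhood of a boundary point, by summation of the
contributions of the polydiscs of dyadic sizes. -/
theorem IsSharpBTypeAt.exists_local_estimate (hΩo : IsOpen Ω) (hr : IsSmoothDefining Ω r)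
    {p : Fin n → ℂ} (hp : IsSharpBTypeAt Ω r p) {s : ℝ} (hs0 : 0 < s) (hs1 : s < 1) :
    ∃ ε > 0, ∃ M A : ℝ≥0∞, M ≠ ⊤ ∧ A ≠ ⊤ ∧ ∀ z ∈ Ω ∩ Metric.ball p ε,
      ∫⁻ w in Ω ∩ Metric.ball p ε, ‖bergmanKernel Ω z w‖ₑ * ENNReal.ofReal (|r w| ^ (-s))
        ≤ M * (∫⁻ w in Ω, ENNReal.ofReal (|r w| ^ (-s))) + A * ENNReal.ofReal (|r z| ^ (-s)) := by
  obtain ⟨U, δ₀, C, Φ, b, hpU, hS, hK, -⟩ := hp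
  have hC := hS.const_pos
  have hrc : Continuous r := hr.differentiable.continuous
  obtain ⟨ε, hε, hεU, hεU'⟩ := exists_ball_subset hS.isOpen hpU C
  obtain ⟨A, hA, hAle⟩ := hS.exists_lintegral_polydisc_le hr.differentiable hε hεU hs0 hs1
  set q : ℝ := 2 ^ (-s) with hq
  have hq0 : 0 < q := by positivity
  have hq1 : q < 1 := Real.rpow_lt_one_of_one_lt_of_neg (by norm_num) (by linarith)
  set M₁ := C * ((C ^ 2) ^ 2) ^ n with hM₁
  refine ⟨ε, hε, ENNReal.ofReal (C * ((2 * C / δ₀) ^ 2) ^ n),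
    ENNReal.ofReal (M₁ * A * (q * (1 - q)⁻¹)), ENNReal.ofReal_ne_top, ENNReal.ofReal_ne_top,
    fun z hz => ?_⟩
  have hzU : z ∈ Ω ∩ U := ⟨hz.1, hεU' hz.2⟩
  have hrz : 0 < |r z| := abs_pos.2 (hr.neg hz.1).ne
  set wt : (Fin n → ℂ) → ℝ≥0∞ := fun w => ENNReal.ofReal (|r w| ^ (-s))
  have hwtm : Measurable wt := by
    have := hrc.measurable
    fun_prop
  set δ : ℕ → ℝ := fun k => 2 ^ (k + 1) * |r z| with hδ
  have hδ0 : ∀ k, 0 < δ k := fun k => by positivity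
  set P : ℕ → ℝ := fun k => ∏ j, b j z (δ k) ^ 2 with hP
  set S : ℕ → Set (Fin n → ℂ) := fun k => {w | δ k ≤ δ₀ ∧ w ∈ Metric.ball p ε ∧
    (∀ j, ‖Φ z (δ k) w j‖ < C / b j z (δ k)) ∧ r w < 0 ∧ -(δ k) < r w} with hSdef
  have hSm : ∀ k, MeasurableSet (S k) := by
    intro k
    by_cases hk : δ k ≤ δ₀
    · simp only [hSdef, hk, true_and]
      exact ((hS.isTransversalChart hzU ⟨hδ0 k, hk⟩).isOpen_layer hr.differentiable
        hεU' (fun j => C / b j z (δ k)) (δ k)).measurableSet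
    · simp only [hSdef, hk, false_and]
      exact MeasurableSet.empty
  have hpt : ∀ w ∈ Ω ∩ Metric.ball p ε, ‖bergmanKernel Ω z w‖ₑ * wt w
      ≤ ENNReal.ofReal (C * ((2 * C / δ₀) ^ 2) ^ n) * wt w
        + ∑' k, (S k).indicator (fun w => ENNReal.ofReal (M₁ * P k) * wt w) w := by
    intro w hw
    have hwU : w ∈ Ω ∩ U := ⟨hw.1, hεU' hw.2⟩
    rw [← ofReal_norm]
    rcases norm_kernel_le_dyadic hS (fun z hz => hr.neg hz) hzU (hK z hzU w hwU) with
      h | ⟨k, hk1, hk2, hk3, hk4⟩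
    · refine le_add_right ?_
      gcongr
    · refine le_add_left ?_
      have hwS : w ∈ S k := by
        refine ⟨hk1, hw.2, fun j => ?_, hr.neg hw.1, ?_⟩
        · rw [lt_div_iff₀ (hS.b_pos z hzU _ ⟨hδ0 k, hk1⟩ j), mul_comm]
          exact hk3.2 j
        · rw [abs_of_neg (hr.neg hw.1)] at hk2
          linarith
      refine le_trans ?_ (ENNReal.le_tsum k)
      rw [indicator_of_mem hwS]
      gcongr
  have hterm : ∀ k, ∫⁻ w in Ω ∩ Metric.ball p ε,
      (S k).indicator (fun w => ENNReal.ofReal (M₁ * P k) * wt w) w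
      ≤ ENNReal.ofReal (M₁ * A * |r z| ^ (-s) * (q * q ^ k)) := by
    intro k
    have hnn : 0 ≤ M₁ * A * |r z| ^ (-s) * (q * q ^ k) := by positivity
    by_cases hk : δ k ≤ δ₀
    · calc ∫⁻ w in Ω ∩ Metric.ball p ε,
            (S k).indicator (fun w => ENNReal.ofReal (M₁ * P k) * wt w) w
          ≤ ∫⁻ w, (S k).indicator (fun w => ENNReal.ofReal (M₁ * P k) * wt w) w :=
            setLIntegral_le_lintegral _ _
        _ = ENNReal.ofReal M₁ * (ENNReal.ofReal (P k) * ∫⁻ w in S k, wt w) := by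
            rw [lintegral_indicator (hSm k), lintegral_const_mul _ hwtm,
              ENNReal.ofReal_mul (by positivity), mul_assoc]
        _ ≤ ENNReal.ofReal M₁ * ENNReal.ofReal (A * δ k ^ (-s)) := by
            gcongr
            have := hAle z hzU (δ k) ⟨hδ0 k, hk⟩
            simpa only [hSdef, hk, true_and] using this
        _ = _ := by
            rw [← ENNReal.ofReal_mul (by positivity)]
            congr 1
            have : δ k ^ (-s) = q * q ^ k * |r z| ^ (-s) := by
              rw [hδ, Real.mul_rpow (by positivity) hrz.le, ← pow_succ', hq,
                ← Real.rpow_natCast, ← Real.rpow_natCast, ← Real.rpow_mul (by norm_num),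
                ← Real.rpow_mul (by norm_num), mul_comm (-s)]
            rw [this]
            ring
    · have : S k = ∅ := by simp [hSdef, hk]
      simp [this]
  calc ∫⁻ w in Ω ∩ Metric.ball p ε, ‖bergmanKernel Ω z w‖ₑ * wt w
      ≤ ∫⁻ w in Ω ∩ Metric.ball p ε, (ENNReal.ofReal (C * ((2 * C / δ₀) ^ 2) ^ n) * wt w
        + ∑' k, (S k).indicator (fun w => ENNReal.ofReal (M₁ * P k) * wt w) w) :=
        setLIntegral_mono' (hΩo.measurableSet.inter Metric.isOpen_ball.measurableSet) hpt
    _ = ENNReal.ofReal (C * ((2 * C / δ₀) ^ 2) ^ n) * (∫⁻ w in Ω ∩ Metric.ball p ε, wt w)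
        + ∑' k, ∫⁻ w in Ω ∩ Metric.ball p ε,
          (S k).indicator (fun w => ENNReal.ofReal (M₁ * P k) * wt w) w := by
        rw [lintegral_add_left (hwtm.const_mul _), lintegral_const_mul _ hwtm,
          lintegral_tsum fun k => ((hwtm.const_mul _).indicator (hSm k)).aemeasurable]
    _ ≤ _ := by
        refine add_le_add (mul_le_mul_right (lintegral_mono_set inter_subset_left) _) ?_
        refine (ENNReal.tsum_le_tsum hterm).trans (le_of_eq ?_)
        rw [← ENNReal.ofReal_tsum_of_nonneg (fun k => by positivity)
          (((summable_geometric_of_lt_one hq0.le hq1).mul_left _).mul_left _), tsum_mul_left,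
          tsum_mul_left, tsum_geometric_of_lt_one hq0.le hq1,
          ← ENNReal.ofReal_mul (by have : 0 < 1 - q := by linarith
                                   positivity)]
        congr 1
        ring

/-- The hypothesis of Schur's test: `|r| ^ (-s)` is, up to a constant, a supersolution for the
absolute Bergman projection. -/
theorem exists_lintegral_kernel_le (hΩo : IsOpen Ω) (hΩb : Bornology.IsBounded Ω)
    (hoff : KernelBoundedOffDiagonal Ω)
    (hr : IsSmoothDefining Ω r) (hB : ∀ p ∈ frontier Ω, IsSharpBTypeAt Ω r p) {s : ℝ}
    (hs0 : 0 < s) (hs1 : s < 1) :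
    ∃ A : ℝ≥0∞, A ≠ ⊤ ∧ ∀ z ∈ Ω,
      ∫⁻ w in Ω, ‖bergmanKernel Ω z w‖ₑ * ENNReal.ofReal (|r w| ^ (-s))
        ≤ A * ENNReal.ofReal (|r z| ^ (-s)) := by
  obtain ⟨c, hc0, hct, hc⟩ := hr.exists_le_rpow_neg hΩb hs0
  have hJ := lintegral_rpow_neg_defining_lt_top hΩo hΩb hr hB hs0 hs1
  set J := ∫⁻ w in Ω, ENNReal.ofReal (|r w| ^ (-s)) with hJdef
  have hrm := hr.differentiable.continuous.measurable
  have hwtm : Measurable fun w => ENNReal.ofReal (|r w| ^ (-s)) := by fun_prop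
  -- a constant is dominated by a multiple of the weight
  have hconst : ∀ x : ℝ≥0∞, ∀ z ∈ Ω, x ≤ x / c * ENNReal.ofReal (|r z| ^ (-s)) := fun x z hz =>
    calc x = x / c * c := (ENNReal.div_mul_cancel hc0 hct).symm
      _ ≤ _ := mul_le_mul_right (hc z hz) _
  have hbd : ∀ (M : ℝ) (T : Set (Fin n → ℂ)) (z : Fin n → ℂ), MeasurableSet T → T ⊆ Ω →
      (∀ w ∈ T, ‖bergmanKernel Ω z w‖ ≤ M) →
      ∫⁻ w in T, ‖bergmanKernel Ω z w‖ₑ * ENNReal.ofReal (|r w| ^ (-s))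
        ≤ ENNReal.ofReal M * J := by
    intro M T z hT hTΩ hM
    calc ∫⁻ w in T, ‖bergmanKernel Ω z w‖ₑ * ENNReal.ofReal (|r w| ^ (-s))
        ≤ ∫⁻ w in T, ENNReal.ofReal M * ENNReal.ofReal (|r w| ^ (-s)) := by
          refine setLIntegral_mono' hT fun w hw => ?_
          rw [← ofReal_norm]
          gcongr
          exact hM w hw
      _ = ENNReal.ofReal M * ∫⁻ w in T, ENNReal.ofReal (|r w| ^ (-s)) :=
          lintegral_const_mul _ hwtm
      _ ≤ ENNReal.ofReal M * J := mul_le_mul_right (lintegral_mono_set hTΩ) _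
  have hdivtop : ∀ x : ℝ≥0∞, x ≠ ⊤ → x / c ≠ ⊤ := fun x hx => ENNReal.div_ne_top hx hc0
  suffices h : ∃ A : ℝ≥0∞, A ≠ ⊤ ∧ ∀ z ∈ Ω ∩ closure Ω,
      ∫⁻ w in Ω, ‖bergmanKernel Ω z w‖ₑ * ENNReal.ofReal (|r w| ^ (-s))
        ≤ A * ENNReal.ofReal (|r z| ^ (-s)) by
    rwa [inter_eq_left.2 subset_closure] at h
  refine hΩb.isCompact_closure.induction_on (p := fun S => ∃ A : ℝ≥0∞, A ≠ ⊤ ∧ ∀ z ∈ Ω ∩ S,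
      ∫⁻ w in Ω, ‖bergmanKernel Ω z w‖ₑ * ENNReal.ofReal (|r w| ^ (-s))
        ≤ A * ENNReal.ofReal (|r z| ^ (-s))) ⟨0, by simp, by simp⟩ ?_ ?_ ?_
  · rintro S T hST ⟨A, hA, h⟩
    exact ⟨A, hA, fun z hz => h z ⟨hz.1, hST hz.2⟩⟩
  · rintro S T ⟨A, hA, h⟩ ⟨A', hA', h'⟩
    refine ⟨max A A', (max_lt hA.lt_top hA'.lt_top).ne, fun z hz => ?_⟩
    rcases hz.2 with hz' | hz'
    · exact (h z ⟨hz.1, hz'⟩).trans (mul_le_mul_left (le_max_left _ _) _)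
    · exact (h' z ⟨hz.1, hz'⟩).trans (mul_le_mul_left (le_max_right _ _) _)
  intro p hp
  by_cases hpΩ : p ∈ Ω
  · obtain ⟨M, V, hV, hM⟩ := hoff.exists_bound_of_mem hΩo hΩb hpΩ
    refine ⟨V, mem_nhdsWithin_of_mem_nhds hV, ENNReal.ofReal M * J / c,
      hdivtop _ (ENNReal.mul_ne_top ENNReal.ofReal_ne_top hJ.ne), fun z hz => ?_⟩
    exact (hbd M Ω z hΩo.measurableSet subset_rfl (hM z hz)).trans (hconst _ z hz.1)
  · have hpf : p ∈ frontier Ω := by rw [hΩo.frontier_eq]; exact ⟨hp, hpΩ⟩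
    obtain ⟨ε, hε, M, A, hMt, hAt, hloc⟩ :=
      (hB p hpf).exists_local_estimate hΩo hr hs0 hs1
    obtain ⟨M', V, hV, hM'⟩ := hoff.exists_bound hp
      (hΩb.isCompact_closure.diff (Metric.isOpen_ball (x := p) (ε := ε))) sdiff_subset
      (fun h => absurd (Metric.mem_ball_self hε) h.2)
    refine ⟨V ∩ Metric.ball p ε, mem_nhdsWithin_of_mem_nhds
      (inter_mem hV (Metric.ball_mem_nhds p hε)),
      (ENNReal.ofReal M' * J + M * J) / c + A, ?_, fun z hz => ?_⟩
    · exact ENNReal.add_ne_top.2 ⟨hdivtop _ (ENNReal.add_ne_top.2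
        ⟨ENNReal.mul_ne_top ENNReal.ofReal_ne_top hJ.ne, ENNReal.mul_ne_top hMt hJ.ne⟩), hAt⟩
    · have h1 := hbd M' (Ω \ Metric.ball p ε) z
        (hΩo.measurableSet.diff Metric.isOpen_ball.measurableSet) sdiff_subset
        (fun w hw => hM' z ⟨hz.1, hz.2.1⟩ w ⟨hw.1, subset_closure hw.1, hw.2⟩)
      have h2 := hloc z ⟨hz.1, hz.2.2⟩
      rw [← lintegral_inter_add_sdiff _ Ω (Metric.isOpen_ball (x := p) (ε := ε)).measurableSet]
      calc _ ≤ (M * J + A * ENNReal.ofReal (|r z| ^ (-s))) + ENNReal.ofReal M' * J :=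
            add_le_add h2 h1
        _ = (ENNReal.ofReal M' * J + M * J) + A * ENNReal.ofReal (|r z| ^ (-s)) := by ring
        _ ≤ _ := by
            rw [add_mul]
            gcongr
            exact hconst _ z hz.1

/-- By the upper bound for the kernel near the boundary diagonal and the lower bound on the
diagonal, `K(z, w)` is at most a constant times `K(z, z)`. -/
theorem exists_norm_kernel_le_mul_self (hΩo : IsOpen Ω) (hΩb : Bornology.IsBounded Ω)
    (hoff : KernelBoundedOffDiagonal Ω)
    (hr : IsSmoothDefining Ω r) (hB : ∀ p ∈ frontier Ω, IsSharpBTypeAt Ω r p) :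
    ∃ A : ℝ, ∀ z ∈ Ω, ∀ w ∈ Ω, ‖bergmanKernel Ω z w‖ ≤ A * (bergmanKernel Ω z z).re := by
  have hex : ∀ z ∈ Ω, ∃ k, IsReproducingAt Ω z k := fun z hz => exists_isReproducingAt hΩo hz
  have hdiag : ∀ z ∈ Ω, 1 ≤ volume.real Ω * (bergmanKernel Ω z z).re := fun z hz =>
    (one_le_volume_mul_bergmanKernel_self hex hΩb.measure_lt_top.ne hz).2
  have hpos : ∀ z ∈ Ω, 0 < (bergmanKernel Ω z z).re := fun z hz =>
    bergmanKernel_self_re_pos hex hΩb.measure_lt_top.ne hz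
  -- the bounded part is controlled by the lower bound `K(z, z) ≥ 1 / vol Ω`
  have hbd : ∀ (M : ℝ), ∀ z ∈ Ω, ∀ w, ‖bergmanKernel Ω z w‖ ≤ M →
      ‖bergmanKernel Ω z w‖ ≤ max M 0 * volume.real Ω * (bergmanKernel Ω z z).re := by
    intro M z hz w h
    calc ‖bergmanKernel Ω z w‖ ≤ max M 0 * 1 := by rw [mul_one]; exact h.trans (le_max_left _ _)
      _ ≤ max M 0 * (volume.real Ω * (bergmanKernel Ω z z).re) :=
          mul_le_mul_of_nonneg_left (hdiag z hz) (le_max_right _ _)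
      _ = _ := by ring
  suffices h : ∃ A : ℝ, ∀ z ∈ Ω ∩ closure Ω, ∀ w ∈ Ω,
      ‖bergmanKernel Ω z w‖ ≤ A * (bergmanKernel Ω z z).re by
    rwa [inter_eq_left.2 subset_closure] at h
  refine hΩb.isCompact_closure.induction_on (p := fun S => ∃ A : ℝ, ∀ z ∈ Ω ∩ S, ∀ w ∈ Ω,
      ‖bergmanKernel Ω z w‖ ≤ A * (bergmanKernel Ω z z).re) ⟨0, by simp⟩ ?_ ?_ ?_
  · rintro S T hST ⟨A, h⟩
    exact ⟨A, fun z hz => h z ⟨hz.1, hST hz.2⟩⟩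
  · rintro S T ⟨A, h⟩ ⟨A', h'⟩
    refine ⟨max A A', fun z hz w hw => ?_⟩
    have h0 := (hpos z hz.1).le
    rcases hz.2 with hz' | hz'
    · exact (h z ⟨hz.1, hz'⟩ w hw).trans (mul_le_mul_of_nonneg_right (le_max_left _ _) h0)
    · exact (h' z ⟨hz.1, hz'⟩ w hw).trans (mul_le_mul_of_nonneg_right (le_max_right _ _) h0)
  intro p hp
  by_cases hpΩ : p ∈ Ω
  · obtain ⟨M, V, hV, hM⟩ := hoff.exists_bound_of_mem hΩo hΩb hpΩ
    exact ⟨V, mem_nhdsWithin_of_mem_nhds hV, max M 0 * volume.real Ω,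
      fun z hz w hw => hbd M z hz.1 w (hM z hz w hw)⟩
  · have hpf : p ∈ frontier Ω := by rw [hΩo.frontier_eq]; exact ⟨hp, hpΩ⟩
    obtain ⟨U, δ₀, C, Φ, b, hpU, hS, hK, hKd⟩ := hB p hpf
    have hC := hS.const_pos
    obtain ⟨M, V, hV, hM⟩ := hoff.exists_bound hp
      (hΩb.isCompact_closure.diff hS.isOpen) sdiff_subset (fun h => absurd hpU h.2)
    have hrp : r p = 0 := by
      by_contra hne
      have hcl : r p ≤ 0 := by
        have : closure Ω ⊆ {z | r z ≤ 0} := closure_minimal (fun z hz => (hr.neg hz).le)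
          (isClosed_le hr.differentiable.continuous continuous_const)
        exact this hp
      apply hpΩ
      rw [hr.2.1]
      exact lt_of_le_of_ne hcl hne
    have hsmall : ∀ᶠ z in 𝓝 p, |r z| < δ₀ :=
      (hr.differentiable.continuous.abs.tendsto p).eventually_lt_const
        (by rw [hrp, abs_zero]; exact hS.scale_pos)
    refine ⟨V ∩ (U ∩ {z | |r z| < δ₀}), mem_nhdsWithin_of_mem_nhds
      (inter_mem hV (inter_mem (hS.isOpen.mem_nhds hpU) hsmall)),
      max (max M 0 * volume.real Ω) (C * (C ^ 2) ^ n * C), fun z hz w hw => ?_⟩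
    have h0 := (hpos z hz.1).le
    by_cases hwU : w ∈ U
    · refine le_trans ?_ (mul_le_mul_of_nonneg_right (le_max_right _ _) h0)
      have hzU : z ∈ Ω ∩ U := ⟨hz.1, hz.2.2.1⟩
      have hrz : 0 < |r z| := abs_pos.2 (hr.neg hz.1).ne
      have hrz' : |r z| < δ₀ := hz.2.2.2
      have hMn := bDist_nonneg (U := U) (Φ := Φ) (b := b) hS.scale_pos z w
      have hle : |r z| ≤ bScale r U δ₀ Φ b z w :=
        le_min hrz'.le (by linarith [abs_nonneg (r w)])
      have hmem : bScale r U δ₀ Φ b z w ∈ Ioc 0 δ₀ := ⟨hrz.trans_le hle, min_le_left _ _⟩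
      have hrmem : |r z| ∈ Ioc 0 δ₀ := ⟨hrz, hrz'.le⟩
      calc ‖bergmanKernel Ω z w‖ ≤ C * ∏ j, b j z (bScale r U δ₀ Φ b z w) ^ 2 :=
            hK z hzU w ⟨hw, hwU⟩
        _ ≤ C * ((C ^ 2) ^ n * ∏ j, b j z |r z| ^ 2) := by
            refine mul_le_mul_of_nonneg_left ?_ hC.le
            rw [← Fin.prod_const n (C ^ 2), ← Finset.prod_mul_distrib]
            refine Finset.prod_le_prod (fun j _ => by positivity) fun j _ => ?_
            rw [← mul_pow]
            exact pow_le_pow_left₀ (hS.b_pos z hzU _ hmem j).le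
              (hS.b_almost_antitone z hzU _ hrmem _ hmem hle j) 2
        _ ≤ C * ((C ^ 2) ^ n * (C * (bergmanKernel Ω z z).re)) := by
            gcongr
            exact hKd z hzU hrz'.le
        _ = _ := by ring
    · refine le_trans ?_ (mul_le_mul_of_nonneg_right (le_max_left _ _) h0)
      exact hbd M z hz.1 w (hM z ⟨hz.1, hz.2.1⟩ w ⟨hw, subset_closure hw, hwU⟩)

end Global

/-! ### Positive kernels on `L^p`: Schur's test and products -/

section PositiveKernel

/-- The operator on nonnegative functions with the kernel `k ≥ 0` is bounded on `L^p(μ)`, and the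
`p`-th power of its norm is at most `A`. -/
def IsLpBoundedKernel {X : Type*} [MeasurableSpace X] (μ : Measure X) (k : X → X → ℝ≥0∞) (p : ℝ)
    (A : ℝ≥0∞) : Prop :=
  ∀ f : X → ℝ≥0∞, Measurable f →
    ∫⁻ z, (∫⁻ w, k z w * f w ∂μ) ^ p ∂μ ≤ A * ∫⁻ w, f w ^ p ∂μ

variable {X Y : Type*} [MeasurableSpace X] [MeasurableSpace Y] {μ : Measure X} {ν : Measure Y}

/-- **Schur's test**: Hölder's inequality for the measure `k(z, ·) μ` is applied to the
factorization `f = (f / h) h`. -/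
theorem isLpBoundedKernel_of_schur [SFinite μ] {k : X → X → ℝ≥0∞}
    (hk : Measurable (Function.uncurry k)) {p q : ℝ} (hpq : p.HolderConjugate q) {h : X → ℝ≥0∞}
    (hh : Measurable h) (h0 : ∀ᵐ x ∂μ, h x ≠ 0 ∧ h x ≠ ⊤) {C : ℝ≥0∞}
    (h1 : ∀ᵐ z ∂μ, ∫⁻ w, k z w * h w ^ q ∂μ ≤ C * h z ^ q)
    (h2 : ∀ᵐ w ∂μ, ∫⁻ z, k z w * h z ^ p ∂μ ≤ C * h w ^ p) :
    IsLpBoundedKernel μ k p (C ^ (p / q) * C) := by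
  intro f hf
  have hp := hpq.pos
  have hq := hpq.symm.pos
  have hkz : ∀ z, Measurable (k z) := fun z => hk.comp measurable_prodMk_left
  set g : X → ℝ≥0∞ := fun w => f w ^ p * (h w ^ p)⁻¹ with hg
  have hgm : Measurable g := (hf.pow_const p).mul (hh.pow_const p).inv
  have hholder : ∀ᵐ z ∂μ, (∫⁻ w, k z w * f w ∂μ) ^ p
      ≤ C ^ (p / q) * (h z ^ p * ∫⁻ w, k z w * g w ∂μ) := by
    filter_upwards [h1] with z hz
    set κ := μ.withDensity (k z) with hκ
    have hκint : ∀ u : X → ℝ≥0∞, Measurable u → ∫⁻ w, u w ∂κ = ∫⁻ w, k z w * u w ∂μ :=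
      fun u hu => lintegral_withDensity_eq_lintegral_mul _ (hkz z) hu
    have e1 : ∫⁻ w, k z w * f w ∂μ = ∫⁻ w, ((fun w => f w * (h w)⁻¹) * h) w ∂κ := by
      rw [← hκint f hf]
      refine lintegral_congr_ae ((withDensity_absolutelyContinuous μ (k z)).ae_le ?_)
      filter_upwards [h0] with w hw
      rw [Pi.mul_apply, mul_assoc, ENNReal.inv_mul_cancel hw.1 hw.2, mul_one]
    have e2 : ∫⁻ w, (f w * (h w)⁻¹) ^ p ∂κ = ∫⁻ w, k z w * g w ∂μ := by
      rw [← hκint g hgm]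
      refine lintegral_congr fun w => ?_
      rw [ENNReal.mul_rpow_of_nonneg _ _ hp.le, ENNReal.inv_rpow]
    have hol := ENNReal.lintegral_mul_le_Lp_mul_Lq κ hpq (f := fun w => f w * (h w)⁻¹) (g := h)
      (hf.mul hh.inv).aemeasurable hh.aemeasurable
    rw [← e1, e2, hκint _ (hh.pow_const q)] at hol
    calc (∫⁻ w, k z w * f w ∂μ) ^ p
        ≤ ((∫⁻ w, k z w * g w ∂μ) ^ (1 / p) * (C * h z ^ q) ^ (1 / q)) ^ p := by
          gcongr
          exact hol.trans (by gcongr)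
      _ = _ := by
          rw [ENNReal.mul_rpow_of_nonneg _ _ hp.le, ← ENNReal.rpow_mul, ← ENNReal.rpow_mul,
            ENNReal.mul_rpow_of_nonneg _ _ (by positivity), ← ENNReal.rpow_mul,
            one_div_mul_cancel hp.ne', ENNReal.rpow_one]
          have e3 : 1 / q * p = p / q := by ring
          have e4 : q * (1 / q * p) = p := by field_simp
          rw [e4, e3]
          ring
  have hkg : Measurable fun z => ∫⁻ w, k z w * g w ∂μ :=
    Measurable.lintegral_prod_right' (f := fun x : X × X => k x.1 x.2 * g x.2)
      (hk.mul (hgm.comp measurable_snd))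
  calc ∫⁻ z, (∫⁻ w, k z w * f w ∂μ) ^ p ∂μ
      ≤ ∫⁻ z, C ^ (p / q) * (h z ^ p * ∫⁻ w, k z w * g w ∂μ) ∂μ := lintegral_mono_ae hholder
    _ = C ^ (p / q) * ∫⁻ z, ∫⁻ w, h z ^ p * (k z w * g w) ∂μ ∂μ := by
        have hm : Measurable fun z => h z ^ p * ∫⁻ w, k z w * g w ∂μ :=
          (hh.pow_const p).mul hkg
        rw [lintegral_const_mul _ hm]
        congr 1
        refine lintegral_congr fun z => ?_
        have hm : Measurable fun w => k z w * g w := (hkz z).mul hgm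
        rw [lintegral_const_mul _ hm]
    _ = C ^ (p / q) * ∫⁻ w, ∫⁻ z, h z ^ p * (k z w * g w) ∂μ ∂μ := by
        rw [lintegral_lintegral_swap]
        exact (((hh.pow_const p).comp measurable_fst).mul
          (hk.mul (hgm.comp measurable_snd))).aemeasurable
    _ ≤ C ^ (p / q) * ∫⁻ w, C * f w ^ p ∂μ := by
        refine mul_le_mul_right (lintegral_mono_ae ?_) _
        filter_upwards [h2] with w hw
        have hkw : Measurable fun z => k z w * h z ^ p :=
          (hk.comp measurable_prodMk_right).mul (hh.pow_const p)
        calc ∫⁻ z, h z ^ p * (k z w * g w) ∂μ = ∫⁻ z, g w * (k z w * h z ^ p) ∂μ := by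
              refine lintegral_congr fun z => ?_
              ring
          _ = g w * ∫⁻ z, k z w * h z ^ p ∂μ := lintegral_const_mul _ hkw
          _ ≤ g w * (C * h w ^ p) := mul_le_mul_right hw _
          _ = C * f w ^ p * ((h w ^ p)⁻¹ * h w ^ p) := by rw [hg]; ring
          _ ≤ C * f w ^ p * 1 := mul_le_mul_right (ENNReal.inv_mul_le_one _) _
          _ = C * f w ^ p := mul_one _
    _ = _ := by rw [lintegral_const_mul _ (hf.pow_const p), mul_assoc]

theorem IsLpBoundedKernel.prod [SFinite μ] [SFinite ν] {k : X → X → ℝ≥0∞} {l : Y → Y → ℝ≥0∞}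
    (hk : Measurable (Function.uncurry k)) (hl : Measurable (Function.uncurry l)) {p : ℝ}
    {A B : ℝ≥0∞} (hA : IsLpBoundedKernel μ k p A) (hB : IsLpBoundedKernel ν l p B) :
    IsLpBoundedKernel (μ.prod ν) (fun z w => k z.1 w.1 * l z.2 w.2) p (A * B) := by
  intro f hf
  have hkz : ∀ z, Measurable (k z) := fun z => hk.comp measurable_prodMk_left
  have hlz : ∀ z, Measurable (l z) := fun z => hl.comp measurable_prodMk_left
  set G : X → Y → ℝ≥0∞ := fun w₁ z₂ => ∫⁻ w₂, l z₂ w₂ * f (w₁, w₂) ∂ν with hG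
  have hGm : Measurable (Function.uncurry G) :=
    Measurable.lintegral_prod_right'
      (f := fun x : (X × Y) × Y => l x.1.2 x.2 * f (x.1.1, x.2)) (by
        refine Measurable.mul (hl.comp (g := Function.uncurry l) (f := fun x : (X × Y) × Y =>
          (x.1.2, x.2)) (by fun_prop)) (hf.comp (by fun_prop)))
  have hin : ∀ z : X × Y, ∫⁻ w, k z.1 w.1 * l z.2 w.2 * f w ∂(μ.prod ν)
      = ∫⁻ w₁, k z.1 w₁ * G w₁ z.2 ∂μ := by
    intro z
    have hm : Measurable fun w : X × Y => k z.1 w.1 * l z.2 w.2 * f w :=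
      (((hkz z.1).comp measurable_fst).mul ((hlz z.2).comp measurable_snd)).mul hf
    rw [lintegral_prod _ hm.aemeasurable]
    refine lintegral_congr fun w₁ => ?_
    have hm2 : Measurable fun w₂ => l z.2 w₂ * f (w₁, w₂) :=
      (hlz z.2).mul (hf.comp measurable_prodMk_left)
    simp only [mul_assoc]
    rw [lintegral_const_mul _ hm2]
  have hmeas : Measurable fun z : X × Y => (∫⁻ w₁, k z.1 w₁ * G w₁ z.2 ∂μ) ^ p :=
    (Measurable.lintegral_prod_right'
      (f := fun x : (X × Y) × X => k x.1.1 x.2 * G x.2 x.1.2) (by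
        refine Measurable.mul (hk.comp (g := Function.uncurry k) (f := fun x : (X × Y) × X =>
          (x.1.1, x.2)) (by fun_prop)) (hGm.comp (g := Function.uncurry G)
          (f := fun x : (X × Y) × X => (x.2, x.1.2)) (by fun_prop)))).pow_const p
  simp only [hin]
  calc ∫⁻ z, (∫⁻ w₁, k z.1 w₁ * G w₁ z.2 ∂μ) ^ p ∂(μ.prod ν)
      = ∫⁻ z₂, ∫⁻ z₁, (∫⁻ w₁, k z₁ w₁ * G w₁ z₂ ∂μ) ^ p ∂μ ∂ν :=
        lintegral_prod_symm _ hmeas.aemeasurable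
    _ ≤ ∫⁻ z₂, A * ∫⁻ w₁, G w₁ z₂ ^ p ∂μ ∂ν :=
        lintegral_mono fun z₂ => hA _ (hGm.comp measurable_prodMk_right)
    _ = A * ∫⁻ w₁, ∫⁻ z₂, G w₁ z₂ ^ p ∂ν ∂μ := by
        rw [lintegral_const_mul _ (Measurable.lintegral_prod_left'
          (f := fun x : X × Y => G x.1 x.2 ^ p) (hGm.pow_const p)),
          ← lintegral_lintegral_swap (hGm.pow_const p).aemeasurable]
    _ ≤ A * ∫⁻ w₁, B * ∫⁻ w₂, f (w₁, w₂) ^ p ∂ν ∂μ :=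
        mul_le_mul_right (lintegral_mono fun w₁ => hB _ (hf.comp measurable_prodMk_left)) _
    _ = A * B * ∫⁻ w, f w ^ p ∂(μ.prod ν) := by
        rw [lintegral_const_mul _ (Measurable.lintegral_prod_right'
          (f := fun x : X × Y => f x ^ p) (hf.pow_const p)),
          lintegral_prod _ (hf.pow_const p).aemeasurable, mul_assoc]

theorem IsLpBoundedKernel.pi {m : ℕ} {X : Fin m → Type*} [∀ j, MeasurableSpace (X j)]
    {μ : ∀ j, Measure (X j)} [∀ j, SigmaFinite (μ j)] {k : ∀ j, X j → X j → ℝ≥0∞}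
    (hk : ∀ j, Measurable (Function.uncurry (k j))) {p : ℝ} {A : Fin m → ℝ≥0∞}
    (hA : ∀ j, IsLpBoundedKernel (μ j) (k j) p (A j)) :
    IsLpBoundedKernel (Measure.pi μ) (fun z w => ∏ j, k j (z j) (w j)) p (∏ j, A j) := by
  induction m with
  | zero =>
    intro f hf
    simp [Measure.pi_of_empty μ (fun j => Fin.elim0 j)]
  | succ m ih =>
    intro f hf
    have hmp := measurePreserving_finConsMeasurableEquiv μ
    have hkr : Measurable (Function.uncurry fun z w : ∀ j : Fin m, X j.succ =>
        ∏ j, k j.succ (z j) (w j)) := by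
      refine Finset.measurable_fun_prod _ fun j _ => ?_
      exact (hk j.succ).comp (g := Function.uncurry (k j.succ)) (f := fun x :
        (∀ j : Fin m, X j.succ) × (∀ j : Fin m, X j.succ) => (x.1 j, x.2 j)) (by fun_prop)
    have h := (hA 0).prod (hk 0) hkr
      (ih (fun j : Fin m => hk j.succ) (fun j : Fin m => hA j.succ))
      (fun x => f (finConsMeasurableEquiv X x)) (hf.comp (finConsMeasurableEquiv X).measurable)
    rw [Fin.prod_univ_succ]
    simp only [hmp.lintegral_map_equiv]
    convert! h using 6 with z w
    simp [Fin.prod_univ_succ]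

theorem IsLpBoundedKernel.mono_restrict {Ω : Set X} (hΩ : MeasurableSet Ω)
    {k l : X → X → ℝ≥0∞} {p : ℝ} (hp : 0 ≤ p) {A S : ℝ≥0∞}
    (hS : ∀ z ∈ Ω, ∀ w ∈ Ω, k z w ≤ S * l z w) (h : IsLpBoundedKernel (μ.restrict Ω) l p A) :
    IsLpBoundedKernel (μ.restrict Ω) k p (S ^ p * A) := by
  intro f hf
  calc ∫⁻ z in Ω, (∫⁻ w in Ω, k z w * f w ∂μ) ^ p ∂μ
      ≤ ∫⁻ z in Ω, (∫⁻ w in Ω, l z w * (S * f w) ∂μ) ^ p ∂μ := by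
        refine setLIntegral_mono' hΩ fun z hz => ?_
        gcongr ?_ ^ p
        refine setLIntegral_mono' hΩ fun w hw => ?_
        calc k z w * f w ≤ S * l z w * f w := mul_le_mul_left (hS z hz w hw) _
          _ = l z w * (S * f w) := by ring
    _ ≤ A * ∫⁻ w in Ω, (S * f w) ^ p ∂μ := h _ (hf.const_mul S)
    _ = _ := by
        simp only [ENNReal.mul_rpow_of_nonneg _ _ hp]
        rw [lintegral_const_mul _ (hf.pow_const p)]
        ring

end PositiveKernel

/-! ### Integral operators on `L^p(Ω)` -/

section IntegralOp

variable {E : Type*} [MeasureSpace E]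

/-- A kernel on `Ω` that is jointly measurable, and bounded in the second variable for each value
of the first: the associated integral is then defined pointwise on `L^p(Ω)` for `p ≥ 1`. -/
structure IsRegularKernel (Ω : Set E) (k : E → E → ℝ) : Prop where
  measurableSet : MeasurableSet Ω
  measurable : Measurable ((Ω ×ˢ Ω).indicator (Function.uncurry k))
  bounded : ∀ z ∈ Ω, ∃ M : ℝ, ∀ w ∈ Ω, |k z w| ≤ M

variable {Ω : Set E} {k : E → E → ℝ}

theorem enorm_integralOp_le (f : E → ℂ) (z : E) :
    ‖integralOp Ω k f z‖ₑ ≤ ∫⁻ w in Ω, ‖k z w‖ₑ * ‖f w‖ₑ := by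
  refine (enorm_integral_le_lintegral_enorm _).trans (le_of_eq (lintegral_congr fun w => ?_))
  rw [enorm_mul, ← ofReal_norm, Complex.norm_real, ofReal_norm]

theorem IsRegularKernel.integrableOn (h : IsRegularKernel Ω k) (hvol : volume Ω ≠ ⊤) {p : ℝ≥0∞}
    (hp : 1 ≤ p) {f : E → ℂ} (hf : MemLp f p (volume.restrict Ω)) {z : E} (hz : z ∈ Ω) :
    IntegrableOn (fun w => (k z w : ℂ) * f w) Ω := by
  have : IsFiniteMeasure (volume.restrict Ω) := ⟨by
    rw [Measure.restrict_apply_univ]; exact hvol.lt_top⟩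
  obtain ⟨M, hM⟩ := h.bounded z hz
  have hm : AEStronglyMeasurable (fun w => (k z w : ℂ)) (volume.restrict Ω) := by
    have h1 : Measurable fun w => (((Ω ×ˢ Ω).indicator (Function.uncurry k) (z, w) : ℝ) : ℂ) :=
      Complex.measurable_ofReal.comp (h.measurable.comp measurable_prodMk_left)
    refine h1.aestronglyMeasurable.congr ?_
    filter_upwards [ae_restrict_mem h.measurableSet] with w hw
    rw [indicator_of_mem (show (z, w) ∈ Ω ×ˢ Ω from ⟨hz, hw⟩)]
    rfl
  refine (hf.integrable hp).bdd_mul (c := M) hm ?_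
  filter_upwards [ae_restrict_mem h.measurableSet] with w hw
  rw [Complex.norm_real]
  exact hM w hw

theorem IsRegularKernel.aestronglyMeasurable_integralOp [SFinite (volume : Measure E)]
    (h : IsRegularKernel Ω k) {f : E → ℂ}
    (hf : AEStronglyMeasurable f (volume.restrict Ω)) :
    AEStronglyMeasurable (integralOp Ω k f) (volume.restrict Ω) := by
  have h1 : AEStronglyMeasurable (fun x : E × E =>
      (((Ω ×ˢ Ω).indicator (Function.uncurry k) x : ℝ) : ℂ) * f x.2)
      ((volume.restrict Ω).prod (volume.restrict Ω)) :=
    (Complex.measurable_ofReal.comp h.measurable).aestronglyMeasurable.mul hf.comp_snd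
  refine h1.integral_prod_right'.congr ?_
  filter_upwards [ae_restrict_mem h.measurableSet] with z hz
  refine integral_congr_ae ?_
  filter_upwards [ae_restrict_mem h.measurableSet] with w hw
  rw [indicator_of_mem (show (z, w) ∈ Ω ×ˢ Ω from ⟨hz, hw⟩)]
  rfl

/-- A bound for a positive kernel on nonnegative functions gives a bound for the integral operator
on complex-valued functions. -/
theorem eLpNorm_integralOp_le {p : ℝ≥0∞} (hp0 : p ≠ 0) (hpt : p ≠ ⊤) {A : ℝ≥0∞}
    (hA : IsLpBoundedKernel (volume.restrict Ω) (fun z w => ‖k z w‖ₑ) p.toReal A) {f : E → ℂ}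
    (hf : AEStronglyMeasurable f (volume.restrict Ω)) :
    eLpNorm (integralOp Ω k f) p (volume.restrict Ω)
      ≤ A ^ (1 / p.toReal) * eLpNorm f p (volume.restrict Ω) := by
  have hP : 0 < p.toReal := ENNReal.toReal_pos hp0 hpt
  rw [eLpNorm_eq_lintegral_rpow_enorm_toReal hp0 hpt,
    eLpNorm_eq_lintegral_rpow_enorm_toReal hp0 hpt, ← ENNReal.mul_rpow_of_nonneg _ _ (by positivity)]
  gcongr
  set g := hf.mk f with hg
  have hfg : f =ᵐ[volume.restrict Ω] g := hf.ae_eq_mk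
  calc ∫⁻ z in Ω, ‖integralOp Ω k f z‖ₑ ^ p.toReal
      ≤ ∫⁻ z in Ω, (∫⁻ w in Ω, ‖k z w‖ₑ * ‖g w‖ₑ) ^ p.toReal := by
        refine lintegral_mono fun z => ?_
        gcongr
        refine (enorm_integralOp_le f z).trans (le_of_eq (lintegral_congr_ae ?_))
        filter_upwards [hfg] with w hw
        rw [hw]
    _ ≤ A * ∫⁻ w in Ω, ‖g w‖ₑ ^ p.toReal := hA _ hf.stronglyMeasurable_mk.measurable.enorm
    _ = A * ∫⁻ w in Ω, ‖f w‖ₑ ^ p.toReal := by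
        congr 1
        refine lintegral_congr_ae ?_
        filter_upwards [hfg] with w hw
        rw [hw]

theorem lpOpNorm_le {p : ℝ≥0∞} (hp0 : p ≠ 0) (hpt : p ≠ ⊤) {A : ℝ≥0∞}
    (hA : IsLpBoundedKernel (volume.restrict Ω) (fun z w => ‖k z w‖ₑ) p.toReal A) :
    lpOpNorm Ω p k ≤ A ^ (1 / p.toReal) :=
  sInf_le fun _ hf => eLpNorm_integralOp_le hp0 hpt hA hf.1

theorem IsRegularKernel.isBoundedOnLp_of_eLpNorm_le [SFinite (volume : Measure E)]
    (h : IsRegularKernel Ω k) (hvol : volume Ω ≠ ⊤) {p : ℝ≥0∞} (hp : 1 ≤ p) {C : ℝ≥0∞}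
    (hC : C ≠ ⊤) (hle : ∀ f : E → ℂ, MemLp f p (volume.restrict Ω) →
      eLpNorm (integralOp Ω k f) p (volume.restrict Ω)
        ≤ C * eLpNorm f p (volume.restrict Ω)) : IsBoundedOnLp Ω p k :=
  ⟨fun f hf => ⟨fun _ hz => h.integrableOn hvol hp hf hz,
    h.aestronglyMeasurable_integralOp hf.1,
    (hle f hf).trans_lt (ENNReal.mul_lt_top hC.lt_top hf.2)⟩, C, hC, hle⟩

theorem IsRegularKernel.isBoundedOnLp [SFinite (volume : Measure E)]
    (h : IsRegularKernel Ω k) (hvol : volume Ω ≠ ⊤) {p : ℝ≥0∞} (hp : 1 ≤ p) (hpt : p ≠ ⊤)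
    {A : ℝ≥0∞} (hAt : A ≠ ⊤)
    (hA : IsLpBoundedKernel (volume.restrict Ω) (fun z w => ‖k z w‖ₑ) p.toReal A) :
    IsBoundedOnLp Ω p k :=
  h.isBoundedOnLp_of_eLpNorm_le hvol hp (ENNReal.rpow_ne_top_of_nonneg (by positivity) hAt)
    fun _ hf => eLpNorm_integralOp_le (zero_lt_one.trans_le hp).ne' hpt hA hf.1

theorem IsRegularKernel.isBoundedOnLp_top [SFinite (volume : Measure E)]
    (h : IsRegularKernel Ω k) (hvol : volume Ω ≠ ⊤) {A : ℝ≥0∞} (hAt : A ≠ ⊤)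
    (hA : ∀ z ∈ Ω, ∫⁻ w in Ω, ‖k z w‖ₑ ≤ A) : IsBoundedOnLp Ω ⊤ k := by
  refine h.isBoundedOnLp_of_eLpNorm_le hvol le_top hAt fun f hf => ?_
  rw [eLpNorm_exponent_top, eLpNorm_exponent_top]
  refine eLpNormEssSup_le_of_ae_enorm_bound ?_
  filter_upwards [ae_restrict_mem h.measurableSet] with z hz
  have hft : eLpNormEssSup f (volume.restrict Ω) ≠ ⊤ := by
    have := hf.2.ne
    rwa [eLpNorm_exponent_top] at this
  calc ‖integralOp Ω k f z‖ₑ ≤ ∫⁻ w in Ω, ‖k z w‖ₑ * ‖f w‖ₑ := enorm_integralOp_le f z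
    _ ≤ ∫⁻ w in Ω, ‖k z w‖ₑ * eLpNormEssSup f (volume.restrict Ω) := by
        refine lintegral_mono_ae ?_
        filter_upwards [enorm_ae_le_eLpNormEssSup f (volume.restrict Ω)] with w hw
        exact mul_le_mul_right hw _
    _ = (∫⁻ w in Ω, ‖k z w‖ₑ) * eLpNormEssSup f (volume.restrict Ω) :=
        lintegral_mul_const' _ _ hft
    _ ≤ A * eLpNormEssSup f (volume.restrict Ω) := mul_le_mul_left (hA z hz) _

theorem IsBoundedOnLp.eLpNorm_integralOp_le_lpOpNorm {p : ℝ≥0∞} (h : IsBoundedOnLp Ω p k)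
    {f : E → ℂ} (hf : MemLp f p (volume.restrict Ω)) :
    eLpNorm (integralOp Ω k f) p (volume.restrict Ω)
      ≤ lpOpNorm Ω p k * eLpNorm f p (volume.restrict Ω) := by
  obtain ⟨C, -, hC⟩ := h.2
  rcases eq_or_ne (eLpNorm f p (volume.restrict Ω)) 0 with h0 | h0
  · have := hC f hf
    rw [h0, mul_zero] at this
    rw [h0, mul_zero]
    exact this
  · rw [← ENNReal.div_le_iff h0 hf.2.ne]
    refine le_sInf fun C' hC' => ?_
    rw [ENNReal.div_le_iff h0 hf.2.ne]
    exact hC' f hf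

theorem IsBoundedOnLp.lpOpNorm_ne_top {p : ℝ≥0∞} (h : IsBoundedOnLp Ω p k) :
    lpOpNorm Ω p k ≠ ⊤ := by
  obtain ⟨C, hCt, hC⟩ := h.2
  have hle : lpOpNorm Ω p k ≤ C := sInf_le hC
  exact (hle.trans_lt hCt.lt_top).ne

/-- For a kernel `k ≥ 0` the operator norm on complex-valued functions bounds the operator on
nonnegative functions. That the norm is not `0` is needed for functions outside `L^p`, because of
the convention `0 * ∞ = 0`. -/
theorem IsBoundedOnLp.isLpBoundedKernel {p : ℝ≥0∞} (hp0 : p ≠ 0) (hpt : p ≠ ⊤)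
    (h : IsBoundedOnLp Ω p k) (hΩ : MeasurableSet Ω) (hk : ∀ z w, 0 ≤ k z w)
    (hN : lpOpNorm Ω p k ≠ 0) :
    IsLpBoundedKernel (volume.restrict Ω) (fun z w => ‖k z w‖ₑ) p.toReal
      (lpOpNorm Ω p k ^ p.toReal) := by
  intro f hf
  have hP : 0 < p.toReal := ENNReal.toReal_pos hp0 hpt
  rcases eq_or_ne (∫⁻ w in Ω, f w ^ p.toReal) ⊤ with htop | hfin
  · rw [htop, ENNReal.mul_top]
    · exact le_top
    · simp [hN, hP.le]
  have hft : ∀ᵐ w ∂(volume.restrict Ω), f w ≠ ⊤ := by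
    filter_upwards [ae_lt_top (hf.pow_const _) hfin] with w hw
    rintro e
    rw [e, ENNReal.top_rpow_of_pos hP] at hw
    exact lt_irrefl _ hw
  set F : E → ℂ := fun w => ((f w).toReal : ℂ) with hF
  have hFe : ∀ᵐ w ∂(volume.restrict Ω), ‖F w‖ₑ = f w := by
    filter_upwards [hft] with w hw
    rw [hF, ← ofReal_norm, Complex.norm_real, Real.norm_of_nonneg ENNReal.toReal_nonneg,
      ENNReal.ofReal_toReal hw]
  have hFp : ∫⁻ w in Ω, ‖F w‖ₑ ^ p.toReal = ∫⁻ w in Ω, f w ^ p.toReal := by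
    refine lintegral_congr_ae ?_
    filter_upwards [hFe] with w hw
    rw [hw]
  have hFm : MemLp F p (volume.restrict Ω) := by
    refine ⟨(Complex.measurable_ofReal.comp hf.ennreal_toReal).aestronglyMeasurable, ?_⟩
    rw [eLpNorm_lt_top_iff_lintegral_rpow_enorm_lt_top hp0 hpt, hFp]
    exact hfin.lt_top
  have hop : ∀ z ∈ Ω, ‖integralOp Ω k F z‖ₑ = ∫⁻ w in Ω, ‖k z w‖ₑ * f w := by
    intro z hz
    have hint := (h.1 F hFm).1 z hz
    have hre : Integrable (fun w => k z w * (f w).toReal) (volume.restrict Ω) := by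
      refine hint.re.congr (Eventually.of_forall fun w => ?_)
      simp [hF]
    have e : integralOp Ω k F z = ((∫ w in Ω, k z w * (f w).toReal : ℝ) : ℂ) := by
      rw [integralOp, ← integral_complex_ofReal]
      simp [hF]
    have hnn : ∀ w, 0 ≤ k z w * (f w).toReal := fun w =>
      mul_nonneg (hk z w) ENNReal.toReal_nonneg
    rw [e, ← ofReal_norm, Complex.norm_real,
      Real.norm_of_nonneg (integral_nonneg hnn),
      ofReal_integral_eq_lintegral_ofReal hre (Eventually.of_forall hnn)]
    refine lintegral_congr_ae ?_
    filter_upwards [hft] with w hw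
    rw [ENNReal.ofReal_mul (hk z w), ENNReal.ofReal_toReal hw, ← ofReal_norm,
      Real.norm_of_nonneg (hk z w)]
  have hle := h.eLpNorm_integralOp_le_lpOpNorm hFm
  rw [eLpNorm_eq_lintegral_rpow_enorm_toReal hp0 hpt,
    eLpNorm_eq_lintegral_rpow_enorm_toReal hp0 hpt, hFp, one_div, ENNReal.rpow_inv_le_iff hP,
    ENNReal.mul_rpow_of_nonneg _ _ hP.le,
    ENNReal.rpow_inv_rpow hP.ne'] at hle
  rwa [setLIntegral_congr_fun hΩ fun z hz => by rw [hop z hz]] at hle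

end IntegralOp

/-! ### The absolute Bergman projection and the Berezin transform -/

section Projection

variable {n : ℕ} [NeZero n] {Ω : Set (Fin n → ℂ)}

theorem IsSharpBTypeDomain.volume_ne_top (h : IsSharpBTypeDomain Ω) : volume Ω ≠ ⊤ :=
  h.isBounded.measure_lt_top.ne

theorem IsSharpBTypeDomain.exists_isReproducingAt (h : IsSharpBTypeDomain Ω) :
    ∀ z ∈ Ω, ∃ k, IsReproducingAt Ω z k := fun _ hz => _root_.exists_isReproducingAt h.isOpen hz

theorem IsSharpBTypeDomain.exists_norm_kernel_le (h : IsSharpBTypeDomain Ω) :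
    ∃ A : ℝ, ∀ z ∈ Ω, ∀ w ∈ Ω, ‖bergmanKernel Ω z w‖ ≤ A * (bergmanKernel Ω z z).re := by
  obtain ⟨r, hr, hB⟩ := h.sharpBType
  exact exists_norm_kernel_le_mul_self h.isOpen h.isBounded h.offDiagonal hr hB

theorem IsSharpBTypeDomain.isRegularKernel (h : IsSharpBTypeDomain Ω) :
    IsRegularKernel Ω (absBergmanKernel Ω) where
  measurableSet := h.isOpen.measurableSet
  measurable := by
    have := (measurable_indicator_bergmanKernel h.exists_isReproducingAt h.isOpen).norm
    convert! this using 2 with x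
    rw [norm_indicator_eq_indicator_norm]
    rfl
  bounded := by
    obtain ⟨A, hA⟩ := h.exists_norm_kernel_le
    intro z hz
    refine ⟨A * (bergmanKernel Ω z z).re, fun w hw => ?_⟩
    rw [absBergmanKernel, abs_of_nonneg (norm_nonneg _)]
    exact hA z hz w hw

/-- The kernel `|K_Ω|`, set to `0` outside `Ω × Ω`; there it is measurable on the whole space. -/
noncomputable def absKernelExt (Ω : Set (Fin n → ℂ)) (z w : Fin n → ℂ) : ℝ≥0∞ :=
  ‖(Ω ×ˢ Ω).indicator (fun x => bergmanKernel Ω x.1 x.2) (z, w)‖ₑ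

omit [NeZero n] in
theorem absKernelExt_of_mem {z w : Fin n → ℂ} (hz : z ∈ Ω) (hw : w ∈ Ω) :
    absKernelExt Ω z w = ‖bergmanKernel Ω z w‖ₑ := by
  rw [absKernelExt, indicator_of_mem (show (z, w) ∈ Ω ×ˢ Ω from ⟨hz, hw⟩)]

theorem IsSharpBTypeDomain.measurable_absKernelExt (h : IsSharpBTypeDomain Ω) :
    Measurable (Function.uncurry (absKernelExt Ω)) :=
  (measurable_indicator_bergmanKernel h.exists_isReproducingAt h.isOpen).enorm

/-- The absolute Bergman projection satisfies Schur's test with the function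
`|r| ^ (-1 / (p q))`. -/
theorem IsSharpBTypeDomain.exists_isLpBoundedKernel (h : IsSharpBTypeDomain Ω) {p : ℝ}
    (hp : 1 < p) : ∃ A : ℝ≥0∞, A ≠ ⊤ ∧
      IsLpBoundedKernel (volume.restrict Ω) (absKernelExt Ω) p A := by
  obtain ⟨r, hr, hB⟩ := h.sharpBType
  have hpq := Real.HolderConjugate.conjExponent hp
  set q := p.conjExponent with hq
  have hp0 := hpq.pos
  have hq0 := hpq.symm.pos
  have hq1 : 1 < q := hpq.symm.lt
  obtain ⟨A, hA, h1⟩ := exists_lintegral_kernel_le h.isOpen h.isBounded h.offDiagonal hr hB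
    (s := 1 / p) (by positivity) ((div_lt_one hp0).2 hp)
  obtain ⟨A', hA', h2⟩ := exists_lintegral_kernel_le h.isOpen h.isBounded h.offDiagonal hr hB
    (s := 1 / q) (by positivity) ((div_lt_one hq0).2 hq1)
  have hrm := hr.differentiable.continuous.measurable
  have hΩm := h.isOpen.measurableSet
  have hM : max A A' ≠ ⊤ := (max_lt hA.lt_top hA'.lt_top).ne
  have hw : ∀ t : ℝ, 0 < t → ∀ z ∈ Ω, ENNReal.ofReal (|r z| ^ (-(1 / (p * q)))) ^ t
      = ENNReal.ofReal (|r z| ^ (-(1 / (p * q)) * t)) := by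
    intro t ht z hz
    have hrz : 0 < |r z| := abs_pos.2 (hr.neg hz).ne
    rw [ENNReal.ofReal_rpow_of_pos (by positivity), ← Real.rpow_mul hrz.le]
  have ep : -(1 / (p * q)) * p = -(1 / q) := by field_simp
  have eq : -(1 / (p * q)) * q = -(1 / p) := by field_simp
  refine ⟨max A A' ^ (p / q) * max A A',
    ENNReal.mul_ne_top (ENNReal.rpow_ne_top_of_nonneg (by positivity) hM) hM,
    isLpBoundedKernel_of_schur (h := fun z => ENNReal.ofReal (|r z| ^ (-(1 / (p * q)))))
      h.measurable_absKernelExt hpq (by fun_prop) ?_ ?_ ?_⟩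
  · filter_upwards [ae_restrict_mem hΩm] with z hz
    have hrz : 0 < |r z| := abs_pos.2 (hr.neg hz).ne
    exact ⟨(ENNReal.ofReal_pos.2 (by positivity)).ne', ENNReal.ofReal_ne_top⟩
  · filter_upwards [ae_restrict_mem hΩm] with z hz
    rw [setLIntegral_congr_fun hΩm fun w hw' => by
      rw [absKernelExt_of_mem hz hw', hw q hq0 w hw', eq], hw q hq0 z hz, eq]
    exact (h1 z hz).trans (mul_le_mul_left (le_max_left _ _) _)
  · filter_upwards [ae_restrict_mem hΩm] with w hw'
    rw [setLIntegral_congr_fun hΩm fun z hz => by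
      rw [absKernelExt_of_mem hz hw', hw p hp0 z hz, ep, ← ofReal_norm,
        norm_bergmanKernel_comm h.exists_isReproducingAt hw' hz, ofReal_norm],
      hw p hp0 w hw', ep]
    exact (h2 w hw').trans (mul_le_mul_left (le_max_right _ _) _)

theorem IsSharpBTypeDomain.isBoundedOnLp (h : IsSharpBTypeDomain Ω) {p : ℝ≥0∞} (hp : 1 < p)
    (hpt : p < ⊤) : IsBoundedOnLp Ω p (absBergmanKernel Ω) := by
  obtain ⟨A, hAt, hA⟩ := h.exists_isLpBoundedKernel (p := p.toReal)
    (by rw [← ENNReal.toReal_one]; exact ENNReal.toReal_strict_mono hpt.ne hp)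
  refine h.isRegularKernel.isBoundedOnLp h.volume_ne_top hp.le hpt.ne
    (A := 1 ^ p.toReal * A) (by simpa using hAt)
    (hA.mono_restrict h.isOpen.measurableSet ENNReal.toReal_nonneg fun z hz w hw => ?_)
  rw [absKernelExt_of_mem hz hw, one_mul, absBergmanKernel, enorm_norm]

/-- As `P⁺ 1 ≥ 1`, the norm of the absolute Bergman projection is at least `1`. -/
theorem IsSharpBTypeDomain.lpOpNorm_ne_zero (h : IsSharpBTypeDomain Ω) {p : ℝ≥0∞} (hp : p ≠ 0) :
    lpOpNorm Ω p (absBergmanKernel Ω) ≠ 0 := by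
  have hvol := h.volume_ne_top
  have : IsFiniteMeasure (volume.restrict Ω) := ⟨by
    rw [Measure.restrict_apply_univ]; exact hvol.lt_top⟩
  have hne : volume.restrict Ω ≠ 0 := by
    rw [Ne, Measure.restrict_eq_zero]
    exact (h.isOpen.measure_pos volume h.isConnected.nonempty).ne'
  have hone : MemLp (fun _ : Fin n → ℂ => (1 : ℂ)) p (volume.restrict Ω) := memLp_const 1
  have hone0 : eLpNorm (fun _ : Fin n → ℂ => (1 : ℂ)) p (volume.restrict Ω) ≠ 0 := by
    rw [Ne, eLpNorm_eq_zero_iff hone.1 hp]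
    intro h0
    obtain ⟨x, hx⟩ := (ae_neBot.2 hne).nonempty_of_mem h0
    simp at hx
  have hge : ∀ z ∈ Ω, 1 ≤ ‖integralOp Ω (absBergmanKernel Ω) (fun _ => 1) z‖ := by
    intro z hz
    have hrep := isReproducingAt_bergmanKernel (h.exists_isReproducingAt z hz)
    have h1 := hrep.2 (fun _ => 1) ⟨differentiableOn_const 1, memLp_const 1⟩
    have h2 := norm_integral_le_integral_norm (μ := volume.restrict Ω)
      (fun w => (1 : ℂ) * (starRingEnd ℂ) (bergmanKernel Ω w z))
    rw [h1] at h2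
    have e : integralOp Ω (absBergmanKernel Ω) (fun _ => 1) z
        = ((∫ w in Ω, ‖bergmanKernel Ω w z‖ : ℝ) : ℂ) := by
      rw [integralOp, ← integral_complex_ofReal]
      refine setIntegral_congr_fun h.isOpen.measurableSet fun w hw => ?_
      simp only [mul_one, absBergmanKernel]
      rw [norm_bergmanKernel_comm h.exists_isReproducingAt hw hz]
    rw [e, Complex.norm_real, Real.norm_of_nonneg (integral_nonneg fun _ => norm_nonneg _)]
    simpa using h2
  have hone_le : 1 ≤ lpOpNorm Ω p (absBergmanKernel Ω) := by
    refine le_sInf fun C hC => ?_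
    have h1 : eLpNorm (fun _ : Fin n → ℂ => (1 : ℂ)) p (volume.restrict Ω)
        ≤ eLpNorm (integralOp Ω (absBergmanKernel Ω) fun _ => 1) p (volume.restrict Ω) := by
      refine eLpNorm_mono_ae ?_
      filter_upwards [ae_restrict_mem h.isOpen.measurableSet] with z hz
      rw [norm_one]
      exact hge z hz
    have h2 := h1.trans (hC _ hone)
    rw [← ENNReal.div_le_iff hone0 hone.2.ne, ENNReal.div_self hone0 hone.2.ne] at h2
    exact h2
  exact (zero_lt_one.trans_le hone_le).ne'

end Projection

section Berezin

variable {E : Type*} [NormedAddCommGroup E] [NormedSpace ℂ E] [MeasureSpace E] {Ω : Set E}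

theorem enorm_kernel_div_le {z w : E} (hz : z ∈ Ω) (hw : w ∈ Ω) :
    ‖bergmanKernel Ω w z‖ₑ / ‖bergmanKernel Ω z z‖ₑ ≤ kernelRatioSup Ω :=
  le_iSup₂_of_le (f := fun z (_ : z ∈ Ω) => ⨆ w ∈ Ω, ‖bergmanKernel Ω w z‖ₑ /
    ‖bergmanKernel Ω z z‖ₑ) z hz (le_iSup₂_of_le (f := fun w (_ : w ∈ Ω) =>
      ‖bergmanKernel Ω w z‖ₑ / ‖bergmanKernel Ω z z‖ₑ) w hw le_rfl)

variable (hex : ∀ z ∈ Ω, ∃ k, IsReproducingAt Ω z k)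

include hex

theorem berezinKernel_eq {z : E} (hz : z ∈ Ω) (w : E) :
    berezinKernel Ω z w = ‖bergmanKernel Ω w z‖ ^ 2 / ‖bergmanKernel Ω z z‖ := by
  rw [berezinKernel, normalizedKernel, norm_div, Complex.norm_real, div_pow,
    Real.norm_of_nonneg (Real.sqrt_nonneg _), norm_bergmanKernel_self hex hz, Real.sq_sqrt]
  rw [← norm_bergmanKernel_self hex hz]
  exact norm_nonneg _

theorem enorm_berezinKernel_le {z w : E} (hz : z ∈ Ω) (hw : w ∈ Ω)
    (hne : bergmanKernel Ω z z ≠ 0) :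
    ‖berezinKernel Ω z w‖ₑ ≤ kernelRatioSup Ω * ‖bergmanKernel Ω z w‖ₑ := by
  have hpos : 0 < ‖bergmanKernel Ω z z‖ := norm_pos_iff.2 hne
  refine le_trans (le_of_eq ?_) (mul_le_mul_left (enorm_kernel_div_le hz hw) _)
  rw [← ofReal_norm, ← ofReal_norm, ← ofReal_norm, ← ofReal_norm,
    ← ENNReal.ofReal_div_of_pos hpos, ← ENNReal.ofReal_mul (by positivity),
    berezinKernel_eq hex hz, Real.norm_of_nonneg (by positivity),
    ← norm_bergmanKernel_comm hex hz hw]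
  congr 1
  ring

/-- `|k_z|² dV` has total mass at most `1`, because `K(z, z)` is the square of the norm of
`K(·, z)`. -/
theorem lintegral_berezinKernel_le {z : E} (hz : z ∈ Ω) :
    ∫⁻ w in Ω, ‖berezinKernel Ω z w‖ₑ ≤ 1 := by
  have hrep := (isReproducingAt_bergmanKernel (hex z hz)).1
  have hint := (memLp_two_iff_integrable_sq_norm hrep.2.1).1 hrep.2
  calc ∫⁻ w in Ω, ‖berezinKernel Ω z w‖ₑ
      = ∫⁻ w in Ω, ENNReal.ofReal (‖bergmanKernel Ω w z‖ ^ 2 / ‖bergmanKernel Ω z z‖) := by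
        refine lintegral_congr fun w => ?_
        rw [← ofReal_norm, berezinKernel_eq hex hz, Real.norm_of_nonneg (by positivity)]
    _ = ENNReal.ofReal (∫ w in Ω, ‖bergmanKernel Ω w z‖ ^ 2 / ‖bergmanKernel Ω z z‖) :=
        (ofReal_integral_eq_lintegral_ofReal (hint.div_const _)
          (Eventually.of_forall fun w => by positivity)).symm
    _ = ENNReal.ofReal (‖bergmanKernel Ω z z‖ / ‖bergmanKernel Ω z z‖) := by
        rw [integral_div, ← bergmanKernel_self_re hex hz, norm_bergmanKernel_self hex hz]
    _ ≤ 1 := by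
        rw [← ENNReal.ofReal_one]
        exact ENNReal.ofReal_le_ofReal (div_self_le_one _)

theorem isRegularKernel_berezinKernel [SecondCountableTopology E] [BorelSpace E] (hΩ : IsOpen Ω)
    (hne : ∀ z ∈ Ω, bergmanKernel Ω z z ≠ 0) (hS : kernelRatioSup Ω ≠ ⊤) :
    IsRegularKernel Ω (berezinKernel Ω) where
  measurableSet := hΩ.measurableSet
  measurable := by
    have hg := measurable_indicator_bergmanKernel hex hΩ
    set g := (Ω ×ˢ Ω).indicator fun p : E × E => bergmanKernel Ω p.1 p.2 with hgdef
    have h1 : Measurable fun x : E × E => ‖g (x.2, x.1)‖ ^ 2 / ‖g (x.1, x.1)‖ :=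
      ((hg.comp (measurable_snd.prodMk measurable_fst)).norm.pow_const 2).div
        (hg.comp (measurable_fst.prodMk measurable_fst)).norm
    convert! h1 using 1
    ext ⟨z, w⟩
    by_cases hz : z ∈ Ω
    · by_cases hw : w ∈ Ω
      · rw [indicator_of_mem (show (z, w) ∈ Ω ×ˢ Ω from ⟨hz, hw⟩)]
        simp only [hgdef, Function.uncurry]
        rw [indicator_of_mem (show (w, z) ∈ Ω ×ˢ Ω from ⟨hw, hz⟩),
          indicator_of_mem (show (z, z) ∈ Ω ×ˢ Ω from ⟨hz, hz⟩), berezinKernel_eq hex hz]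
      · simp [hgdef, hw]
    · simp [hgdef, hz]
  bounded := by
    intro z hz
    refine ⟨(kernelRatioSup Ω).toReal ^ 2 * ‖bergmanKernel Ω z z‖, fun w hw => ?_⟩
    have hpos : 0 < ‖bergmanKernel Ω z z‖ := norm_pos_iff.2 (hne z hz)
    have h2 : ‖bergmanKernel Ω w z‖ / ‖bergmanKernel Ω z z‖ ≤ (kernelRatioSup Ω).toReal := by
      have := ENNReal.toReal_mono hS (enorm_kernel_div_le hz hw)
      simpa using this
    rw [abs_of_nonneg (by rw [berezinKernel_eq hex hz]; positivity), berezinKernel_eq hex hz]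
    have e : ‖bergmanKernel Ω w z‖ ^ 2 / ‖bergmanKernel Ω z z‖
        = (‖bergmanKernel Ω w z‖ / ‖bergmanKernel Ω z z‖) ^ 2 * ‖bergmanKernel Ω z z‖ := by
      field_simp
    rw [e]
    gcongr

end Berezin

/-! ### Products of domains of sharp `𝓑`-type -/

section ProductDomain

variable {m : ℕ} {n : Fin m → ℕ} [∀ j, NeZero (n j)] {Ωs : (j : Fin m) → Set (Fin (n j) → ℂ)}

/-- By the product formula, the ratio `|K(w, z)| / K(z, z)` of a product is the product of the
ratios of the factors. -/
theorem kernelRatioSup_pi_ne_top (h : ∀ j, IsSharpBTypeDomain (Ωs j)) :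
    kernelRatioSup (univ.pi Ωs) ≠ ⊤ := by
  choose A hA using fun j => (h j).exists_norm_kernel_le
  have hex := fun j => (h j).exists_isReproducingAt
  have hm : ∀ j, MeasurableSet (Ωs j) := fun j => (h j).isOpen.measurableSet
  have hle : kernelRatioSup (univ.pi Ωs) ≤ ENNReal.ofReal (∏ j, A j) := by
    refine iSup₂_le fun z hz => iSup₂_le fun w hw => ?_
    have hpos : ∀ j, 0 < ‖bergmanKernel (Ωs j) (z j) (z j)‖ := fun j => by
      rw [norm_bergmanKernel_self (hex j) (hz j (mem_univ j))]
      exact bergmanKernel_self_re_pos (hex j) (h j).volume_ne_top (hz j (mem_univ j))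
    have hpos' : 0 < ‖bergmanKernel (univ.pi Ωs) z z‖ := by
      rw [bergmanKernel_pi hm hex hz hz, norm_prod]
      exact Finset.prod_pos fun j _ => hpos j
    rw [← ofReal_norm, ← ofReal_norm, ← ENNReal.ofReal_div_of_pos hpos']
    refine ENNReal.ofReal_le_ofReal ?_
    rw [bergmanKernel_pi hm hex hz hz, bergmanKernel_pi hm hex hz hw, norm_prod, norm_prod,
      ← Finset.prod_div_distrib]
    refine Finset.prod_le_prod (fun j _ => by positivity) fun j _ => ?_
    rw [div_le_iff₀ (hpos j), norm_bergmanKernel_self (hex j) (hz j (mem_univ j)),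
      norm_bergmanKernel_comm (hex j) (hz j (mem_univ j)) (hw j (mem_univ j))]
    exact hA j _ (hz j (mem_univ j)) _ (hw j (mem_univ j))
  exact (hle.trans_lt ENNReal.ofReal_lt_top).ne

/-- The Berezin kernel is dominated by the supremum of the kernel ratio times the product of the
absolute kernels of the factors. -/
theorem isLpBoundedKernel_berezinKernel_pi (h : ∀ j, IsSharpBTypeDomain (Ωs j))
    (hne : ∀ z ∈ univ.pi Ωs, bergmanKernel (univ.pi Ωs) z z ≠ 0) {p : ℝ≥0∞} (hp : 1 < p)
    (hpt : p < ⊤) :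
    IsLpBoundedKernel (volume.restrict (univ.pi Ωs))
      (fun z w => ‖berezinKernel (univ.pi Ωs) z w‖ₑ) p.toReal
      ((kernelRatioSup (univ.pi Ωs) * ∏ j, lpOpNorm (Ωs j) p (absBergmanKernel (Ωs j)))
        ^ p.toReal) := by
  have hex := fun j => (h j).exists_isReproducingAt
  have hm : ∀ j, MeasurableSet (Ωs j) := fun j => (h j).isOpen.measurableSet
  have hp0 : p ≠ 0 := (zero_lt_one.trans hp).ne'
  have hfac : ∀ j, IsLpBoundedKernel (volume.restrict (Ωs j)) (absKernelExt (Ωs j)) p.toReal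
      (lpOpNorm (Ωs j) p (absBergmanKernel (Ωs j)) ^ p.toReal) := by
    intro j
    have h1 := ((h j).isBoundedOnLp hp hpt).isLpBoundedKernel hp0 hpt.ne (hm j)
      (fun _ _ => norm_nonneg _) ((h j).lpOpNorm_ne_zero hp0)
    have h2 := h1.mono_restrict (hm j) (k := absKernelExt (Ωs j)) (S := 1)
      ENNReal.toReal_nonneg fun z hz w hw => by
        rw [absKernelExt_of_mem hz hw, one_mul, absBergmanKernel, enorm_norm]
    simpa using h2
  have hprod := IsLpBoundedKernel.pi (fun j => (h j).measurable_absKernelExt) hfac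
  rw [← restrict_univ_pi] at hprod
  have hfin := hprod.mono_restrict (MeasurableSet.univ_pi hm)
    (k := fun z w => ‖berezinKernel (univ.pi Ωs) z w‖ₑ) (S := kernelRatioSup (univ.pi Ωs))
    ENNReal.toReal_nonneg fun z hz w hw => by
      refine (enorm_berezinKernel_le (exists_isReproducingAt_pi hm hex) hz hw (hne z hz)).trans
        (le_of_eq ?_)
      congr 1
      rw [bergmanKernel_pi hm hex hw hz, ← ofReal_norm, norm_prod,
        ENNReal.ofReal_prod_of_nonneg fun _ _ => norm_nonneg _]
      refine Finset.prod_congr rfl fun j _ => ?_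
      rw [absKernelExt_of_mem (hz j (mem_univ j)) (hw j (mem_univ j)), ofReal_norm]
  rw [ENNReal.mul_rpow_of_nonneg _ _ ENNReal.toReal_nonneg,
    ← ENNReal.prod_rpow_of_nonneg ENNReal.toReal_nonneg]
  exact hfin

end ProductDomain

theorem theorem1 (m : ℕ) (n : Fin m → ℕ) [∀ j, NeZero (n j)]
    (Ωs : (j : Fin m) → Set (Fin (n j) → ℂ)) (hΩs : ∀ j, IsSharpBTypeDomain (Ωs j))
    (Ω : Set ((j : Fin m) → Fin (n j) → ℂ)) (hΩ : Ω = {z | ∀ j, z j ∈ Ωs j}) :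
    (∀ p : ℝ≥0∞, 1 < p → IsBoundedOnLp Ω p (berezinKernel Ω)) ∧
    (∀ z ∈ Ω, bergmanKernel Ω z z ≠ 0) ∧
    kernelRatioSup Ω ≠ ⊤ ∧
    (∀ p : ℝ≥0∞, 1 < p → p < ⊤ →
      (∀ j, IsBoundedOnLp (Ωs j) p (absBergmanKernel (Ωs j))) ∧
      lpOpNorm Ω p (berezinKernel Ω) ≤
        kernelRatioSup Ω * ∏ j, lpOpNorm (Ωs j) p (absBergmanKernel (Ωs j))) := by
  obtain rfl : Ω = univ.pi Ωs := by rw [hΩ]; ext z; simp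
  have hm : ∀ j, MeasurableSet (Ωs j) := fun j => (hΩs j).isOpen.measurableSet
  have hex := exists_isReproducingAt_pi hm fun j => (hΩs j).exists_isReproducingAt
  have hopen : IsOpen (univ.pi Ωs) := isOpen_set_pi finite_univ fun j _ => (hΩs j).isOpen
  have hvol : volume (univ.pi Ωs) ≠ ⊤ := by
    rw [volume_pi_pi]
    exact ENNReal.prod_ne_top fun j _ => (hΩs j).volume_ne_top
  have hne : ∀ z ∈ univ.pi Ωs, bergmanKernel (univ.pi Ωs) z z ≠ 0 := fun z hz => by
    rw [← norm_pos_iff, norm_bergmanKernel_self hex hz]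
    exact bergmanKernel_self_re_pos hex hvol hz
  have hS := kernelRatioSup_pi_ne_top hΩs
  have hreg := isRegularKernel_berezinKernel hex hopen hne hS
  refine ⟨fun p hp => ?_, hne, hS, fun p hp hpt =>
    ⟨fun j => (hΩs j).isBoundedOnLp hp hpt, ?_⟩⟩
  · rcases eq_or_ne p ⊤ with rfl | hpt
    · exact hreg.isBoundedOnLp_top hvol ENNReal.one_ne_top fun z hz =>
        lintegral_berezinKernel_le hex hz
    · refine hreg.isBoundedOnLp hvol hp.le hpt ?_
        (isLpBoundedKernel_berezinKernel_pi hΩs hne hp hpt.lt_top)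
      exact ENNReal.rpow_ne_top_of_nonneg ENNReal.toReal_nonneg (ENNReal.mul_ne_top hS
        (ENNReal.prod_ne_top fun j _ => ((hΩs j).isBoundedOnLp hp hpt.lt_top).lpOpNorm_ne_top))
  · have hP : p.toReal ≠ 0 := (ENNReal.toReal_pos (zero_lt_one.trans hp).ne' hpt.ne).ne'
    have h := lpOpNorm_le (zero_lt_one.trans hp).ne' hpt.ne
      (isLpBoundedKernel_berezinKernel_pi hΩs hne hp hpt)
    rwa [one_div, ENNReal.rpow_rpow_inv hP] at h
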